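/- Let $G$ be a biconnected undirected simple graph, that is, a connected graph without a cut vertex, with $n\ge 3$ vertices and feedback edge number $k$ (the minimum number of edges whose deletion turns $G$ into a forest), and let $\mathrm{Pen}\colon V(G)\to\mathbb{N}$ be vertex weights. For $s,t,v\in V(G)$ let $\sigma_{st}$ be the number of shortest $s$-$t$-paths, let $\sigma_{st}(v)$ be the number of shortest $s$-$t$-paths that contain $v$, with $\sigma_{st}(v)=0$ if $v\in\{s,t\}$, and let $\gamma(s,t,v)=\mathrm{Pen}[s]\cdot\mathrm{Pen}[t]\cdot\sigma_{st}(v)/\sigma_{st}$. A maximal induced path of $G$ is a path $v_0v_1\ldots v_\ell$ in $G$ (a subgraph, not distinguished from its reverse; the vertices $v_i$ are pairwise distinct) with $\ell\ge 2$ such that $\deg_G(v_1)=\dots=\deg_G(v_{\ell-1})=2$, $\deg_G(v_0)\ne 2$ and $\deg_G(v_\ell)\ne 2$. Let $\mathcal{P}^{\max}$ be the set of all maximal induced paths of $G$, and for $P\in\mathcal{P}^{\max}$ let $V^{=2}(P)$ be the set of vertices of $P$ of degree two in $G$. Then, given $n$, the adjacency lists of $G$ and the weights $\mathrm{Pen}$,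 one can compute in $O(kn)$ time the values $$\sum_{P\in\mathcal{P}^{\max}}\ \sum_{s,t\in V^{=2}(P)}\gamma(s,t,v)\qquad\text{for all } v\in V(G),$$ where $s,t$ ranges over ordered pairs. That is, there are a single program for a unit-cost random access machine and constants $C,d$ such that on every such input the program halts after at most $C\cdot k\cdot n$ steps with these values in its memory. The machine has words bounded by $n^{d}$ for indexing and control flow, and it has cells for rational numbers, on which each of the four exact arithmetic operations takes one step (there is no rounding of and no branching on rational numbers). -/

import Mathlib

/-! ### Graph notions -/

namespace BetweennessPaths

variable {V : Type*}

/-- A cut vertex is a vertex whose removal disconnects the graph. -/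
def IsCutVertex (G : SimpleGraph V) (v : V) : Prop :=
  ¬ (G.induce {v}ᶜ).Preconnected

/-- Connected and without cut vertices. -/
def IsBiconnected (G : SimpleGraph V) : Prop :=
  G.Connected ∧ ∀ v, ¬ IsCutVertex G v

/-- The minimum number of edges whose deletion turns `G` into a forest. -/
noncomputable def feedbackEdgeNumber (G : SimpleGraph V) : ℕ :=
  sInf {c | ∃ F : Finset (Sym2 V),
    (F : Set (Sym2 V)) ⊆ G.edgeSet ∧ (G.deleteEdges (F : Set (Sym2 V))).IsAcyclic ∧ F.card = c}

/-- The set of shortest paths from `s` to `t`. -/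
def shortestPaths (G : SimpleGraph V) (s t : V) : Set (G.Walk s t) :=
  {p | p.IsPath ∧ p.length = G.dist s t}

/-- `σ_{st}`: the number of shortest paths from `s` to `t`. -/
noncomputable def sigma (G : SimpleGraph V) (s t : V) : ℕ :=
  (shortestPaths G s t).ncard

open Classical in
/-- `σ_{st}(v)`: the number of shortest paths from `s` to `t` that visit `v`, and `0` if `v` is
one of the endpoints. -/
noncomputable def sigmaThrough (G : SimpleGraph V) (s t v : V) : ℕ :=
  if v = s ∨ v = t then 0 else {p ∈ shortestPaths G s t | v ∈ p.support}.ncard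

/-- `γ(s,t,v) = Pen[s] · Pen[t] · σ_{st}(v) / σ_{st}`. -/
noncomputable def gamma (G : SimpleGraph V) (pen : V → ℕ) (s t v : V) : ℚ :=
  pen s * pen t * (sigmaThrough G s t v / sigma G s t)

open Classical in
/-- A path of length at least two (given by a traversal of it) is a maximal induced path if all
its inner vertices have degree two in `G` and its two endpoints do not. -/
noncomputable def IsMaximalInducedPath [Fintype V] (G : SimpleGraph V) {u w : V}
    (p : G.Walk u w) : Prop :=
  p.IsPath ∧ 2 ≤ p.length ∧ G.degree u ≠ 2 ∧ G.degree w ≠ 2 ∧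
    ∀ x ∈ p.support, x ≠ u → x ≠ w → G.degree x = 2

/-- The set of all maximal induced paths. A path is a subgraph here, so that a path and its
reverse are the same element. -/
def maximalInducedPaths [Fintype V] (G : SimpleGraph V) : Set G.Subgraph :=
  {P | ∃ (u w : V) (p : G.Walk u w), IsMaximalInducedPath G p ∧ p.toSubgraph = P}

open Classical in
/-- The degree-two vertices of `G` that lie on `P`. -/
noncomputable def degreeTwoVerts [Fintype V] (G : SimpleGraph V) (P : G.Subgraph) : Finset V :=
  {s | s ∈ P.verts ∧ G.degree s = 2}

/-- The sum of `γ(s,t,v)` over all maximal induced paths `P` and all ordered pairs of degree-two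
vertices `s`, `t` of `P`. -/
noncomputable def samePathSum [Fintype V] (G : SimpleGraph V) (pen : V → ℕ) (v : V) : ℚ :=
  ∑ P ∈ (maximalInducedPaths G).toFinite.toFinset,
    ∑ s ∈ degreeTwoVerts G P, ∑ t ∈ degreeTwoVerts G P, gamma G pen s t v

/-! ### The machine model

A random access machine with unit cost, programmed by structured programs. Its memory consists of
arrays (finitely many are named by a program) of two kinds of cells: machine words, which are
natural numbers up to a bound `B` and are used for indexing and for control flow, and rational
numbers, on which only the four arithmetic operations are available. No information flows from
rational cells to words: there is no rounding and no branching on rationals. -/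

/-- The memory: `word a i` and `rat a i` are the `i`-th cells of the `a`-th array of words and
of rationals. -/
structure Memory where
  word : ℕ → ℕ → ℕ
  rat : ℕ → ℕ → ℚ

/-- Word expressions; `sub` is truncated subtraction and `div` is division with rounding down. -/
inductive WordExpr where
  | const (c : ℕ)
  | get (a : ℕ) (i : WordExpr)
  | add (e f : WordExpr)
  | sub (e f : WordExpr)
  | mul (e f : WordExpr)
  | div (e f : WordExpr)

namespace WordExpr

def eval (M : Memory) : WordExpr → ℕ
  | const c => c
  | get a i => M.word a (i.eval M)
  | add e f => e.eval M + f.eval M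
  | sub e f => e.eval M - f.eval M
  | mul e f => e.eval M * f.eval M
  | div e f => e.eval M / f.eval M

/-- Every intermediate value of the evaluation, in particular every address, is a word. -/
def Fits (B : ℕ) (M : Memory) : WordExpr → Prop
  | const c => c ≤ B
  | get a i => i.Fits B M ∧ M.word a (i.eval M) ≤ B
  | add e f => e.Fits B M ∧ f.Fits B M ∧ e.eval M + f.eval M ≤ B
  | sub e f => e.Fits B M ∧ f.Fits B M
  | mul e f => e.Fits B M ∧ f.Fits B M ∧ e.eval M * f.eval M ≤ B
  | div e f => e.Fits B M ∧ f.Fits B M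

/-- Every constant, memory access and arithmetic operation costs one step. -/
def cost : WordExpr → ℕ
  | const _ => 1
  | get _ i => i.cost + 1
  | add e f => e.cost + f.cost + 1
  | sub e f => e.cost + f.cost + 1
  | mul e f => e.cost + f.cost + 1
  | div e f => e.cost + f.cost + 1

end WordExpr

/-- Rational expressions. -/
inductive RatExpr where
  | const (q : ℚ)
  | ofWord (e : WordExpr)
  | get (a : ℕ) (i : WordExpr)
  | add (e f : RatExpr)
  | sub (e f : RatExpr)
  | mul (e f : RatExpr)
  | div (e f : RatExpr)

namespace RatExpr

def eval (M : Memory) : RatExpr → ℚ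
  | const q => q
  | ofWord e => (e.eval M : ℚ)
  | get a i => M.rat a (i.eval M)
  | add e f => e.eval M + f.eval M
  | sub e f => e.eval M - f.eval M
  | mul e f => e.eval M * f.eval M
  | div e f => e.eval M / f.eval M

/-- All words that occur in the evaluation are within the bound, and there is no division by
zero. -/
def Fits (B : ℕ) (M : Memory) : RatExpr → Prop
  | const _ => True
  | ofWord e => e.Fits B M
  | get _ i => i.Fits B M
  | add e f => e.Fits B M ∧ f.Fits B M
  | sub e f => e.Fits B M ∧ f.Fits B M
  | mul e f => e.Fits B M ∧ f.Fits B M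
  | div e f => e.Fits B M ∧ f.Fits B M ∧ f.eval M ≠ 0

def cost : RatExpr → ℕ
  | const _ => 1
  | ofWord e => e.cost + 1
  | get _ i => i.cost + 1
  | add e f => e.cost + f.cost + 1
  | sub e f => e.cost + f.cost + 1
  | mul e f => e.cost + f.cost + 1
  | div e f => e.cost + f.cost + 1

end RatExpr

namespace Memory

def setWord (M : Memory) (a i x : ℕ) : Memory :=
  { M with word := Function.update M.word a (Function.update (M.word a) i x) }

def setRat (M : Memory) (a i : ℕ) (x : ℚ) : Memory :=
  { M with rat := Function.update M.rat a (Function.update (M.rat a) i x) }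

end Memory

/-- Programs. A condition is a word expression; it holds if its value is not zero. -/
inductive Prog where
  | skip
  | setWord (a : ℕ) (i e : WordExpr)
  | setRat (a : ℕ) (i : WordExpr) (e : RatExpr)
  | seq (p q : Prog)
  | cond (b : WordExpr) (p q : Prog)
  | loop (b : WordExpr) (p : Prog)

/-- `Runs B p M T M'`: on a machine whose words are bounded by `B`, the program `p` started with
memory `M` halts after `T` steps with memory `M'`. A program that produces a word larger than `B`
or divides a rational by zero is stuck and has no run. -/
inductive Runs (B : ℕ) : Prog → Memory → ℕ → Memory → Prop where
  | skip (M : Memory) : Runs B .skip M 1 M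
  | setWord (M : Memory) (a : ℕ) (i e : WordExpr) (hi : i.Fits B M) (he : e.Fits B M) :
      Runs B (.setWord a i e) M (i.cost + e.cost + 1) (M.setWord a (i.eval M) (e.eval M))
  | setRat (M : Memory) (a : ℕ) (i : WordExpr) (e : RatExpr) (hi : i.Fits B M)
      (he : e.Fits B M) :
      Runs B (.setRat a i e) M (i.cost + e.cost + 1) (M.setRat a (i.eval M) (e.eval M))
  | seq {p q : Prog} {M M' M'' : Memory} {T T' : ℕ} (hp : Runs B p M T M')
      (hq : Runs B q M' T' M'') : Runs B (.seq p q) M (T + T') M''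
  | condTrue {b : WordExpr} {p q : Prog} {M M' : Memory} {T : ℕ} (hb : b.Fits B M)
      (h : b.eval M ≠ 0) (hp : Runs B p M T M') : Runs B (.cond b p q) M (b.cost + 1 + T) M'
  | condFalse {b : WordExpr} {p q : Prog} {M M' : Memory} {T : ℕ} (hb : b.Fits B M)
      (h : b.eval M = 0) (hq : Runs B q M T M') : Runs B (.cond b p q) M (b.cost + 1 + T) M'
  | loopDone {b : WordExpr} {p : Prog} {M : Memory} (hb : b.Fits B M) (h : b.eval M = 0) :
      Runs B (.loop b p) M (b.cost + 1) M
  | loopStep {b : WordExpr} {p : Prog} {M M' M'' : Memory} {T T' : ℕ} (hb : b.Fits B M)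
      (h : b.eval M ≠ 0) (hp : Runs B p M T M') (hl : Runs B (.loop b p) M' T' M'') :
      Runs B (.loop b p) M (b.cost + 1 + T + T') M''

/-! ### Input -/

/-- `adj v` lists the neighbours of `v`, each of them once, in an arbitrary order. -/
def IsAdjacencyList {n : ℕ} (G : SimpleGraph (Fin n)) (adj : Fin n → List (Fin n)) : Prop :=
  ∀ v, (adj v).Nodup ∧ ∀ w, w ∈ adj v ↔ G.Adj v w

/-- The start of the block of vertex `i` in the concatenation of the adjacency lists; for `i = n`
the length of the concatenation. -/
def blockStart {n : ℕ} (adj : Fin n → List (Fin n)) (i : ℕ) : ℕ :=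
  (((List.finRange n).take i).map fun v => (adj v).length).sum

/-- The initial memory. Word array `0` holds `n` in its cell `0`; word array `2` holds the
concatenation of the adjacency lists of the vertices `0, …, n - 1`; word array `1` holds the `n + 1`
block boundaries, so that the neighbours of `v` are the cells of array `2` from position `word 1 v`
up to, but not including, position `word 1 (v + 1)`. Rational array `0` holds the vertex weights.
All other cells are zero. -/
def inputMemory {n : ℕ} (adj : Fin n → List (Fin n)) (pen : Fin n → ℕ) : Memory where
  word a i :=
    if a = 0 then (if i = 0 then n else 0)
    else if a = 1 then (if i ≤ n then blockStart adj i else 0)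
    else if a = 2 then (((List.finRange n).flatMap adj).map Fin.val).getD i 0
    else 0
  rat a i := if a = 0 then (if h : i < n then (pen ⟨i, h⟩ : ℚ) else 0) else 0

end BetweennessPaths

/-! Let `v_0 … v_L` be a maximal induced path, `D ≤ L` the distance of its ends and `N` the number
of shortest connections between them. For inner vertices `v_i`, `v_j` with `i < j` two kinds of
connection compete: the segment of length `j - i`, and the detours over both ends, of length `L + D
- (j - i)`. The share `α(j - i)` of the segment among the shortest paths is therefore `1`, `1/(N+1)`
or `0`, according to how `2(j - i)` compares with `L + D` (`dist_inner`, `sigma_inner`). If `D = L`,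
then `N` also counts the path itself, but in that case the segment always wins. Up to the two
weights, `γ(v_i, v_j, x)` is `α` for `x` strictly inside the segment, `1 - α` for the inner vertices
outside of it, and, for every `x` that is not inner, `1 - α` times the fraction of shortest
`v_0`-`v_L`-connections that visit `x` (`gamma_inner`, `gamma_outer`).

Since `α` is a step function with at most one intermediate value, its sums against the weights are
differences of prefix sums. The total weight of the indirectly connected pairs is thus available in
`O(L)` steps. For `v_r` this total is corrected by `2α - 1` for each pair around `r`, and the pairs
that end in `r` are taken out; a sweep along the path maintains the correction (`balance`,
`sum_pairs_inner`). The other vertices only need the total and breadth-first searches from the two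
ends. One path hence costs `O(n + m)` steps, where `m` is the number of edges.

A path is determined by its first edge (`IsChain.agree`), so all of them are found by following
every edge from a vertex whose degree is not two to one of degree two; the direction from the
smaller to the larger end is the one that is evaluated (`samePathSum_eq_sum_dartSum`). Let `X` be
the number of these directed edges. Each degree-two vertex is entered at most twice, so `X ≤ 2n`.
All degrees are at least two, so `X` is at most the sum of `deg ≤ 3(deg - 2)` over the vertices of
degree at least three, which is at most `6(m - n) ≤ 6k`. As `m < n + k`, the time `O((n + m) X)` is
`O(nX + kX) = O(kn)`: the first term uses `X ≤ 6k`, the second one `X ≤ 2n`. Beyond connectedness,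
biconnectedness is needed only for the minimum degree. -/

namespace BetweennessPaths

/-! ### Program logic -/

/-- `Wp B p M Q`: the program `p` started with memory `M` halts, after `T` steps with memory `M'`
such that `Q T M'` holds. -/
def Wp (B : ℕ) (p : Prog) (M : Memory) (Q : ℕ → Memory → Prop) : Prop :=
  ∃ T M', Runs B p M T M' ∧ Q T M'

section Logic

variable {B : ℕ} {p q : Prog} {M : Memory} {Q Q' : ℕ → Memory → Prop}

theorem Wp.imp (h : Wp B p M Q) (hQ : ∀ T M', Q T M' → Q' T M') : Wp B p M Q' := by
  obtain ⟨T, M', h1, h2⟩ := h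
  exact ⟨T, M', h1, hQ _ _ h2⟩

/-- The consequence rule that also provides the run, so that frame lemmas can be applied to it. -/
theorem Wp.imp_runs (h : Wp B p M Q) (hQ : ∀ T M', Runs B p M T M' → Q T M' → Q' T M') :
    Wp B p M Q' := by
  obtain ⟨T, M', h1, h2⟩ := h
  exact ⟨T, M', h1, hQ _ _ h1 h2⟩

theorem wp_skip : Wp B .skip M Q ↔ Q 1 M := by
  constructor
  · rintro ⟨T, M', h, hq⟩
    cases h
    exact hq
  · exact fun h => ⟨_, _, .skip M, h⟩

theorem wp_setWord {a : ℕ} {i e : WordExpr} : Wp B (.setWord a i e) M Q ↔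
    i.Fits B M ∧ e.Fits B M ∧ Q (i.cost + e.cost + 1) (M.setWord a (i.eval M) (e.eval M)) := by
  constructor
  · rintro ⟨T, M', h, hq⟩
    cases h
    exact ⟨‹_›, ‹_›, hq⟩
  · exact fun h => ⟨_, _, .setWord M a i e h.1 h.2.1, h.2.2⟩

theorem wp_setRat {a : ℕ} {i : WordExpr} {e : RatExpr} : Wp B (.setRat a i e) M Q ↔
    i.Fits B M ∧ e.Fits B M ∧ Q (i.cost + e.cost + 1) (M.setRat a (i.eval M) (e.eval M)) := by
  constructor
  · rintro ⟨T, M', h, hq⟩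
    cases h
    exact ⟨‹_›, ‹_›, hq⟩
  · exact fun h => ⟨_, _, .setRat M a i e h.1 h.2.1, h.2.2⟩

theorem wp_seq : Wp B (.seq p q) M Q ↔
    Wp B p M fun T M' => Wp B q M' fun T' M'' => Q (T + T') M'' := by
  constructor
  · rintro ⟨T, M', h, hq⟩
    cases h with
    | seq h1 h2 => exact ⟨_, _, h1, _, _, h2, hq⟩
  · rintro ⟨_, _, h1, _, _, h2, hq⟩
    exact ⟨_, _, .seq h1 h2, hq⟩

theorem wp_cond {b : WordExpr} : Wp B (.cond b p q) M Q ↔ b.Fits B M ∧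
    (b.eval M ≠ 0 → Wp B p M fun T M' => Q (b.cost + 1 + T) M') ∧
    (b.eval M = 0 → Wp B q M fun T M' => Q (b.cost + 1 + T) M') := by
  constructor
  · rintro ⟨T, M', h, hq⟩
    cases h with
    | condTrue hb h hp => exact ⟨hb, fun _ => ⟨_, _, hp, hq⟩, fun h' => absurd h' h⟩
    | condFalse hb h hp => exact ⟨hb, fun h' => absurd h h', fun _ => ⟨_, _, hp, hq⟩⟩
  · rintro ⟨hb, h1, h2⟩
    by_cases h : b.eval M = 0
    · obtain ⟨_, _, h3, h4⟩ := h2 h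
      exact ⟨_, _, .condFalse hb h h3, h4⟩
    · obtain ⟨_, _, h3, h4⟩ := h1 h
      exact ⟨_, _, .condTrue hb h h3, h4⟩

/-- The loop rule: the invariant `I` relates the memory to an abstract state, and the potential `Φ`
of the abstract state pays for the remaining running time. -/
theorem wp_loop {σ : Type*} {b : WordExpr} (I : σ → Memory → Prop) (Φ : σ → ℕ)
    (h : ∀ s M, I s M → b.Fits B M ∧
      (b.eval M ≠ 0 → Wp B p M fun T M' => ∃ s', I s' M' ∧ b.cost + 1 + T + Φ s' ≤ Φ s) ∧
      (b.eval M = 0 → b.cost + 1 ≤ Φ s)) (s : σ) (M : Memory) (hI : I s M) :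
    Wp B (.loop b p) M fun T M' => T ≤ Φ s ∧ ∃ s', I s' M' ∧ b.eval M' = 0 := by
  -- Every round costs at least one step, so the potential drops strictly; strong induction on it
  -- gives termination together with the time bound.
  induction hk : Φ s using Nat.strong_induction_on generalizing s M with
  | _ k ih =>
    subst hk
    obtain ⟨hb, h1, h2⟩ := h s M hI
    by_cases h0 : b.eval M = 0
    · exact ⟨_, _, .loopDone hb h0, h2 h0, s, hI, h0⟩
    · obtain ⟨T, M', hr, s', hI', hΦ⟩ := h1 h0
      obtain ⟨T', M'', hr', hT', hs⟩ := ih (Φ s') (by omega) s' M' hI' rfl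
      exact ⟨_, _, .loopStep hb h0 hr hr', by omega, hs⟩

/-- The rule for loops with a fixed number `K` of rounds. -/
theorem wp_for {b : WordExpr} (K : ℕ) (I : ℕ → Memory → Prop) (t : ℕ → ℕ)
    (hb : ∀ k M, k ≤ K → I k M → b.Fits B M ∧ (b.eval M ≠ 0 ↔ k < K))
    (hp : ∀ k M, k < K → I k M → Wp B p M fun T M' => T ≤ t k ∧ I (k + 1) M')
    (M : Memory) (h0 : I 0 M) :
    Wp B (.loop b p) M fun T M' =>
      T ≤ (∑ k ∈ Finset.range K, (t k + (b.cost + 1))) + (b.cost + 1) ∧ I K M' := by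
  have key := wp_loop (B := B) (p := p) (b := b) (fun k M => k ≤ K ∧ I k M)
    (fun k => (∑ k ∈ Finset.Ico k K, (t k + (b.cost + 1))) + (b.cost + 1)) ?_ 0 M ⟨by omega, h0⟩
  · refine key.imp fun T M' => ?_
    rintro ⟨hT, k, ⟨hk, hI⟩, h⟩
    rw [Finset.range_eq_Ico]
    refine ⟨hT, ?_⟩
    have := (hb k M' hk hI).2
    have : k = K := by omega
    exact this ▸ hI
  · rintro k M ⟨hk, hI⟩
    refine ⟨(hb k M hk hI).1, fun hne => ?_, fun _ => by omega⟩
    have hlt := (hb k M hk hI).2.1 hne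
    refine (hp k M hlt hI).imp fun T M' h => ⟨k + 1, ⟨hlt, h.2⟩, ?_⟩
    rw [← Finset.add_sum_Ioo_eq_sum_Ico hlt, ← Finset.Ico_succ_left_eq_Ioo, Order.succ_eq_add_one]
    omega

theorem wp_for_const {b : WordExpr} (K : ℕ) (I : ℕ → Memory → Prop) (t : ℕ)
    (hb : ∀ k M, k ≤ K → I k M → b.Fits B M ∧ (b.eval M ≠ 0 ↔ k < K))
    (hp : ∀ k M, k < K → I k M → Wp B p M fun T M' => T ≤ t ∧ I (k + 1) M')
    (M : Memory) (h0 : I 0 M) :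
    Wp B (.loop b p) M fun T M' => T ≤ K * (t + (b.cost + 1)) + (b.cost + 1) ∧ I K M' := by
  simpa using wp_for K I (fun _ => t) hb hp M h0

end Logic

/-! ### Frames -/

namespace Prog

/-- The word arrays a program may write to. -/
def wordArrays : Prog → List ℕ
  | skip => []
  | setWord a _ _ => [a]
  | setRat _ _ _ => []
  | seq p q => p.wordArrays ++ q.wordArrays
  | cond _ p q => p.wordArrays ++ q.wordArrays
  | loop _ p => p.wordArrays

/-- The rational arrays a program may write to. -/
def ratArrays : Prog → List ℕ
  | skip => []
  | setWord _ _ _ => []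
  | setRat a _ _ => [a]
  | seq p q => p.ratArrays ++ q.ratArrays
  | cond _ p q => p.ratArrays ++ q.ratArrays
  | loop _ p => p.ratArrays

end Prog

theorem Memory.word_setWord (M : Memory) (a i x b j : ℕ) :
    (M.setWord a i x).word b j = if b = a ∧ j = i then x else M.word b j := by
  by_cases hb : b = a
  · subst hb
    by_cases hj : j = i <;> simp [Memory.setWord, hj, Function.update]
  · simp [Memory.setWord, hb, Function.update]

theorem Memory.rat_setRat (M : Memory) (a i : ℕ) (x : ℚ) (b j : ℕ) :
    (M.setRat a i x).rat b j = if b = a ∧ j = i then x else M.rat b j := by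
  by_cases hb : b = a
  · subst hb
    by_cases hj : j = i <;> simp [Memory.setRat, hj, Function.update]
  · simp [Memory.setRat, hb, Function.update]

theorem Memory.rat_setWord (M : Memory) (a i x b j : ℕ) :
    (M.setWord a i x).rat b j = M.rat b j := rfl

theorem Memory.word_setRat (M : Memory) (a i : ℕ) (x : ℚ) (b j : ℕ) :
    (M.setRat a i x).word b j = M.word b j := rfl

/-- Specifications need to mention only what a program changes. That an array never occurs as a
target is syntactic, so `decide` can check it for concrete programs. -/
theorem Runs.word_eq {B : ℕ} {p : Prog} {M M' : Memory} {T : ℕ} (h : Runs B p M T M') {a : ℕ}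
    (ha : a ∉ p.wordArrays) (j : ℕ) : M'.word a j = M.word a j := by
  induction h with
  | skip => rfl
  | setWord M b i e =>
    rw [Memory.word_setWord, if_neg]
    simp only [Prog.wordArrays, List.mem_singleton] at ha
    tauto
  | setRat => rfl
  | seq _ _ ih1 ih2 =>
    simp only [Prog.wordArrays, List.mem_append, not_or] at ha
    rw [ih2 ha.2, ih1 ha.1]
  | condTrue _ _ _ ih =>
    simp only [Prog.wordArrays, List.mem_append, not_or] at ha
    exact ih ha.1
  | condFalse _ _ _ ih =>
    simp only [Prog.wordArrays, List.mem_append, not_or] at ha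
    exact ih ha.2
  | loopDone => rfl
  | loopStep _ _ _ _ ih1 ih2 => rw [ih2 ha, ih1 ha]

theorem Runs.rat_eq {B : ℕ} {p : Prog} {M M' : Memory} {T : ℕ} (h : Runs B p M T M') {a : ℕ}
    (ha : a ∉ p.ratArrays) (j : ℕ) : M'.rat a j = M.rat a j := by
  induction h with
  | skip => rfl
  | setWord => rfl
  | setRat M b i e =>
    rw [Memory.rat_setRat, if_neg]
    simp only [Prog.ratArrays, List.mem_singleton] at ha
    tauto
  | seq _ _ ih1 ih2 =>
    simp only [Prog.ratArrays, List.mem_append, not_or] at ha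
    rw [ih2 ha.2, ih1 ha.1]
  | condTrue _ _ _ ih =>
    simp only [Prog.ratArrays, List.mem_append, not_or] at ha
    exact ih ha.1
  | condFalse _ _ _ ih =>
    simp only [Prog.ratArrays, List.mem_append, not_or] at ha
    exact ih ha.2
  | loopDone => rfl
  | loopStep _ _ _ _ ih1 ih2 => rw [ih2 ha, ih1 ha]

/-! ### Scalar variables and tests -/

/-- A word variable: cell `0` of array `a`. -/
@[reducible] def WordExpr.var (a : ℕ) : WordExpr := .get a (.const 0)

/-- A test for `e < f`. -/
@[reducible] def WordExpr.lt (e f : WordExpr) : WordExpr := .sub f e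

/-- A test for `e ≠ f`. -/
@[reducible] def WordExpr.ne (e f : WordExpr) : WordExpr := .add (.sub e f) (.sub f e)

/-- Assignment to a word variable. -/
@[reducible] def Prog.setVar (a : ℕ) (e : WordExpr) : Prog := .setWord a (.const 0) e

/-! ### Counting shortest paths -/

section Counting

open Classical

variable {V : Type*} {G : SimpleGraph V}

/-- A walk as short as the distance cannot repeat a vertex. Without the path condition, the counts
become entries of powers of the adjacency matrix. -/
theorem shortestPaths_eq (G : SimpleGraph V) (s t : V) :
    shortestPaths G s t = {p : G.Walk s t | p.length = G.dist s t} := by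
  ext p
  exact ⟨fun h => h.2, fun h => ⟨p.isPath_of_length_eq_dist h, h⟩⟩

theorem dist_le_dist_add_one (hG : G.Connected) (s : V) {x y : V} (h : G.Adj x y) :
    G.dist s y ≤ G.dist s x + 1 := by
  have h1 := hG.dist_triangle (u := s) (v := x) (w := y)
  rw [SimpleGraph.dist_eq_one_iff_adj.2 h] at h1
  exact h1

theorem exists_adj_dist_add_one (hG : G.Connected) {s x : V} (hx : x ≠ s) :
    ∃ y, G.Adj y x ∧ G.dist s y + 1 = G.dist s x := by
  obtain ⟨p, hp⟩ := hG.exists_walk_length_eq_dist x s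
  cases p with
  | nil => exact absurd rfl hx
  | @cons _ y _ h q =>
    refine ⟨y, h.symm, ?_⟩
    rw [SimpleGraph.Walk.length_cons] at hp
    have h1 := G.dist_le q
    have h2 := dist_le_dist_add_one hG s h.symm
    rw [G.dist_comm (u := s), G.dist_comm (u := s)] at *
    omega

theorem gamma_self (G : SimpleGraph V) (pen : V → ℕ) (s v : V) : gamma G pen s s v = 0 := by
  have : sigmaThrough G s s v = 0 := by
    rw [sigmaThrough]
    split_ifs with h
    · rfl
    · have : {p ∈ shortestPaths G s s | v ∈ p.support} = ∅ := by
        ext p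
        simp only [Set.mem_ofPred_eq, Set.mem_empty_iff_false, iff_false, not_and]
        rintro ⟨hp, _⟩
        rw [(SimpleGraph.Walk.isPath_iff_nil.1 hp).eq_nil]
        simpa using h
      rw [this, Set.ncard_empty]
  simp [gamma, this]

/-! ### Numbers of shortest paths as entries of powers of the adjacency matrix. -/

variable [Fintype V]

theorem ncard_walk_length (G : SimpleGraph V) (s t : V) (k : ℕ) :
    {p : G.Walk s t | p.length = k}.ncard = (G.adjMatrix ℕ ^ k) s t := by
  rw [SimpleGraph.adjMatrix_pow_apply_eq_card_walk, ← Nat.card_coe_set_eq,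
    Nat.card_eq_fintype_card]
  simp

theorem sigma_eq_pow (G : SimpleGraph V) (s t : V) :
    sigma G s t = (G.adjMatrix ℕ ^ G.dist s t) s t := by
  rw [sigma, shortestPaths_eq, ncard_walk_length]

theorem finite_walk_length (G : SimpleGraph V) (s t : V) (k : ℕ) :
    {p : G.Walk s t | p.length = k}.Finite := by
  have := (G.finsetWalkLength k s t).finite_toSet
  rwa [SimpleGraph.coe_finsetWalkLength_eq] at this

theorem sigma_comm (G : SimpleGraph V) (s t : V) : sigma G s t = sigma G t s := by
  rw [sigma_eq_pow, sigma_eq_pow, G.dist_comm (u := t)]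
  have : ((G.adjMatrix ℕ ^ G.dist s t).transpose) = G.adjMatrix ℕ ^ G.dist s t := by
    rw [Matrix.transpose_pow, SimpleGraph.transpose_adjMatrix]
  rw [← this, Matrix.transpose_apply, this]

theorem sigma_self (G : SimpleGraph V) (s : V) : sigma G s s = 1 := by
  simp [sigma_eq_pow]

theorem sigma_pos (hG : G.Connected) (s t : V) : 0 < sigma G s t := by
  obtain ⟨p, hp⟩ := hG.exists_walk_length_eq_dist s t
  rw [sigma, shortestPaths_eq, Set.ncard_pos (finite_walk_length G s t _)]
  exact ⟨p, hp⟩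

theorem pow_eq_zero_of_lt_dist {s t : V} {k : ℕ} (h : k < G.dist s t) :
    (G.adjMatrix ℕ ^ k) s t = 0 := by
  rw [← ncard_walk_length, Set.ncard_eq_zero (finite_walk_length G s t _)]
  ext p
  simp only [Set.mem_ofPred_eq, Set.mem_empty_iff_false, iff_false]
  have := G.dist_le p
  omega

/-- The number of shortest paths to `x` is obtained from the predecessors of `x`. -/
theorem sigma_eq_sum (hG : G.Connected) {s x : V} (hx : x ≠ s) :
    sigma G s x = ∑ y, if G.Adj x y ∧ G.dist s y + 1 = G.dist s x then sigma G s y else 0 := by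
  obtain ⟨k, hk⟩ : ∃ k, G.dist s x = k + 1 :=
    Nat.exists_eq_succ_of_ne_zero (hG.pos_dist_of_ne hx.symm).ne'
  -- Walks of length `k + 1` are split at their last but one vertex; those over a vertex farther
  -- than `k` from `s` do not exist.
  rw [sigma_eq_pow, hk, pow_succ, Matrix.mul_apply]
  refine Finset.sum_congr rfl fun y _ => ?_
  rw [SimpleGraph.adjMatrix_apply]
  by_cases hy : G.Adj x y
  · have h1 := dist_le_dist_add_one hG s hy.symm
    by_cases h2 : G.dist s y = k
    · simp [hy, hy.symm, h2, sigma_eq_pow]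
    · rw [pow_eq_zero_of_lt_dist (by omega)]
      simp [h2]
  · simp [hy, mt SimpleGraph.Adj.symm hy]

/-- If the distances add up, concatenation is a bijection from pairs of a shortest `s`-`v`-path and
a shortest `v`-`t`-path to the shortest `s`-`t`-paths through `v`. Conversely, cutting a shortest
path at `v` shows that the distances must add up. -/
theorem sigmaThrough_eq (hG : G.Connected) {s t v : V} (hs : v ≠ s) (ht : v ≠ t) :
    sigmaThrough G s t v =
      if G.dist s v + G.dist v t = G.dist s t then sigma G s v * sigma G v t else 0 := by
  rw [sigmaThrough, if_neg (by tauto)]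
  split_ifs with h
  · rw [sigma, sigma, ← Set.ncard_prod, shortestPaths_eq, shortestPaths_eq, shortestPaths_eq]
    symm
    refine Set.ncard_congr (fun pq _ => pq.1.append pq.2) ?_ ?_ ?_
    · rintro ⟨p, q⟩ ⟨hp, hq⟩
      simp only [Set.mem_ofPred_eq] at hp hq ⊢
      simp [hp, hq, h]
    · rintro ⟨p, q⟩ ⟨p', q'⟩ ⟨hp, hq⟩ ⟨hp', hq'⟩ heq
      simp only [Set.mem_ofPred_eq] at hp hq hp' hq' heq
      -- Both concatenations are cut at the same position, so equality of the whole walks gives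
      -- equality of the two parts.
      have hl : p.length = p'.length := hp.trans hp'.symm
      have hget := fun i => congrArg (fun r => r.getVert i) heq
      simp only [SimpleGraph.Walk.getVert_append, ← hl] at hget
      refine Prod.ext (SimpleGraph.Walk.ext_getVert_le_length hl fun i hi => ?_)
        (SimpleGraph.Walk.ext_getVert fun i => ?_)
      · rcases hi.eq_or_lt with rfl | h1
        · rw [SimpleGraph.Walk.getVert_of_length_le _ le_rfl,
            SimpleGraph.Walk.getVert_of_length_le _ hl.ge]
        · simpa [h1] using hget i
      · simpa using hget (p.length + i)
    · rintro p ⟨hp, hv⟩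
      simp only [Set.mem_ofPred_eq] at hp
      have hl := congrArg SimpleGraph.Walk.length (p.take_spec hv)
      rw [SimpleGraph.Walk.length_append] at hl
      have h1 := G.dist_le (p.takeUntil v hv)
      have h2 := G.dist_le (p.dropUntil v hv)
      refine ⟨(p.takeUntil v hv, p.dropUntil v hv), ⟨?_, ?_⟩, p.take_spec hv⟩ <;>
        simp only [Set.mem_ofPred_eq] <;> omega
  · rw [shortestPaths_eq, Set.ncard_eq_zero
      ((finite_walk_length G s t _).subset fun p hp => hp.1)]
    ext p
    simp only [Set.mem_ofPred_eq, Set.mem_empty_iff_false, iff_false, not_and]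
    intro hp hv
    have hl := congrArg SimpleGraph.Walk.length (p.take_spec hv)
    rw [SimpleGraph.Walk.length_append] at hl
    have h1 := G.dist_le (p.takeUntil v hv)
    have h2 := G.dist_le (p.dropUntil v hv)
    have h3 := hG.dist_triangle (u := s) (v := v) (w := t)
    omega

theorem gamma_comm (hG : G.Connected) (pen : V → ℕ) (s t v : V) :
    gamma G pen s t v = gamma G pen t s v := by
  have : sigmaThrough G s t v = sigmaThrough G t s v := by
    by_cases h : v = s ∨ v = t
    · rw [sigmaThrough, sigmaThrough, if_pos h, if_pos h.symm]
    · rw [not_or] at h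
      rw [sigmaThrough_eq hG h.1 h.2, sigmaThrough_eq hG h.2 h.1, sigma_comm G s v,
        sigma_comm G t v, G.dist_comm (u := t), G.dist_comm (u := t), G.dist_comm (u := v) (v := t),
        G.dist_comm (u := v) (v := s), add_comm, mul_comm]
  rw [gamma, gamma, this, sigma_comm G s t]
  ring

/-! ### Distances along a path of degree-two vertices -/

theorem two_neighbors_cover {x a b : V} (hx : G.degree x = 2) (ha : G.Adj x a) (hb : G.Adj x b)
    (hab : a ≠ b) (y : V) : G.Adj x y ↔ y = a ∨ y = b := by
  have h1 : ({a, b} : Finset V) = G.neighborFinset x := by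
    refine Finset.eq_of_subset_of_card_le ?_ ?_
    · intro z hz
      simp only [Finset.mem_insert, Finset.mem_singleton] at hz
      rcases hz with rfl | rfl <;> simpa
    · rw [SimpleGraph.card_neighborFinset_eq_degree, hx, Finset.card_pair hab]
  rw [← SimpleGraph.mem_neighborFinset, ← h1]
  simp

/-- The last step of a shortest path from `s` to `x` comes from `a` or from `b`. -/
theorem dist_degree_two (hG : G.Connected) {s x a b : V} (hxs : x ≠ s) (hx : G.degree x = 2)
    (ha : G.Adj x a) (hb : G.Adj x b) (hab : a ≠ b) :
    G.dist s x = 1 + min (G.dist s a) (G.dist s b) := by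
  obtain ⟨y, hy, hd⟩ := exists_adj_dist_add_one hG hxs
  have h1 := dist_le_dist_add_one hG s ha.symm
  have h2 := dist_le_dist_add_one hG s hb.symm
  rcases (two_neighbors_cover hx ha hb hab y).1 hy.symm with rfl | rfl <;> omega

theorem sigma_degree_two (hG : G.Connected) {s x a b : V} (hxs : x ≠ s) (hx : G.degree x = 2)
    (ha : G.Adj x a) (hb : G.Adj x b) (hab : a ≠ b) :
    sigma G s x = (if G.dist s a ≤ G.dist s b then sigma G s a else 0) +
      (if G.dist s b ≤ G.dist s a then sigma G s b else 0) := by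
  rw [sigma_eq_sum hG hxs, dist_degree_two hG hxs hx ha hb hab,
    Finset.sum_eq_add a b hab]
  · congr 1
    · refine if_congr ?_ rfl rfl
      simp only [ha, true_and]
      omega
    · refine if_congr ?_ rfl rfl
      simp only [hb, true_and]
      omega
  · intro c _ hc
    rw [if_neg]
    rw [two_neighbors_cover hx ha hb hab]
    tauto
  · simp
  · simp

end Counting

/-- Used for the distances from a fixed vertex along a path. Away from either end the values grow by
at most one per step, which gives the upper bound; descending to a smaller neighbour until an end is
reached gives the lower bound. The hypotheses on `f 0` and `f L` make the formula correct at the two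
ends, where no recursion is available. -/
theorem min_sequence_eq {L : ℕ} {f : ℕ → ℕ} (hL : f 0 ≤ L + f L) (hL' : f L ≤ L + f 0)
    (hf : ∀ i, 0 < i → i < L → f i = 1 + min (f (i - 1)) (f (i + 1))) {i : ℕ} (hi : i ≤ L) :
    f i = min (i + f 0) (L - i + f L) := by
  have up : ∀ i, i < L → f i ≤ i + f 0 := by
    intro i
    induction i with
    | zero => intro _; omega
    | succ i ih =>
      intro h
      have h1 := ih (by omega)
      have := hf (i + 1) (by omega) h
      rw [Nat.add_sub_cancel] at this
      omega
  have down : ∀ j, j < L → f (L - j) ≤ j + f L := by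
    intro j
    induction j with
    | zero => intro _; simp
    | succ i ih =>
      intro h
      have h1 := ih (by omega)
      have := hf (L - (i + 1)) (by omega) (by omega)
      rw [show L - (i + 1) + 1 = L - i by omega] at this
      omega
  -- Induction on the value: the smaller neighbour has value `f i - 1`, and moving there changes the
  -- claimed bound by at most one.
  have low : ∀ k i, i ≤ L → f i = k → min (i + f 0) (L - i + f L) ≤ k := by
    intro k
    induction k using Nat.strong_induction_on with
    | _ k ih =>
      intro i hi hk
      rcases Nat.eq_zero_or_pos i with rfl | h0
      · omega
      rcases hi.eq_or_lt with rfl | h1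
      · omega
      have h2 := hf i h0 h1
      have h3 := ih (f (i - 1))
      have h4 := ih (f (i + 1))
      rcases le_total (f (i - 1)) (f (i + 1)) with h5 | h5
      · have := h3 (by omega) (i - 1) (by omega) rfl
        omega
      · have := h4 (by omega) (i + 1) (by omega) rfl
        omega
  have h1 := low (f i) i hi rfl
  rcases Nat.eq_zero_or_pos i with rfl | h0
  · omega
  rcases hi.eq_or_lt with rfl | h2
  · omega
  have h3 := up i h2
  have h4 := down (L - i) (by omega)
  rw [show L - (L - i) = i by omega] at h4
  omega

/-- A count is inherited from the neighbours with the smallest value. By `min_sequence_eq`,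
positions strictly nearer to one end copy the count of that end, and a balanced position, if there
is one, adds up both. -/
theorem count_sequence_eq {L : ℕ} {f g : ℕ → ℕ} (hL : f 0 ≤ L + f L) (hL' : f L ≤ L + f 0)
    (hf : ∀ i, 0 < i → i < L → f i = 1 + min (f (i - 1)) (f (i + 1)))
    (hg : ∀ i, 0 < i → i < L → g i = (if f (i - 1) ≤ f (i + 1) then g (i - 1) else 0) +
      (if f (i + 1) ≤ f (i - 1) then g (i + 1) else 0)) {i : ℕ} (h0 : 0 < i) (hi : i < L) :
    g i = (if i + f 0 ≤ L - i + f L then g 0 else 0) +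
      (if L - i + f L ≤ i + f 0 then g L else 0) := by
  have left : ∀ i, i < L → i + f 0 < L - i + f L → g i = g 0 := by
    intro i
    induction i with
    | zero => simp
    | succ i ih =>
      intro h h'
      have h1 := min_sequence_eq hL hL' hf (i := i) (by omega)
      have h2 := min_sequence_eq hL hL' hf (i := i + 1 + 1) (by omega)
      rw [hg (i + 1) (by omega) h, Nat.add_sub_cancel, if_pos (by omega), if_neg (by omega),
        ih (by omega) (by omega), add_zero]
  have right : ∀ j, j < L → j + f L < L - j + f 0 → g (L - j) = g L := by
    intro i
    induction i with
    | zero => simp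
    | succ i ih =>
      intro h h'
      have h1 := min_sequence_eq hL hL' hf (i := L - (i + 1) - 1) (by omega)
      have h2 := min_sequence_eq hL hL' hf (i := L - (i + 1) + 1) (by omega)
      rw [hg (L - (i + 1)) (by omega) (by omega), if_neg (by omega), if_pos (by omega),
        show L - (i + 1) + 1 = L - i by omega, ih (by omega) (by omega), zero_add]
  have h1 := min_sequence_eq hL hL' hf (i := i - 1) (by omega)
  have h2 := min_sequence_eq hL hL' hf (i := i + 1) (by omega)
  rcases lt_trichotomy (i + f 0) (L - i + f L) with h | h | h
  · rw [if_pos h.le, if_neg (by omega), left i hi h, add_zero]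
  · have h3 : g (i - 1) = g 0 := left _ (by omega) (by omega)
    have h4 : g (i + 1) = g L := by
      rcases (show i + 1 ≤ L from hi).eq_or_lt with h5 | h5
      · rw [h5]
      · have := right (L - (i + 1)) (by omega) (by omega)
        rwa [show L - (L - (i + 1)) = i + 1 by omega] at this
    rw [if_pos h.le, if_pos h.ge, hg i h0 hi, if_pos (by omega), if_pos (by omega), h3, h4]
  · have := right (L - i) (by omega) (by omega)
    rw [show L - (L - i) = i by omega] at this
    rw [if_neg (by omega), if_pos h.le, this, zero_add]

/-! ### Dependencies between the inner vertices of a maximal induced path -/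

section Traversal

open Classical

variable {V : Type*} [Fintype V] {G : SimpleGraph V}

/-- The vertices `ps 0, …, ps L` form a maximal induced path. -/
structure IsTraversal (G : SimpleGraph V) (ps : ℕ → V) (L : ℕ) : Prop where
  two_le : 2 ≤ L
  adj : ∀ i, i < L → G.Adj (ps i) (ps (i + 1))
  inj : ∀ i j, i ≤ L → j ≤ L → ps i = ps j → i = j
  degree_inner : ∀ i, 0 < i → i < L → G.degree (ps i) = 2
  degree_start : G.degree (ps 0) ≠ 2
  degree_end : G.degree (ps L) ≠ 2

namespace IsTraversal

variable {ps : ℕ → V} {L : ℕ}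

theorem dist_le (h : IsTraversal G ps L) (hG : G.Connected) (i j : ℕ) (hij : i ≤ j) (hj : j ≤ L) :
    G.dist (ps i) (ps j) ≤ j - i := by
  induction j, hij using Nat.le_induction with
  | base => simp
  | succ j hij ih =>
    have h1 := dist_le_dist_add_one hG (ps i) (h.adj j (by omega))
    have := ih (by omega)
    omega

theorem pred_adj (h : IsTraversal G ps L) {i : ℕ} (h0 : 0 < i) (hi : i ≤ L) :
    G.Adj (ps i) (ps (i - 1)) := by
  have := h.adj (i - 1) (by omega)
  rw [show i - 1 + 1 = i by omega] at this
  exact this.symm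

theorem pred_ne_succ (h : IsTraversal G ps L) {i : ℕ} (h0 : 0 < i) (hi : i < L) :
    ps (i - 1) ≠ ps (i + 1) := fun heq => by
  have := h.inj _ _ (by omega) (by omega) heq
  omega

theorem dist_step (h : IsTraversal G ps L) (hG : G.Connected) {x : V} {i : ℕ} (h0 : 0 < i)
    (hi : i < L) (hx : ps i ≠ x) :
    G.dist x (ps i) = 1 + min (G.dist x (ps (i - 1))) (G.dist x (ps (i + 1))) :=
  dist_degree_two hG hx (h.degree_inner i h0 hi) (h.pred_adj h0 hi.le) (h.adj i hi)
    (h.pred_ne_succ h0 hi)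

theorem sigma_step (h : IsTraversal G ps L) (hG : G.Connected) {x : V} {i : ℕ} (h0 : 0 < i)
    (hi : i < L) (hx : ps i ≠ x) :
    sigma G x (ps i) =
      (if G.dist x (ps (i - 1)) ≤ G.dist x (ps (i + 1)) then sigma G x (ps (i - 1)) else 0) +
      (if G.dist x (ps (i + 1)) ≤ G.dist x (ps (i - 1)) then sigma G x (ps (i + 1)) else 0) :=
  sigma_degree_two hG hx (h.degree_inner i h0 hi) (h.pred_adj h0 hi.le) (h.adj i hi)
    (h.pred_ne_succ h0 hi)

theorem dist_ends (h : IsTraversal G ps L) (hG : G.Connected) (x : V) {j : ℕ} (hj : j ≤ L) :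
    G.dist x (ps 0) ≤ j + G.dist x (ps j) ∧ G.dist x (ps j) ≤ j + G.dist x (ps 0) := by
  have h1 := h.dist_le hG 0 j (by omega) hj
  have h2 := hG.dist_triangle (u := x) (v := ps 0) (w := ps j)
  have h3 := hG.dist_triangle (u := x) (v := ps j) (w := ps 0)
  rw [G.dist_comm (u := ps j) (v := ps 0)] at h3
  omega

/-- A vertex that is not inner reaches the inner ones only through the ends: the recursion for the
distance holds at every inner position because none of them is `x`. -/
theorem dist_outer (h : IsTraversal G ps L) (hG : G.Connected) {x : V}
    (hx : ∀ i, 0 < i → i < L → ps i ≠ x) {i : ℕ} (hi : i ≤ L) :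
    G.dist x (ps i) = min (i + G.dist x (ps 0)) (L - i + G.dist x (ps L)) :=
  min_sequence_eq (f := fun i => G.dist x (ps i)) (h.dist_ends hG x le_rfl).1
    (h.dist_ends hG x le_rfl).2 (fun i h0 hi => h.dist_step hG h0 hi (hx i h0 hi)) hi

theorem sigma_outer (h : IsTraversal G ps L) (hG : G.Connected) {x : V}
    (hx : ∀ i, 0 < i → i < L → ps i ≠ x) {i : ℕ} (h0 : 0 < i) (hi : i < L) :
    sigma G x (ps i) =
      (if i + G.dist x (ps 0) ≤ L - i + G.dist x (ps L) then sigma G x (ps 0) else 0) +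
      (if L - i + G.dist x (ps L) ≤ i + G.dist x (ps 0) then sigma G x (ps L) else 0) :=
  count_sequence_eq (f := fun i => G.dist x (ps i)) (g := fun i => sigma G x (ps i))
    (h.dist_ends hG x le_rfl).1
    (h.dist_ends hG x le_rfl).2 (fun i h0 hi => h.dist_step hG h0 hi (hx i h0 hi))
    (fun i h0 hi => h.sigma_step hG h0 hi (hx i h0 hi)) h0 hi

theorem start_not_inner (h : IsTraversal G ps L) (i : ℕ) (h0 : 0 < i) (hi : i < L) :
    ps i ≠ ps 0 := fun heq => by
  have := h.inj _ _ (by omega) (by omega) heq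
  omega

theorem end_not_inner (h : IsTraversal G ps L) (i : ℕ) (_ : 0 < i) (hi : i < L) :
    ps i ≠ ps L := fun heq => by
  have := h.inj _ _ (by omega) (by omega) heq
  omega

theorem dist_end_le (h : IsTraversal G ps L) (hG : G.Connected) : G.dist (ps 0) (ps L) ≤ L := by
  simpa using h.dist_le hG 0 L (by omega) le_rfl

theorem dist_start_inner (h : IsTraversal G ps L) (hG : G.Connected) {j : ℕ} (hj : j ≤ L) :
    G.dist (ps 0) (ps j) = min j (L - j + G.dist (ps 0) (ps L)) := by
  simpa using h.dist_outer hG h.start_not_inner hj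

theorem dist_end_inner (h : IsTraversal G ps L) (hG : G.Connected) {j : ℕ} (hj : j ≤ L) :
    G.dist (ps L) (ps j) = min (j + G.dist (ps 0) (ps L)) (L - j) := by
  have := h.dist_outer hG h.end_not_inner hj
  rw [G.dist_comm (u := ps L) (v := ps 0)] at this
  simpa using this

/-- The recursion for the distance from `ps j` fails at position `j`, so `min_sequence_eq` is
applied to the part of the path up to `j`. The boundary values are `0` at `j` and, at `0`, the one
from `dist_start_inner`. -/
theorem dist_inner (h : IsTraversal G ps L) (hG : G.Connected) {i j : ℕ} (h0 : 0 < i)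
    (hij : i < j) (hj : j < L) :
    G.dist (ps i) (ps j) = min (j - i) (i + G.dist (ps 0) (ps L) + (L - j)) := by
  have key := min_sequence_eq (L := j) (f := fun i => G.dist (ps j) (ps i))
    (h.dist_ends hG (ps j) hj.le).1 (h.dist_ends hG (ps j) hj.le).2
    (fun i h0 hi => h.dist_step hG h0 (hi.trans hj) fun heq => by
      have := h.inj _ _ (by omega) (by omega) heq
      omega) hij.le
  have h1 := h.dist_start_inner hG hj.le
  simp only [SimpleGraph.dist_self] at key
  rw [G.dist_comm (u := ps j) (v := ps 0), h1] at key
  rw [G.dist_comm, key]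
  omega

theorem sigma_inner (h : IsTraversal G ps L) (hG : G.Connected) {i j : ℕ} (h0 : 0 < i)
    (hij : i < j) (hj : j < L) :
    sigma G (ps i) (ps j) = (if 2 * (j - i) ≤ L + G.dist (ps 0) (ps L) then 1 else 0) +
      (if L + G.dist (ps 0) (ps L) ≤ 2 * (j - i) then sigma G (ps 0) (ps L) else 0) := by
  have key := count_sequence_eq (L := j) (f := fun i => G.dist (ps j) (ps i))
    (g := fun i => sigma G (ps j) (ps i))
    (h.dist_ends hG (ps j) hj.le).1 (h.dist_ends hG (ps j) hj.le).2
    (fun i h0 hi => h.dist_step hG h0 (hi.trans hj) fun heq => by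
      have := h.inj _ _ (by omega) (by omega) heq
      omega)
    (fun i h0 hi => h.sigma_step hG h0 (hi.trans hj) fun heq => by
      have := h.inj _ _ (by omega) (by omega) heq
      omega) h0 hij
  have h1 := h.dist_start_inner hG hj.le
  have h2 := h.sigma_outer hG h.start_not_inner (i := j) (by omega) hj
  have hD := h.dist_end_le hG
  simp only [SimpleGraph.dist_self, sigma_self] at key h2
  rw [G.dist_comm (u := ps j) (v := ps 0), h1, sigma_comm G (ps j) (ps 0), h2,
    sigma_comm G (ps j) (ps i)] at key
  rw [key, add_comm]
  generalize G.dist (ps 0) (ps L) = D at *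
  congr 1
  · exact if_congr (by omega) rfl rfl
  -- A detour from `ps j` that is no longer than the segment to `ps i` is, because of `0 < i`,
  -- strictly shorter than the way back when the target is `ps 0`. Hence the count taken over from
  -- `ps 0` is `N`, without the direct path.
  · by_cases hc : L + D ≤ 2 * (j - i)
    · rw [if_pos hc, if_pos (by omega), if_neg (by omega), if_pos (by omega), zero_add]
    · rw [if_neg hc, if_neg (by omega)]

end IsTraversal

/-- The share of the shortest paths that run directly between two inner vertices of a path which are
`d` apart, where `h` is the length of the cycle that a shortest connection of the ends of the path
closes, and `N` is the number of these connections. -/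
def directShare (h N d : ℕ) : ℚ :=
  if 2 * d < h then 1 else if 2 * d = h then 1 / (N + 1) else 0

namespace IsTraversal

variable {ps : ℕ → V} {L : ℕ}

/-- Strictly between `i` and `j`, `ps r` lies on the segment; elsewhere on the path it lies on all
detours, whenever these are shortest. Distances and counts of the three pairs involved are known
from `dist_inner` and `sigma_inner`, so that a case distinction on the position of `r` and on the
shorter connection leaves only arithmetic. -/
theorem gamma_inner (h : IsTraversal G ps L) (hG : G.Connected) (pen : V → ℕ) {i j r : ℕ}
    (h0 : 0 < i) (hij : i < j) (hj : j < L) (hr0 : 0 < r) (hr : r < L) :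
    gamma G pen (ps i) (ps j) (ps r) = pen (ps i) * pen (ps j) *
      (if i < r ∧ r < j then
        directShare (L + G.dist (ps 0) (ps L)) (sigma G (ps 0) (ps L)) (j - i)
      else if r < i ∨ j < r then
        1 - directShare (L + G.dist (ps 0) (ps L)) (sigma G (ps 0) (ps L)) (j - i)
      else 0) := by
  rw [gamma]
  congr 1
  by_cases hend : r = i ∨ r = j
  · rw [if_neg (by omega), if_neg (by omega), sigmaThrough, if_pos]
    · simp
    · rcases hend with rfl | rfl <;> simp
  rw [not_or] at hend
  rw [sigmaThrough_eq hG (fun e => hend.1 (h.inj _ _ (by omega) (by omega) e))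
    (fun e => hend.2 (h.inj _ _ (by omega) (by omega) e)), h.sigma_inner hG h0 hij hj,
    h.dist_inner hG h0 hij hj]
  have hN : (sigma G (ps 0) (ps L) : ℚ) ≠ 0 := by exact_mod_cast (sigma_pos hG _ _).ne'
  have hN1 : (sigma G (ps 0) (ps L) : ℚ) + 1 ≠ 0 := by positivity
  rcases lt_or_gt_of_ne hend.1 with hri | hri
  · rw [if_neg (show ¬(i < r ∧ r < j) by omega), if_pos (show r < i ∨ j < r by omega),
      G.dist_comm (u := ps i) (v := ps r), sigma_comm G (ps i) (ps r),
      h.dist_inner hG hr0 hri (by omega), h.dist_inner hG hr0 (hri.trans hij) hj,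
      h.sigma_inner hG hr0 hri (by omega), h.sigma_inner hG hr0 (hri.trans hij) hj]
    have hD := h.dist_end_le hG
    generalize G.dist (ps 0) (ps L) = D at *
    generalize sigma G (ps 0) (ps L) = N at *
    rw [directShare]
    rcases lt_trichotomy (2 * (j - i)) (L + D) with hc | hc | hc
    · rw [if_neg (by omega), if_pos hc]; simp
    -- A tie: of the `N + 1` shortest paths, the `N` detours visit `ps r`.
    · rw [if_pos (by omega), if_neg hc.not_lt, if_pos hc, if_pos hc.le, if_pos hc.ge,
        if_pos (by omega), if_neg (by omega), if_neg (by omega), if_pos (by omega)]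
      push_cast
      field_simp
      ring
    · rw [if_pos (by omega), if_neg hc.not_gt, if_neg hc.ne', if_neg hc.not_ge, if_pos hc.le,
        if_pos (by omega), if_neg (by omega), if_neg (by omega), if_pos (by omega)]
      simp [hN]
  rcases lt_or_gt_of_ne hend.2 with hrj | hrj
  · rw [if_pos (show i < r ∧ r < j by omega), h.dist_inner hG h0 hri (by omega), h.dist_inner hG hr0 hrj hj,
      h.sigma_inner hG h0 hri (by omega), h.sigma_inner hG hr0 hrj hj]
    have hD := h.dist_end_le hG
    generalize G.dist (ps 0) (ps L) = D at *
    generalize sigma G (ps 0) (ps L) = N at *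
    rw [directShare]
    rcases lt_trichotomy (2 * (j - i)) (L + D) with hc | hc | hc
    · rw [if_pos (by omega), if_pos hc, if_pos hc.le, if_neg hc.not_ge,
        if_pos (by omega), if_neg (by omega), if_pos (by omega), if_neg (by omega)]
      simp
    · rw [if_pos (by omega), if_neg hc.not_lt, if_pos hc, if_pos hc.le, if_pos hc.ge,
        if_pos (by omega), if_neg (by omega), if_pos (by omega), if_neg (by omega)]
      push_cast
      rw [add_comm (1 : ℚ)]
    · rw [if_neg (by omega), if_neg hc.not_gt, if_neg hc.ne']
      simp
  · rw [if_neg (show ¬(i < r ∧ r < j) by omega), if_pos (show r < i ∨ j < r by omega),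
      G.dist_comm (u := ps r), sigma_comm G (ps r),
      h.dist_inner hG h0 hri (by omega), h.dist_inner hG (h0.trans hij) hrj hr,
      h.sigma_inner hG h0 hri (by omega), h.sigma_inner hG (h0.trans hij) hrj hr]
    have hD := h.dist_end_le hG
    generalize G.dist (ps 0) (ps L) = D at *
    generalize sigma G (ps 0) (ps L) = N at *
    rw [directShare]
    rcases lt_trichotomy (2 * (j - i)) (L + D) with hc | hc | hc
    · rw [if_neg (by omega), if_pos hc]; simp
    · rw [if_pos (by omega), if_neg hc.not_lt, if_pos hc, if_pos hc.le, if_pos hc.ge,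
        if_neg (by omega), if_pos (by omega), if_pos (by omega), if_neg (by omega)]
      push_cast
      field_simp
      ring
    · rw [if_pos (by omega), if_neg hc.not_gt, if_neg hc.ne', if_neg hc.not_ge, if_pos hc.le,
        if_neg (by omega), if_pos (by omega), if_pos (by omega), if_neg (by omega)]
      simp [hN]

/-- Only detours reach `x`, and a shortest detour visits `x` exactly if its part between the two
ends does. The ends themselves are allowed as `x`; there the last factor is one. -/
theorem gamma_outer (h : IsTraversal G ps L) (hG : G.Connected) (pen : V → ℕ) {i j : ℕ}
    (h0 : 0 < i) (hij : i < j) (hj : j < L) {x : V} (hx : ∀ i, 0 < i → i < L → ps i ≠ x) :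
    gamma G pen (ps i) (ps j) x = pen (ps i) * pen (ps j) *
      ((1 - directShare (L + G.dist (ps 0) (ps L)) (sigma G (ps 0) (ps L)) (j - i)) *
      (if G.dist (ps 0) x + G.dist (ps L) x = G.dist (ps 0) (ps L) then
        ((sigma G (ps 0) x : ℚ) * sigma G (ps L) x) / sigma G (ps 0) (ps L) else 0)) := by
  rw [gamma]
  congr 1
  rw [sigmaThrough_eq hG (hx i h0 (by omega)).symm (hx j (by omega) hj).symm,
    h.sigma_inner hG h0 hij hj, h.dist_inner hG h0 hij hj, G.dist_comm (v := x),
    sigma_comm G (ps i), h.dist_outer hG hx (i := i) (by omega), h.dist_outer hG hx hj.le,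
    h.sigma_outer hG hx h0 (by omega), h.sigma_outer hG hx (by omega) hj,
    G.dist_comm (u := ps 0) (v := x), G.dist_comm (u := ps L) (v := x),
    sigma_comm G (ps 0) x, sigma_comm G (ps L) x]
  have hN : (sigma G (ps 0) (ps L) : ℚ) ≠ 0 := by exact_mod_cast (sigma_pos hG _ _).ne'
  have hN1 : (sigma G (ps 0) (ps L) : ℚ) + 1 ≠ 0 := by positivity
  have hD := h.dist_end_le hG
  have htri := hG.dist_triangle (u := ps 0) (v := x) (w := ps L)
  rw [G.dist_comm (u := ps 0) (v := x)] at htri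
  generalize G.dist (ps 0) (ps L) = D at *
  generalize G.dist x (ps 0) = d at *
  generalize G.dist x (ps L) = d' at *
  generalize sigma G (ps 0) (ps L) = N at *
  rw [directShare]
  rcases lt_trichotomy (2 * (j - i)) (L + D) with hc | hc | hc
  · rw [if_neg (by omega), if_pos hc]; simp
  · rw [if_neg hc.not_lt, if_pos hc, if_pos hc.le, if_pos hc.ge]
    by_cases hd : d + d' = D
    · rw [if_pos (by omega), if_pos hd, if_pos (by omega), if_neg (by omega), if_neg (by omega),
        if_pos (by omega)]
      push_cast
      field_simp
      ring
    · rw [if_neg (by omega), if_neg hd]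
      simp
  · rw [if_neg hc.not_gt, if_neg hc.ne', if_neg hc.not_ge, if_pos hc.le]
    by_cases hd : d + d' = D
    · rw [if_pos (by omega), if_pos hd, if_pos (by omega), if_neg (by omega), if_neg (by omega),
        if_pos (by omega)]
      push_cast
      simp
    · rw [if_neg (by omega), if_neg hd]
      simp

/-- The quantity added for outer vertices vanishes on inner ones. -/
theorem indirect_inner (h : IsTraversal G ps L) (hG : G.Connected) {i j r : ℕ}
    (h0 : 0 < i) (hj : j < L) (hr : 0 < r) (hrL : r < L) :
    (1 - directShare (L + G.dist (ps 0) (ps L)) (sigma G (ps 0) (ps L)) (j - i)) *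
      (if G.dist (ps 0) (ps r) + G.dist (ps L) (ps r) = G.dist (ps 0) (ps L) then
        ((sigma G (ps 0) (ps r) : ℚ) * sigma G (ps L) (ps r)) / sigma G (ps 0) (ps L)
        else 0) = 0 := by
  rw [h.dist_start_inner hG hrL.le, h.dist_end_inner hG hrL.le]
  have hD := h.dist_end_le hG
  generalize G.dist (ps 0) (ps L) = D at *
  -- If `D = L`, every pair is connected directly and the first factor vanishes. If `D < L`, no
  -- shortest connection of the ends visits an inner vertex, and the second one does.
  by_cases hL : D = L
  · rw [directShare, if_pos (by omega)]
    simp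
  · rw [if_neg (by omega), mul_zero]

end IsTraversal

end Traversal

/-! ### Sums over pairs of inner vertices in linear time -/

section PairSums

/-- The sum of the weights up to and including position `m`. -/
def prefixSum (w : ℕ → ℚ) (m : ℕ) : ℚ := ∑ x ∈ Finset.range (m + 1), w x

/-- The sum over `j > i` of `w j * α (j - i)`, where `α` is `1` up to `c`, `e` at `c + 1`, and `0`
from there on. -/
def directAfter (w : ℕ → ℚ) (c : ℕ) (e : ℚ) (i : ℕ) : ℚ :=
  prefixSum w (i + c) - prefixSum w i + e * w (i + c + 1)

/-- The sum over `i < j` of `w i * α (j - i)`, with `α` as in `directAfter`. -/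
def directBefore (w : ℕ → ℚ) (c : ℕ) (e : ℚ) (j : ℕ) : ℚ :=
  prefixSum w (j - 1) - prefixSum w (j - 1 - c) + e * w (j - 1 - c)

/-- The sum over `j > i` of `w j * (1 - α (j - i))`. -/
def indirectAfter (w : ℕ → ℚ) (L c : ℕ) (e : ℚ) (i : ℕ) : ℚ :=
  prefixSum w L - prefixSum w i - directAfter w c e i

/-- The sum over `i < j` of `w i * (1 - α (j - i))`. -/
def indirectBefore (w : ℕ → ℚ) (c : ℕ) (e : ℚ) (j : ℕ) : ℚ :=
  prefixSum w (j - 1) - directBefore w c e j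

/-- The weight of all pairs that start at `i` and are connected directly, minus the weight of those
that are connected indirectly, minus the same for the pairs that end at `i`. -/
def balance (w : ℕ → ℚ) (L c : ℕ) (e : ℚ) (i : ℕ) : ℚ :=
  w i * (directAfter w c e i - indirectAfter w L c e i - directBefore w c e i +
    indirectBefore w c e i)

/-- The weight of all pairs that are connected indirectly. -/
def indirectTotal (w : ℕ → ℚ) (L c : ℕ) (e : ℚ) : ℚ :=
  ∑ i ∈ Finset.range L, w i * indirectAfter w L c e i

variable {w : ℕ → ℚ} {L h N : ℕ}

theorem prefixSum_eq {K m : ℕ} (hm : m < K) :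
    prefixSum w m = ∑ j ∈ Finset.range K, if j ≤ m then w j else 0 := by
  rw [← Finset.sum_filter, prefixSum]
  refine Finset.sum_congr ?_ fun _ _ => rfl
  ext j
  simp only [Finset.mem_range, Finset.mem_filter]
  omega

/-- The window in `directAfter` may reach beyond `L`, where the weights vanish. -/
theorem sum_range_extend (hL : ∀ x, L ≤ x → w x = 0) (g : ℕ → ℚ) {K : ℕ} (hK : L ≤ K) :
    ∑ j ∈ Finset.range L, g j * w j = ∑ j ∈ Finset.range K, g j * w j := by
  refine Finset.sum_subset (Finset.range_mono hK) fun x _ hx => ?_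
  rw [hL x (by simpa using hx), mul_zero]

/-- The share of the direct connection if both connections are equally long. -/
def tieShare (h N : ℕ) : ℚ := if h = 2 * (h / 2) then 1 / (N + 1) else 0

/-- The largest `d` with `2 * d < h` is `(h - 1) / 2`, and a tie can only occur at the next
position. For odd `h` there is no tie, and `tieShare` is zero. In this form the share can be summed
by prefix sums. -/
theorem directShare_eq (hh : 0 < h) (d : ℕ) : directShare h N d =
    (if d ≤ (h - 1) / 2 then 1 else 0) + tieShare h N * (if d = (h - 1) / 2 + 1 then 1 else 0) := by
  rw [directShare, tieShare]
  rcases lt_trichotomy (2 * d) h with hc | hc | hc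
  · rw [if_pos hc, if_pos (by omega), if_neg (show ¬ d = _ by omega)]
    simp
  · rw [if_neg (by omega), if_pos hc, if_neg (show ¬ d ≤ _ by omega), if_pos (by omega),
      if_pos (by omega)]
    simp
  · rw [if_neg (by omega), if_neg (by omega), if_neg (show ¬ d ≤ _ by omega)]
    by_cases h2 : h = 2 * (h / 2)
    · rw [if_neg (show ¬ d = _ by omega)]; simp
    · rw [if_neg h2]; simp

theorem sum_direct_after (hh : 0 < h) (hL : ∀ x, L ≤ x → w x = 0) (i : ℕ) :
    ∑ j ∈ Finset.range L, (if i < j then directShare h N (j - i) else 0) * w j =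
      directAfter w ((h - 1) / 2) (tieShare h N) i := by
  have hK : i + (h - 1) / 2 + 1 < max L (i + (h - 1) / 2 + 2) := by omega
  rw [sum_range_extend hL _ (le_max_left L (i + (h - 1) / 2 + 2)), directAfter,
    prefixSum_eq (K := max L (i + (h - 1) / 2 + 2)) (by omega),
    prefixSum_eq (K := max L (i + (h - 1) / 2 + 2)) (by omega), ← Finset.sum_sub_distrib,
    ← Finset.sum_ite_eq_of_mem' (Finset.range (max L (i + (h - 1) / 2 + 2))) (i + (h - 1) / 2 + 1) w
      (Finset.mem_range.2 hK), Finset.mul_sum, ← Finset.sum_add_distrib]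
  refine Finset.sum_congr rfl fun j _ => ?_
  rw [directShare_eq hh]
  by_cases hij : i < j
  · rw [if_pos hij, if_neg (show ¬ j ≤ i by omega)]
    by_cases h1 : j ≤ i + (h - 1) / 2
    · rw [if_pos (by omega), if_neg (by omega), if_pos h1, if_neg (by omega)]
      ring
    · by_cases h2 : j = i + (h - 1) / 2 + 1
      · rw [if_neg (by omega), if_pos (by omega), if_neg h1, if_pos h2]
        ring
      · rw [if_neg (by omega), if_neg (by omega), if_neg h1, if_neg h2]
        ring
  · rw [if_neg hij, if_pos (by omega), if_pos (by omega), if_neg (by omega)]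
    ring

/-- The window from `j - c` to `j - 1` may stick out below `0`. Truncated subtraction then gives the
index `0`, and `w 0 = 0` makes both the prefix sum and the tie term there harmless. -/
theorem sum_direct_before (hh : 0 < h) (h0 : w 0 = 0) {j : ℕ} (hj : 0 < j) (hjL : j ≤ L) :
    ∑ i ∈ Finset.range L, (if i < j then directShare h N (j - i) else 0) * w i =
      directBefore w ((h - 1) / 2) (tieShare h N) j := by
  rw [directBefore, prefixSum_eq (K := L) (by omega), prefixSum_eq (K := L) (by omega),
    ← Finset.sum_sub_distrib, ← Finset.sum_ite_eq_of_mem' (Finset.range L) (j - 1 - (h - 1) / 2) w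
      (Finset.mem_range.2 (by omega)), Finset.mul_sum, ← Finset.sum_add_distrib]
  refine Finset.sum_congr rfl fun i _ => ?_
  rcases Nat.eq_zero_or_pos i with rfl | hi
  · simp [h0]
  rw [directShare_eq hh]
  by_cases hij : i < j
  · rw [if_pos hij, if_pos (show i ≤ j - 1 by omega)]
    by_cases h1 : j ≤ i + (h - 1) / 2
    · rw [if_pos (by omega), if_neg (by omega), if_neg (by omega), if_neg (by omega)]
      ring
    · by_cases h2 : j = i + (h - 1) / 2 + 1
      · rw [if_neg (by omega), if_pos (by omega), if_pos (by omega), if_pos (by omega)]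
        ring
      · rw [if_neg (by omega), if_neg (by omega), if_pos (by omega), if_neg (by omega)]
        ring
  · rw [if_neg hij, if_neg (by omega), if_neg (by omega), if_neg (by omega)]
    ring

theorem sum_indirect_after (hh : 0 < h) (hL : ∀ x, L ≤ x → w x = 0) {i : ℕ} (hi : i < L) :
    ∑ j ∈ Finset.range L, (if i < j then 1 - directShare h N (j - i) else 0) * w j =
      indirectAfter w L ((h - 1) / 2) (tieShare h N) i := by
  rw [indirectAfter, ← sum_direct_after hh hL, prefixSum, Finset.sum_range_succ, hL L le_rfl,
    prefixSum_eq hi, add_zero, ← Finset.sum_sub_distrib, ← Finset.sum_sub_distrib]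
  refine Finset.sum_congr rfl fun j _ => ?_
  by_cases hij : i < j
  · rw [if_pos hij, if_pos hij, if_neg (by omega)]; ring
  · rw [if_neg hij, if_neg hij, if_pos (by omega)]; ring

theorem sum_indirect_before (hh : 0 < h) (h0 : w 0 = 0) {j : ℕ} (hj : 0 < j) (hjL : j ≤ L) :
    ∑ i ∈ Finset.range L, (if i < j then 1 - directShare h N (j - i) else 0) * w i =
      indirectBefore w ((h - 1) / 2) (tieShare h N) j := by
  rw [indirectBefore, ← sum_direct_before hh h0 hj hjL, prefixSum_eq (K := L) (by omega),
    ← Finset.sum_sub_distrib]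
  refine Finset.sum_congr rfl fun i _ => ?_
  by_cases hij : i < j
  · rw [if_pos hij, if_pos hij, if_pos (by omega)]; ring
  · rw [if_neg hij, if_neg hij, if_neg (by omega)]; ring

theorem indirectTotal_eq (hh : 0 < h) (hL : ∀ x, L ≤ x → w x = 0) :
    indirectTotal w L ((h - 1) / 2) (tieShare h N) = ∑ i ∈ Finset.range L, ∑ j ∈ Finset.range L,
      if i < j then w i * w j * (1 - directShare h N (j - i)) else 0 := by
  refine Finset.sum_congr rfl fun i hi => ?_
  rw [← sum_indirect_after hh hL (Finset.mem_range.1 hi), Finset.mul_sum]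
  refine Finset.sum_congr rfl fun j _ => ?_
  split_ifs <;> ring

theorem balance_eq (hh : 0 < h) (h0 : w 0 = 0) (hL : ∀ x, L ≤ x → w x = 0) {i : ℕ}
    (hi : i < L) : balance w L ((h - 1) / 2) (tieShare h N) i =
    (∑ j ∈ Finset.range L, if i < j then w i * w j * (2 * directShare h N (j - i) - 1) else 0) -
    ∑ j ∈ Finset.range L, if j < i then w j * w i * (2 * directShare h N (i - j) - 1) else 0 := by
  rcases Nat.eq_zero_or_pos i with rfl | hp
  · simp [balance, h0]
  rw [balance, ← sum_direct_after hh hL, ← sum_indirect_after hh hL hi,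
    ← sum_direct_before hh h0 hp hi.le, ← sum_indirect_before hh h0 hp hi.le,
    ← Finset.sum_sub_distrib, ← Finset.sum_sub_distrib, ← Finset.sum_add_distrib,
    ← Finset.sum_sub_distrib, Finset.mul_sum]
  refine Finset.sum_congr rfl fun j _ => ?_
  split_ifs <;> ring

/-- Write `α` for the direct share. Counting all pairs as indirect is wrong by `2α - 1` for the
pairs with `i < r < j`. In the sum of `balance` below `r`, each pair enters with `2α - 1` at its
first position and leaves at its second one, so that the pairs with `i < r ≤ j` remain. The pairs
with an end at `r` must not count at all: those that start there have received `1 - α`, those that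
end there `(1 - α) + (2α - 1) = α`. This is the subtracted term. -/
theorem sum_pairs_inner (hh : 0 < h) (h0 : w 0 = 0) (hL : ∀ x, L ≤ x → w x = 0) {r : ℕ}
    (hr0 : 0 < r) (hr : r < L) :
    (∑ i ∈ Finset.range L, ∑ j ∈ Finset.range L, if i < j then w i * w j *
      (if i < r ∧ r < j then directShare h N (j - i)
        else if r < i ∨ j < r then 1 - directShare h N (j - i) else 0) else 0) =
    indirectTotal w L ((h - 1) / 2) (tieShare h N) +
      ∑ i ∈ Finset.range r, balance w L ((h - 1) / 2) (tieShare h N) i -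
      w r * (indirectAfter w L ((h - 1) / 2) (tieShare h N) r +
        directBefore w ((h - 1) / 2) (tieShare h N) r) := by
  have hbal : ∑ i ∈ Finset.range r, balance w L ((h - 1) / 2) (tieShare h N) i =
      (∑ i ∈ Finset.range L, ∑ j ∈ Finset.range L,
        if i < j ∧ i < r then w i * w j * (2 * directShare h N (j - i) - 1) else 0) -
      ∑ i ∈ Finset.range L, ∑ j ∈ Finset.range L,
        if i < j ∧ j < r then w i * w j * (2 * directShare h N (j - i) - 1) else 0 := by
    rw [Finset.sum_comm (f := fun i j =>
      if i < j ∧ j < r then w i * w j * (2 * directShare h N (j - i) - 1) else 0),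
      ← Finset.sum_sub_distrib]
    have : ∑ i ∈ Finset.range r, balance w L ((h - 1) / 2) (tieShare h N) i =
        ∑ i ∈ Finset.range L, if i < r then balance w L ((h - 1) / 2) (tieShare h N) i else 0 := by
      rw [← Finset.sum_filter]
      refine Finset.sum_congr ?_ fun _ _ => rfl
      ext i
      simp only [Finset.mem_range, Finset.mem_filter]
      omega
    rw [this]
    refine Finset.sum_congr rfl fun i hi => ?_
    by_cases hir : i < r
    · simp only [hir, and_true, if_true]
      exact balance_eq hh h0 hL (Finset.mem_range.1 hi)
    · simp [hir]
  have hafter : w r * indirectAfter w L ((h - 1) / 2) (tieShare h N) r =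
      ∑ i ∈ Finset.range L, ∑ j ∈ Finset.range L,
        if i < j ∧ i = r then w i * w j * (1 - directShare h N (j - i)) else 0 := by
    rw [Finset.sum_eq_single_of_mem r (Finset.mem_range.2 hr) (by
      intro i _ hir
      simp [hir]), ← sum_indirect_after hh hL hr, Finset.mul_sum]
    refine Finset.sum_congr rfl fun j _ => ?_
    simp only [and_true]
    split_ifs <;> ring
  have hbefore : w r * directBefore w ((h - 1) / 2) (tieShare h N) r =
      ∑ i ∈ Finset.range L, ∑ j ∈ Finset.range L,
        if i < j ∧ j = r then w i * w j * directShare h N (j - i) else 0 := by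
    rw [Finset.sum_comm, Finset.sum_eq_single_of_mem r (Finset.mem_range.2 hr) (by
      intro i _ hir
      simp [hir]), ← sum_direct_before hh h0 hr0 hr.le, Finset.mul_sum]
    refine Finset.sum_congr rfl fun j _ => ?_
    simp only [and_true]
    split_ifs <;> ring
  rw [mul_add, hbal, hafter, hbefore, indirectTotal_eq hh hL]
  simp only [← Finset.sum_sub_distrib, ← Finset.sum_add_distrib]
  refine Finset.sum_congr rfl fun i _ => Finset.sum_congr rfl fun j _ => ?_
  by_cases hij : i < j
  · simp only [hij, true_and, if_true]
    rcases lt_trichotomy i r with h1 | h1 | h1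
    · rcases lt_trichotomy j r with h2 | h2 | h2
      · rw [if_neg (by omega), if_pos (by omega), if_pos h1, if_pos h2, if_neg (by omega),
          if_neg (by omega)]
        ring
      · rw [if_neg (by omega), if_neg (by omega), if_pos h1, if_neg (by omega), if_neg (by omega),
          if_pos h2]
        ring
      · rw [if_pos (by omega), if_pos h1, if_neg (by omega), if_neg (by omega),
          if_neg (by omega)]
        ring
    · rw [if_neg (by omega), if_neg (by omega), if_neg (by omega), if_neg (by omega), if_pos h1,
        if_neg (by omega)]
      ring
    · rw [if_neg (by omega), if_pos (by omega), if_neg (by omega), if_neg (by omega),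
        if_neg (by omega), if_neg (by omega)]
      ring
  · simp [hij]

end PairSums

/-! ### Sums of dependencies over the pairs of one path. -/

section TraversalSums

open Classical

variable {V : Type*} {G : SimpleGraph V} {ps : ℕ → V} {L : ℕ}

/-- The weights of the inner vertices of a path by position. -/
def innerWeight (pen : V → ℕ) (ps : ℕ → V) (L x : ℕ) : ℚ :=
  if 0 < x ∧ x < L then (pen (ps x) : ℚ) else 0

theorem innerWeight_zero (pen : V → ℕ) : innerWeight pen ps L 0 = 0 := by simp [innerWeight]

theorem innerWeight_of_le (pen : V → ℕ) (x : ℕ) (hx : L ≤ x) : innerWeight pen ps L x = 0 := by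
  rw [innerWeight, if_neg (by omega)]

theorem innerWeight_inner (pen : V → ℕ) {x : ℕ} (h0 : 0 < x) (hx : x < L) :
    innerWeight pen ps L x = pen (ps x) := by
  rw [innerWeight, if_pos ⟨h0, hx⟩]

/-- The sum of `γ(s,t,v)` over the pairs of inner vertices in the order of the traversal. -/
noncomputable def pairSum (G : SimpleGraph V) (pen : V → ℕ) (ps : ℕ → V) (L : ℕ) (v : V) : ℚ :=
  ∑ i ∈ Finset.range L, ∑ j ∈ Finset.range L,
    if 0 < i ∧ i < j then gamma G pen (ps i) (ps j) v else 0

/-- The share of the shortest connections of `s` and `t` that visit `x`. -/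
noncomputable def visitShare (G : SimpleGraph V) (s t x : V) : ℚ :=
  if G.dist s x + G.dist t x = G.dist s t then
    ((sigma G s x : ℚ) * sigma G t x) / sigma G s t else 0

variable [Fintype V]

namespace IsTraversal

theorem pairSum_inner (h : IsTraversal G ps L) (hG : G.Connected) (pen : V → ℕ) {r c : ℕ} {e : ℚ}
    (hr0 : 0 < r) (hr : r < L) (hc : c = (L + G.dist (ps 0) (ps L) - 1) / 2)
    (he : e = tieShare (L + G.dist (ps 0) (ps L)) (sigma G (ps 0) (ps L))) :
    pairSum G pen ps L (ps r) = indirectTotal (innerWeight pen ps L) L c e +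
      ∑ i ∈ Finset.range r, balance (innerWeight pen ps L) L c e i -
      innerWeight pen ps L r * (indirectAfter (innerWeight pen ps L) L c e r +
        directBefore (innerWeight pen ps L) c e r) := by
  rw [hc, he, ← sum_pairs_inner (by omega) (innerWeight_zero pen) (innerWeight_of_le pen) hr0 hr]
  refine Finset.sum_congr rfl fun i hi => Finset.sum_congr rfl fun j hj => ?_
  rw [Finset.mem_range] at hi hj
  by_cases h0 : 0 < i
  · by_cases hij : i < j
    · rw [if_pos ⟨h0, hij⟩, if_pos hij, h.gamma_inner hG pen h0 hij hj hr0 hr, innerWeight_inner pen h0 hi,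
        innerWeight_inner pen (h0.trans hij) hj]
    · rw [if_neg (by tauto), if_neg hij]
  · obtain rfl : i = 0 := by omega
    simp [innerWeight_zero]

theorem pairSum_outer (h : IsTraversal G ps L) (hG : G.Connected) (pen : V → ℕ) {c : ℕ} {e : ℚ}
    {x : V} (hx : ∀ i, 0 < i → i < L → ps i ≠ x) (hc : c = (L + G.dist (ps 0) (ps L) - 1) / 2)
    (he : e = tieShare (L + G.dist (ps 0) (ps L)) (sigma G (ps 0) (ps L))) :
    pairSum G pen ps L x =
      indirectTotal (innerWeight pen ps L) L c e * visitShare G (ps 0) (ps L) x := by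
  have := h.two_le
  rw [hc, he, indirectTotal_eq (by omega) (innerWeight_of_le pen), Finset.sum_mul]
  refine Finset.sum_congr rfl fun i hi => ?_
  rw [Finset.sum_mul]
  refine Finset.sum_congr rfl fun j hj => ?_
  rw [Finset.mem_range] at hi hj
  by_cases h0 : 0 < i
  · by_cases hij : i < j
    · rw [if_pos ⟨h0, hij⟩, if_pos hij, h.gamma_outer hG pen h0 hij hj hx, innerWeight_inner pen h0 hi,
        innerWeight_inner pen (h0.trans hij) hj, visitShare]
      ring
    · rw [if_neg (by tauto), if_neg hij, zero_mul]
  · obtain rfl : i = 0 := by omega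
    simp [innerWeight_zero]

/-- Because of this, the outer contribution can be added at all vertices without a test for inner
ones. -/
theorem indirectTotal_mul_visitShare (h : IsTraversal G ps L) (hG : G.Connected) (pen : V → ℕ)
    {r c : ℕ} {e : ℚ}
    (hr0 : 0 < r) (hr : r < L) (hc : c = (L + G.dist (ps 0) (ps L) - 1) / 2)
    (he : e = tieShare (L + G.dist (ps 0) (ps L)) (sigma G (ps 0) (ps L))) :
    indirectTotal (innerWeight pen ps L) L c e * visitShare G (ps 0) (ps L) (ps r) = 0 := by
  rw [hc, he, indirectTotal_eq (by omega) (innerWeight_of_le pen), Finset.sum_mul]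
  refine Finset.sum_eq_zero fun i hi => ?_
  rw [Finset.sum_mul]
  refine Finset.sum_eq_zero fun j hj => ?_
  rw [Finset.mem_range] at hi hj
  by_cases h0 : 0 < i
  · split_ifs with hij
    · rw [mul_assoc, visitShare, h.indirect_inner hG h0 hj hr0 hr, mul_zero]
    · rw [zero_mul]
  · obtain rfl : i = 0 := by omega
    simp [innerWeight_zero]

end IsTraversal

end TraversalSums

/-! ### Enumerating the maximal induced paths -/

section Chains

open Classical

variable {V : Type*} {G : SimpleGraph V} {ps qs : ℕ → V} {L K : ℕ}

theorem exists_walk_getVert (ps : ℕ → V) (L : ℕ) (h : ∀ i, i < L → G.Adj (ps i) (ps (i + 1))) :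
    ∃ p : G.Walk (ps 0) (ps L), p.length = L ∧ ∀ i, i ≤ L → p.getVert i = ps i := by
  induction L with
  | zero => exact ⟨.nil, rfl, fun i hi => by simp [Nat.le_zero.1 hi]⟩
  | succ L ih =>
    obtain ⟨p, hp, hv⟩ := ih fun i hi => h i (by omega)
    refine ⟨p.concat (h L (by omega)), by simp [hp], fun i hi => ?_⟩
    rw [SimpleGraph.Walk.concat_eq_append, SimpleGraph.Walk.getVert_append]
    split_ifs with h1
    · exact hv i (by omega)
    · rw [hp] at h1 ⊢
      rcases (show i = L ∨ i = L + 1 by omega) with rfl | rfl <;> simp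

theorem toSubgraph_eq_of_getVert {a b a' b' : V} (p : G.Walk a b) (q : G.Walk a' b')
    (hl : p.length = q.length) (h : ∀ i, i ≤ p.length → p.getVert i = q.getVert i) :
    p.toSubgraph = q.toSubgraph := by
  have h0 := h 0 (by omega)
  have h1 := h p.length le_rfl
  rw [p.getVert_zero, q.getVert_zero] at h0
  rw [p.getVert_length, hl, q.getVert_length] at h1
  subst h0 h1
  rw [SimpleGraph.Walk.ext_getVert_le_length hl h]

theorem pairSum_congr (pen : V → ℕ) (v : V) (h : ∀ i, i < L → ps i = qs i) :
    pairSum G pen ps L v = pairSum G pen qs L v := by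
  refine Finset.sum_congr rfl fun i hi => Finset.sum_congr rfl fun j hj => ?_
  rw [h i (Finset.mem_range.1 hi), h j (Finset.mem_range.1 hj)]

variable [Fintype V]

/-- A walk that starts in a vertex whose degree is not two and proceeds along vertices of degree two
without turning back; its last vertex is arbitrary. -/
structure IsChain (G : SimpleGraph V) (ps : ℕ → V) (L : ℕ) : Prop where
  adj : ∀ i, i < L → G.Adj (ps i) (ps (i + 1))
  degree_inner : ∀ i, 0 < i → i < L → G.degree (ps i) = 2
  turn : ∀ i, 0 < i → i < L → ps (i - 1) ≠ ps (i + 1)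
  degree_start : G.degree (ps 0) ≠ 2

theorem IsTraversal.isChain (h : IsTraversal G ps L) : IsChain G ps L :=
  ⟨h.adj, h.degree_inner, fun _ h0 hi => h.pred_ne_succ h0 hi, h.degree_start⟩

namespace IsChain

theorem adj_iff (h : IsChain G ps L) {i : ℕ} (h0 : 0 < i) (hi : i < L) (y : V) :
    G.Adj (ps i) y ↔ y = ps (i - 1) ∨ y = ps (i + 1) := by
  refine two_neighbors_cover (h.degree_inner i h0 hi) ?_ (h.adj i hi) (h.turn i h0 hi) y
  have := h.adj (i - 1) (by omega)
  rw [show i - 1 + 1 = i by omega] at this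
  exact this.symm

/-- Consider the first repetition `ps a = ps b`. The start has the wrong degree, so `0 < a`, and `ps
(b - 1)` is one of the two neighbours `ps (a - 1)`, `ps (a + 1)` of `ps a`. This is an earlier
repetition, a turn, or a loop. -/
theorem ne_of_lt (h : IsChain G ps L) : ∀ b, b < L → ∀ a, a < b → ps a ≠ ps b := by
  intro b
  induction b using Nat.strong_induction_on with
  | _ b ih =>
    intro hb a hab heq
    have h2 := h.degree_inner b (by omega) hb
    rcases Nat.eq_zero_or_pos a with rfl | ha
    · exact h.degree_start (heq ▸ h2)
    have h3 := h.adj (b - 1) (by omega)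
    rw [show b - 1 + 1 = b by omega, ← heq] at h3
    rcases (h.adj_iff ha (by omega) _).1 h3.symm with h4 | h4
    · exact ih (b - 1) (by omega) (by omega) (a - 1) (by omega) h4.symm
    · rcases lt_trichotomy (a + 1) (b - 1) with h5 | h5 | h5
      · exact ih (b - 1) (by omega) (by omega) (a + 1) h5 h4.symm
      · refine h.turn (a + 1) (by omega) (by omega) ?_
        rw [Nat.add_sub_cancel, heq, h5, show b - 1 + 1 = b by omega]
      · rw [show b - 1 = a by omega] at h3
        exact h3.ne rfl

theorem eq_of_eq (h : IsChain G ps L) {a b : ℕ} (ha : a < L) (hb : b < L) (heq : ps a = ps b) :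
    a = b := by
  rcases lt_trichotomy a b with h1 | h1 | h1
  · exact absurd heq (h.ne_of_lt b hb a h1)
  · exact h1
  · exact absurd heq.symm (h.ne_of_lt a ha b h1)

/-- Only the last vertex of a chain may repeat. The bound limits the number of rounds when a path is
followed. -/
theorem length_le (h : IsChain G ps L) : L ≤ Fintype.card V := by
  have := Fintype.card_le_of_injective (fun i : Fin L => ps i)
    fun a b heq => Fin.ext (h.eq_of_eq a.2 b.2 heq)
  simpa using this

theorem isTraversal (h : IsChain G ps L) (hL : 2 ≤ L) (he : G.degree (ps L) ≠ 2)
    (hne : ps 0 ≠ ps L) : IsTraversal G ps L := by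
  have key : ∀ a, a < L → ps a ≠ ps L := fun a ha heq => by
    rcases Nat.eq_zero_or_pos a with rfl | h0
    · exact hne heq
    · exact he (heq ▸ h.degree_inner a h0 ha)
  refine ⟨hL, h.adj, fun i j hi hj heq => ?_, h.degree_inner, h.degree_start, he⟩
  rcases hi.eq_or_lt with rfl | hi
  · rcases hj.eq_or_lt with rfl | hj
    · rfl
    · exact absurd heq.symm (key j hj)
  · rcases hj.eq_or_lt with rfl | hj
    · exact absurd heq (key i hi)
    · exact h.eq_of_eq hi hj heq

/-- At a vertex of degree two the only continuation is the neighbour that the chain does not come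
from, so the first edge determines everything. With `length_eq` this identifies the path that the
program finds. -/
theorem agree (h : IsChain G ps L) (h' : IsChain G qs K) (h0 : ps 0 = qs 0) (h1 : ps 1 = qs 1) :
    ∀ i, i ≤ L → i ≤ K → ps i = qs i := by
  intro i
  induction i using Nat.strong_induction_on with
  | _ i ih =>
    intro hL hK
    match i, ih, hL, hK with
    | 0, _, _, _ => exact h0
    | 1, _, _, _ => exact h1
    | i + 2, ih, hL, hK =>
      have e1 := ih i (by omega) (by omega) (by omega)
      have e2 := ih (i + 1) (by omega) (by omega) (by omega)
      have h3 := h'.adj (i + 1) (by omega)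
      rw [← e2] at h3
      rcases (h.adj_iff (by omega) (by omega) _).1 h3 with h4 | h4
      · rw [Nat.add_sub_cancel, e1] at h4
        have := h'.turn (i + 1) (by omega) (by omega)
        rw [Nat.add_sub_cancel] at this
        exact absurd h4.symm this
      · exact h4.symm

theorem length_eq (h : IsChain G ps L) (h' : IsChain G qs K) (h0 : ps 0 = qs 0)
    (h1 : ps 1 = qs 1) (hL : 0 < L) (hK : 0 < K) (he : G.degree (ps L) ≠ 2)
    (he' : G.degree (qs K) ≠ 2) : L = K := by
  rcases lt_trichotomy L K with hlt | heq | hlt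
  · have := h'.degree_inner L hL hlt
    rw [← h.agree h' h0 h1 L le_rfl hlt.le] at this
    exact absurd this he
  · exact heq
  · have := h.degree_inner K hK hlt
    rw [h.agree h' h0 h1 K hlt.le le_rfl] at this
    exact absurd this he'

end IsChain

theorem IsMaximalInducedPath.isTraversal {u w : V} {p : G.Walk u w}
    (h : IsMaximalInducedPath G p) : IsTraversal G p.getVert p.length := by
  obtain ⟨hp, h2, hu, hw, hi⟩ := h
  refine ⟨h2, fun i hi => p.adj_getVert_succ hi, fun i j hi hj heq => hp.getVert_injOn hi hj heq,
    fun i h0 hL => hi _ (p.getVert_mem_support i) (fun e => ?_) (fun e => ?_),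
    by rwa [p.getVert_zero], by rwa [p.getVert_length]⟩
  · have := (hp.getVert_eq_start_iff hL.le).1 e
    omega
  · have := (hp.getVert_eq_end_iff hL.le).1 e
    omega

namespace IsTraversal

/-- The walk along a traversal. -/
noncomputable def walk (h : IsTraversal G ps L) : G.Walk (ps 0) (ps L) :=
  Classical.choose (exists_walk_getVert ps L h.adj)

theorem length_walk (h : IsTraversal G ps L) : h.walk.length = L :=
  (Classical.choose_spec (exists_walk_getVert ps L h.adj)).1

theorem getVert_walk (h : IsTraversal G ps L) {i : ℕ} (hi : i ≤ L) : h.walk.getVert i = ps i :=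
  (Classical.choose_spec (exists_walk_getVert ps L h.adj)).2 i hi

theorem mem_support_walk (h : IsTraversal G ps L) {x : V} :
    x ∈ h.walk.support ↔ ∃ i, i ≤ L ∧ ps i = x := by
  rw [SimpleGraph.Walk.mem_support_iff_exists_getVert]
  constructor
  · rintro ⟨i, hx, hi⟩
    rw [h.length_walk] at hi
    exact ⟨i, hi, by rw [← h.getVert_walk hi, hx]⟩
  · rintro ⟨i, hi, hx⟩
    exact ⟨i, by rw [h.getVert_walk hi, hx], by rwa [h.length_walk]⟩

theorem isPath_walk (h : IsTraversal G ps L) : h.walk.IsPath := by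
  rw [← SimpleGraph.Walk.IsPath.getVert_injOn_iff]
  intro i hi j hj heq
  simp only [Set.mem_ofPred_eq, h.length_walk] at hi hj
  rw [h.getVert_walk hi, h.getVert_walk hj] at heq
  exact h.inj i j hi hj heq

theorem isMaximalInducedPath (h : IsTraversal G ps L) : IsMaximalInducedPath G h.walk := by
  refine ⟨h.isPath_walk, by rw [h.length_walk]; exact h.two_le, h.degree_start, h.degree_end, ?_⟩
  intro x hx h0 hL
  obtain ⟨i, hi, rfl⟩ := h.mem_support_walk.1 hx
  refine h.degree_inner i (Nat.pos_of_ne_zero ?_) (lt_of_le_of_ne hi ?_) <;> rintro rfl <;> tauto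

theorem degreeTwoVerts_eq (h : IsTraversal G ps L) :
    degreeTwoVerts G h.walk.toSubgraph = (Finset.Ioo 0 L).image ps := by
  ext x
  simp only [degreeTwoVerts, Finset.mem_filter, Finset.mem_univ, true_and, Finset.mem_image,
    Finset.mem_Ioo, SimpleGraph.Walk.mem_verts_toSubgraph, h.mem_support_walk]
  constructor
  · rintro ⟨⟨i, hi, rfl⟩, hd⟩
    refine ⟨i, ⟨Nat.pos_of_ne_zero ?_, lt_of_le_of_ne hi ?_⟩, rfl⟩ <;> rintro rfl
    · exact h.degree_start hd
    · exact h.degree_end hd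
  · rintro ⟨i, ⟨h0, hi⟩, rfl⟩
    exact ⟨⟨i, hi.le, rfl⟩, h.degree_inner i h0 hi⟩

/-- `γ` is symmetric in the pair and vanishes on the diagonal, so ordered pairs count twice what the
increasing ones do. -/
theorem sum_degreeTwoVerts (h : IsTraversal G ps L) (hG : G.Connected) (pen : V → ℕ) (v : V) :
    (∑ s ∈ degreeTwoVerts G h.walk.toSubgraph, ∑ t ∈ degreeTwoVerts G h.walk.toSubgraph,
      gamma G pen s t v) = 2 * pairSum G pen ps L v := by
  have hinj : Set.InjOn ps (Finset.Ioo 0 L : Finset ℕ) := by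
    intro i hi j hj heq
    simp only [Finset.coe_Ioo, Set.mem_Ioo] at hi hj
    exact h.inj i j hi.2.le hj.2.le heq
  have hflip : pairSum G pen ps L v = ∑ i ∈ Finset.range L, ∑ j ∈ Finset.range L,
      if 0 < j ∧ j < i then gamma G pen (ps i) (ps j) v else 0 := by
    rw [pairSum, Finset.sum_comm]
    refine Finset.sum_congr rfl fun i _ => Finset.sum_congr rfl fun j _ => ?_
    rw [gamma_comm hG]
  rw [two_mul]
  nth_rewrite 2 [hflip]
  rw [pairSum, ← Finset.sum_add_distrib, h.degreeTwoVerts_eq, Finset.sum_image hinj]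
  refine Finset.sum_subset_zero_on_sdiff (fun i hi => ?_) (fun i hi => ?_) (fun i hi => ?_)
  · rw [Finset.mem_Ioo] at hi
    exact Finset.mem_range.2 hi.2
  · simp only [Finset.mem_sdiff, Finset.mem_range, Finset.mem_Ioo, not_and, not_lt] at hi
    obtain rfl : i = 0 := by by_contra h0; exact absurd (hi.2 (by omega)) (by omega)
    simp
  · rw [Finset.sum_image hinj, ← Finset.sum_add_distrib]
    rw [Finset.mem_Ioo] at hi
    refine Finset.sum_subset_zero_on_sdiff (fun j hj => ?_) (fun j hj => ?_) (fun j hj => ?_)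
    · rw [Finset.mem_Ioo] at hj
      exact Finset.mem_range.2 hj.2
    · simp only [Finset.mem_sdiff, Finset.mem_range, Finset.mem_Ioo, not_and, not_lt] at hj
      obtain rfl : j = 0 := by by_contra h0; exact absurd (hj.2 (by omega)) (by omega)
      simp
    · rw [Finset.mem_Ioo] at hj
      rcases lt_trichotomy i j with h1 | rfl | h1
      · rw [if_pos (by omega), if_neg (by omega), add_zero]
      · simp [gamma_self]
      · rw [if_neg (by omega), if_pos (by omega), zero_add]

end IsTraversal

/-! ### One direction for each path. -/

variable [LinearOrder V]

/-- The traversal `ps` starts with the edge from `u` to `y`, and its direction is the one of the two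
directions in which the first end is smaller than the last one. -/
def StartsWith (G : SimpleGraph V) (u y : V) (ps : ℕ → V) (L : ℕ) : Prop :=
  IsTraversal G ps L ∧ ps 0 = u ∧ ps 1 = y ∧ u < ps L

theorem StartsWith.unique {u y : V} (h : StartsWith G u y ps L) (hq : IsChain G qs K)
    (hK : 0 < K) (h0 : qs 0 = u) (h1 : qs 1 = y) (hd : G.degree (qs K) ≠ 2) :
    L = K ∧ ∀ i, i ≤ L → ps i = qs i := by
  have hl := h.1.isChain.length_eq hq (h.2.1.trans h0.symm) (h.2.2.1.trans h1.symm)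
    (by have := h.1.two_le; omega) hK h.1.degree_end hd
  exact ⟨hl, fun i hi => h.1.isChain.agree hq (h.2.1.trans h0.symm) (h.2.2.1.trans h1.symm) i hi
    (hl ▸ hi)⟩

/-- What the maximal induced path that starts with the edge from `u` to `y` contributes, if `u` is
the smaller one of its two ends. -/
noncomputable def dartSum (G : SimpleGraph V) (pen : V → ℕ) (u y v : V) : ℚ :=
  if h : ∃ (ps : ℕ → V) (L : ℕ), StartsWith G u y ps L then
    2 * pairSum G pen h.choose h.choose_spec.choose v else 0

theorem dartSum_eq_pairSum {u y : V} (h : StartsWith G u y ps L) (pen : V → ℕ) (v : V) :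
    dartSum G pen u y v = 2 * pairSum G pen ps L v := by
  have hex : ∃ (ps : ℕ → V) (L : ℕ), StartsWith G u y ps L := ⟨ps, L, h⟩
  rw [dartSum, dif_pos hex]
  obtain ⟨h1, h2⟩ := hex.choose_spec.choose_spec.unique h.1.isChain
    (by have := h.1.two_le; omega) h.2.1 h.2.2.1 h.1.degree_end
  rw [pairSum_congr pen v fun i hi => h2 i hi.le, h1]

theorem dartSum_eq_zero {u y : V} (hq : IsChain G qs K) (hK : 0 < K) (h0 : qs 0 = u)
    (h1 : qs 1 = y) (hd : G.degree (qs K) ≠ 2) (hlt : ¬ u < qs K) (pen : V → ℕ) (v : V) :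
    dartSum G pen u y v = 0 := by
  rw [dartSum, dif_neg]
  rintro ⟨ps, L, h⟩
  obtain ⟨e1, e2⟩ := h.unique hq hK h0 h1 hd
  exact hlt (by rw [← e1, ← e2 L le_rfl]; exact h.2.2.2)

/-- The subgraph determines its two ends, as the vertices whose degree is not two; the smaller one
is the start, and it has only one neighbour on the path. -/
theorem StartsWith.eq_of_toSubgraph_eq {u y u' y' : V} (h : StartsWith G u y ps L)
    (h' : StartsWith G u' y' qs K) (heq : h.1.walk.toSubgraph = h'.1.walk.toSubgraph) :
    u = u' ∧ y = y' := by
  have hmem : ∀ x, (∃ i, i ≤ L ∧ ps i = x) ↔ ∃ i, i ≤ K ∧ qs i = x := fun x => by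
    rw [← h.1.mem_support_walk, ← h'.1.mem_support_walk,
      ← SimpleGraph.Walk.mem_verts_toSubgraph, heq, SimpleGraph.Walk.mem_verts_toSubgraph]
  have hend : ∀ x, G.degree x ≠ 2 → (∃ i, i ≤ K ∧ qs i = x) → x = u ∨ x = ps L := by
    intro x hx hex
    obtain ⟨i, hi, rfl⟩ := (hmem x).2 hex
    rcases Nat.eq_zero_or_pos i with rfl | h0
    · exact .inl h.2.1
    · rcases hi.eq_or_lt with rfl | hi
      · exact .inr rfl
      · exact absurd (h.1.degree_inner i h0 hi) hx
  have h1 := hend (qs 0) h'.1.degree_start ⟨0, by omega, rfl⟩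
  have h2 := hend (qs K) h'.1.degree_end ⟨K, le_rfl, rfl⟩
  rw [h'.2.1] at h1
  -- If `u'` were the last vertex `ps L`, then `ps L < qs K` with `qs K` equal to `u` or `ps L`,
  -- against `u < ps L`.
  have hu : u = u' := by
    rcases h1 with h1 | h1
    · exact h1.symm
    · have hlt := h'.2.2.2
      have hlt' := h.2.2.2
      rcases h2 with h2 | h2
      · rw [h1, h2] at hlt
        exact absurd (hlt.trans hlt') (lt_irrefl _)
      · rw [h1, h2] at hlt
        exact absurd hlt (lt_irrefl _)
  refine ⟨hu, ?_⟩
  have hadj : h.1.walk.toSubgraph.Adj (ps 0) y' := by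
    have := h'.1.walk.toSubgraph_adj_getVert (i := 0)
      (by rw [h'.1.length_walk]; have := h'.1.two_le; omega)
    rw [zero_add, SimpleGraph.Walk.getVert_zero,
      h'.1.getVert_walk (by have := h'.1.two_le; omega), ← heq] at this
    have e0 : qs 0 = ps 0 := by rw [h'.2.1, ← hu, h.2.1]
    have e1 : qs 1 = y' := h'.2.2.1
    rwa [e0, e1] at this
  have := h.1.isPath_walk.snd_of_toSubgraph_adj hadj
  rw [SimpleGraph.Walk.snd, h.1.getVert_walk (by have := h.1.two_le; omega), h.2.2.1] at this
  exact this

/-- Each maximal induced path runs from its smaller to its larger end in exactly one direction, and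
the first edge in this direction is the only pair that accounts for it. -/
theorem samePathSum_eq_sum_dartSum (hG : G.Connected) (pen : V → ℕ) (v : V) :
    samePathSum G pen v = ∑ u, ∑ y, dartSum G pen u y v := by
  rw [← Finset.sum_product', samePathSum]
  symm
  have hfilter : ∑ d ∈ Finset.univ ×ˢ Finset.univ, dartSum G pen d.1 d.2 v =
      ∑ d : V × V with ∃ (ps : ℕ → V) (L : ℕ), StartsWith G d.1 d.2 ps L,
        dartSum G pen d.1 d.2 v := by
    rw [Finset.univ_product_univ, Finset.sum_filter_of_ne]
    intro d _ hd
    by_contra hcon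
    exact hd (by rw [dartSum, dif_neg hcon])
  rw [hfilter]
  refine Finset.sum_bij
    (fun d hd => (Finset.mem_filter.1 hd).2.choose_spec.choose_spec.1.walk.toSubgraph) ?_ ?_ ?_ ?_
  · intro d hd
    rw [Set.Finite.mem_toFinset]
    exact ⟨_, _, _, IsTraversal.isMaximalInducedPath _, rfl⟩
  · intro d hd d' hd' heq
    have := StartsWith.eq_of_toSubgraph_eq (Finset.mem_filter.1 hd).2.choose_spec.choose_spec
      (Finset.mem_filter.1 hd').2.choose_spec.choose_spec heq
    exact Prod.ext this.1 this.2
  · intro P hP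
    rw [Set.Finite.mem_toFinset] at hP
    have key : ∀ (a b : V) (p : G.Walk a b), IsMaximalInducedPath G p → p.toSubgraph = P →
        a < b → ∃ d, ∃ (hd : d ∈ Finset.univ.filter fun d : V × V =>
          ∃ (ps : ℕ → V) (L : ℕ), StartsWith G d.1 d.2 ps L),
          (Finset.mem_filter.1 hd).2.choose_spec.choose_spec.1.walk.toSubgraph = P := by
      intro a b p hp hP hab
      have hs : StartsWith G a (p.getVert 1) p.getVert p.length :=
        ⟨hp.isTraversal, p.getVert_zero, rfl, by rwa [p.getVert_length]⟩
      refine ⟨(a, p.getVert 1), Finset.mem_filter.2 ⟨Finset.mem_univ _, _, _, hs⟩, ?_⟩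
      generalize_proofs hex hex'
      obtain ⟨e1, e2⟩ := hex'.choose_spec.unique hs.1.isChain
        (by have := hs.1.two_le; omega) hs.2.1 hs.2.2.1 hs.1.degree_end
      rw [← hP]
      refine toSubgraph_eq_of_getVert _ _ (by rw [IsTraversal.length_walk, e1]) fun i hi => ?_
      rw [IsTraversal.length_walk] at hi
      rw [IsTraversal.getVert_walk _ hi, e2 i hi]
    obtain ⟨a, b, p, hp, rfl⟩ := hP
    -- A path from the larger to the smaller end is reversed, with the same subgraph; equal ends
    -- contradict the length.
    rcases lt_trichotomy a b with hab | rfl | hab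
    · exact key a b p hp rfl hab
    · exact absurd (hp.isTraversal.inj 0 p.length (by omega) le_rfl (by simp))
        (by have := hp.isTraversal.two_le; omega)
    · refine key b a p.reverse ?_ p.toSubgraph_reverse hab
      obtain ⟨h1, h2, h3, h4, h5⟩ := hp
      exact ⟨h1.reverse, by simpa, h4, h3, fun x hx hb ha => h5 x (by simpa using hx) ha hb⟩
  · intro d hd
    have hs := (Finset.mem_filter.1 hd).2.choose_spec.choose_spec
    rw [hs.1.sum_degreeTwoVerts hG, dartSum_eq_pairSum hs]

end Chains

-- With these rules `simp` executes loop-free programs symbolically and leaves word bounds and step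
-- counts to `omega`; loops go through `wp_for` and `wp_loop`.
attribute [simp] WordExpr.eval WordExpr.Fits WordExpr.cost RatExpr.eval RatExpr.Fits RatExpr.cost
  Memory.word_setWord Memory.rat_setRat Memory.rat_setWord Memory.word_setRat
  wp_skip wp_setWord wp_setRat wp_seq wp_cond

/-! ### Breadth-first search: the abstract algorithm -/

section BfsOrder

variable {V : Type*} {G : SimpleGraph V} {s : V} {ord : List V} {k : ℕ}

/-- The queue `ord` of a breadth-first search from `s` whose first `k` entries have been
processed. -/
structure IsBfsOrder (G : SimpleGraph V) (s : V) (ord : List V) (k : ℕ) : Prop where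
  nodup : ord.Nodup
  head : ord[0]? = some s
  sorted : ord.Pairwise fun a b => G.dist s a ≤ G.dist s b
  closed : ∀ x ∈ ord.take k, ∀ y, G.Adj x y → y ∈ ord
  near : ∀ x, ord[k]? = some x → ∀ z ∈ ord, G.dist s z ≤ G.dist s x + 1

theorem isBfsOrder_singleton (G : SimpleGraph V) (s : V) : IsBfsOrder G s [s] 0 := by
  refine ⟨by simp, by simp, by simp, by simp, ?_⟩
  intro x hx z hz
  simp only [List.mem_singleton] at hz
  subst hz
  simp

namespace IsBfsOrder

theorem source_mem (h : IsBfsOrder G s ord k) : s ∈ ord := List.mem_of_getElem? h.head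

theorem mem_take_of_dist_lt {m : ℕ} (h : IsBfsOrder G s ord m) {x y : V} (hx : ord[k]? = some x)
    (hy : y ∈ ord) (hlt : G.dist s y < G.dist s x) : y ∈ ord.take k := by
  obtain ⟨i, hi, rfl⟩ := List.mem_iff_getElem.1 hy
  obtain ⟨hk, rfl⟩ := List.getElem?_eq_some_iff.1 hx
  rw [List.mem_take_iff_getElem]
  rcases lt_trichotomy i k with h1 | rfl | h1
  · exact ⟨i, by omega, rfl⟩
  · omega
  · have := List.pairwise_iff_getElem.1 h.sorted k i hk hi h1
    omega

/-- Induction on the distance: a predecessor of `v` is closer to `s` than `x`, so it stands before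
`x` in the queue and has been processed, and all its neighbours, `v` among them, are queued. -/
theorem mem_of_dist_le (h : IsBfsOrder G s ord k) (hG : G.Connected) {x : V}
    (hx : ord[k]? = some x) : ∀ v, G.dist s v ≤ G.dist s x → v ∈ ord := by
  intro v
  induction hd : G.dist s v generalizing v with
  | zero =>
    intro _
    rw [← hG.dist_eq_zero_iff.1 hd]
    exact h.source_mem
  | succ d ih =>
    intro hle
    have hvs : v ≠ s := by rintro rfl; simp at hd
    obtain ⟨y, hy, hdy⟩ := exists_adj_dist_add_one hG hvs
    exact h.closed y (h.mem_take_of_dist_lt hx (ih y (by omega) (by omega)) (by omega)) v hy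

theorem mem_of_length_le (h : IsBfsOrder G s ord k) (hG : G.Connected) (hk : ord.length ≤ k)
    (v : V) : v ∈ ord := by
  induction hd : G.dist s v generalizing v with
  | zero =>
    rw [← hG.dist_eq_zero_iff.1 hd]
    exact h.source_mem
  | succ d ih =>
    have hvs : v ≠ s := by rintro rfl; simp at hd
    obtain ⟨y, hy, hdy⟩ := exists_adj_dist_add_one hG hvs
    exact h.closed y (by rw [List.take_of_length_le hk]; exact ih y (by omega)) v hy

/-- By `mem_of_dist_le` an unqueued vertex is farther than `x`, and a neighbour is at most one
farther. This is why the queue stays sorted. -/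
theorem dist_new (h : IsBfsOrder G s ord k) (hG : G.Connected) {x y : V}
    (hx : ord[k]? = some x) (hxy : G.Adj x y) (hy : y ∉ ord) : G.dist s y = G.dist s x + 1 := by
  have h1 := dist_le_dist_add_one hG s hxy
  have h2 := mt (h.mem_of_dist_le hG hx y) hy
  omega

theorem push (h : IsBfsOrder G s ord k) (hG : G.Connected) {x y : V} (hx : ord[k]? = some x)
    (hxy : G.Adj x y) (hy : y ∉ ord) : IsBfsOrder G s (ord ++ [y]) k := by
  have hd := h.dist_new hG hx hxy hy
  have hk : k < ord.length := (List.getElem?_eq_some_iff.1 hx).1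
  refine ⟨?_, ?_, ?_, ?_, ?_⟩
  · rw [List.nodup_append]
    refine ⟨h.nodup, by simp, ?_⟩
    rintro a ha b hb rfl
    exact hy (List.mem_singleton.1 hb ▸ ha)
  · rw [List.getElem?_append_left (by omega), h.head]
  · rw [List.pairwise_append]
    refine ⟨h.sorted, by simp, ?_⟩
    intro a ha b hb
    rw [List.mem_singleton.1 hb, hd]
    exact h.near x hx a ha
  · intro a ha b hab
    rw [List.take_append_of_le_length hk.le] at ha
    exact List.mem_append_left _ (h.closed a ha b hab)
  · intro a ha z hz
    rw [List.getElem?_append_left hk, hx, Option.some_inj] at ha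
    subst ha
    rcases List.mem_append.1 hz with hz | hz
    · exact h.near x hx z hz
    · rw [List.mem_singleton.1 hz, hd]

theorem advance (h : IsBfsOrder G s ord k) {x : V} (hx : ord[k]? = some x)
    (hc : ∀ y, G.Adj x y → y ∈ ord) : IsBfsOrder G s ord (k + 1) := by
  refine ⟨h.nodup, h.head, h.sorted, ?_, ?_⟩
  · intro a ha y hay
    obtain ⟨hk, rfl⟩ := List.getElem?_eq_some_iff.1 hx
    rw [List.take_succ_eq_append_getElem hk, List.mem_append, List.mem_singleton] at ha
    rcases ha with ha | rfl
    · exact h.closed a ha y hay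
    · exact hc y hay
  · intro a ha z hz
    obtain ⟨hk, rfl⟩ := List.getElem?_eq_some_iff.1 hx
    obtain ⟨hk', rfl⟩ := List.getElem?_eq_some_iff.1 ha
    have h1 := h.near _ hx z hz
    have h2 := List.pairwise_iff_getElem.1 h.sorted k (k + 1) hk hk' (by omega)
    omega

end IsBfsOrder

end BfsOrder

/-! ### The input graph in memory -/

section Graph

variable {n : ℕ}

/-- The number of entries of all adjacency lists. -/
def totalLength (adj : Fin n → List (Fin n)) : ℕ := ∑ v, (adj v).length

/-- The memory holds the adjacency lists in the input format. -/
structure HasGraph (adj : Fin n → List (Fin n)) (M : Memory) : Prop where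
  size : M.word 0 0 = n
  start : ∀ v : Fin n, M.word 1 v = blockStart adj v
  finish : ∀ v : Fin n, M.word 1 (v + 1) = blockStart adj v + (adj v).length
  nbr : ∀ (v : Fin n) (p : ℕ) (hp : p < (adj v).length),
    M.word 2 (blockStart adj v + p) = (adj v)[p]

theorem HasGraph.frame {adj : Fin n → List (Fin n)} {M M' : Memory} (h : HasGraph adj M)
    (h0 : ∀ j, M'.word 0 j = M.word 0 j) (h1 : ∀ j, M'.word 1 j = M.word 1 j)
    (h2 : ∀ j, M'.word 2 j = M.word 2 j) : HasGraph adj M' :=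
  ⟨by rw [h0, h.size], fun v => by rw [h1, h.start], fun v => by rw [h1, h.finish],
    fun v p hp => by rw [h2, h.nbr]⟩

theorem HasGraph.runs {adj : Fin n → List (Fin n)} {M M' : Memory} {B T : ℕ} {p : Prog}
    (h : HasGraph adj M) (hr : Runs B p M T M') (hp : ∀ a ∈ p.wordArrays, 2 < a) :
    HasGraph adj M' :=
  h.frame (hr.word_eq fun ha => absurd (hp _ ha) (by omega))
    (hr.word_eq fun ha => absurd (hp _ ha) (by omega))
    (hr.word_eq fun ha => absurd (hp _ ha) (by omega))

theorem blockStart_succ (adj : Fin n → List (Fin n)) (v : Fin n) :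
    blockStart adj (v + 1) = blockStart adj v + (adj v).length := by
  rw [blockStart, blockStart, List.take_succ_eq_append_getElem (by simp)]
  simp

theorem blockStart_le (adj : Fin n → List (Fin n)) (i : ℕ) :
    blockStart adj i ≤ totalLength adj := by
  have h1 : totalLength adj = ((List.finRange n).map fun v => (adj v).length).sum := by
    rw [totalLength, ← List.ofFn_eq_map, List.sum_ofFn]
  have h2 : (((List.finRange n).take i ++ (List.finRange n).drop i).map
      fun v => (adj v).length).sum = totalLength adj := by rw [List.take_append_drop, h1]
  rw [List.map_append, List.sum_append] at h2
  rw [← h2, blockStart]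
  exact Nat.le_add_right _ _

theorem blockStart_add_le (adj : Fin n → List (Fin n)) (v : Fin n) :
    blockStart adj v + (adj v).length ≤ totalLength adj :=
  blockStart_succ adj v ▸ blockStart_le adj _

theorem flatMap_getElem?_blockStart (adj : Fin n → List (Fin n)) (v : Fin n) (p : ℕ)
    (hp : p < (adj v).length) :
    ((List.finRange n).flatMap adj)[blockStart adj v + p]? = some (adj v)[p] := by
  have hlen : (((List.finRange n).take v).flatMap adj).length = blockStart adj v := by
    rw [List.length_flatMap, blockStart]
  have hv : (List.finRange n).drop v = v :: (List.finRange n).drop (v + 1) := by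
    rw [List.drop_eq_getElem_cons (by simp)]
    simp
  have hsplit : (List.finRange n).flatMap adj =
      ((List.finRange n).take v).flatMap adj ++ (adj v ++
        ((List.finRange n).drop (v + 1)).flatMap adj) := by
    rw [← List.flatMap_cons, ← hv, ← List.flatMap_append, List.take_append_drop]
  rw [hsplit, List.getElem?_append_right (by omega), hlen, Nat.add_sub_cancel_left,
    List.getElem?_append_left hp, List.getElem?_eq_getElem hp]

theorem hasGraph_inputMemory (adj : Fin n → List (Fin n)) (pen : Fin n → ℕ) :
    HasGraph adj (inputMemory adj pen) := by
  refine ⟨by simp [inputMemory], fun v => ?_, fun v => ?_, fun v p hp => ?_⟩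
  · simp [inputMemory, v.2.le]
  · rw [← blockStart_succ]
    simp [inputMemory, v.2]
  · simp [inputMemory, flatMap_getElem?_blockStart adj v p hp, List.getD_eq_getElem?_getD]

end Graph

/-! ### Breadth-first search: the program -/

namespace Prog

open WordExpr

/-- Set the cells `0, …, n - 1` of the word array `a` to zero. -/
def clear (a : ℕ) : Prog :=
  .seq (setVar 4 (.const 0))
    (.loop (lt (var 4) (var 0))
      (.seq (.setWord a (var 4) (.const 0)) (setVar 4 (.add (var 4) (.const 1)))))

/-- Append the neighbour `y` of `x` that is read from cell `e` to the queue, if it is new. -/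
def visit (d : ℕ) : Prog :=
  .seq (setVar 10 (.get 2 (var 8)))
    (.seq (.cond (.get d (var 10)) .skip
      (.seq (.setWord d (var 10) (.add (.get d (var 11)) (.const 1)))
        (.seq (.setWord 5 (var 6) (var 10)) (setVar 6 (.add (var 6) (.const 1))))))
      (setVar 8 (.add (var 8) (.const 1))))

/-- Process the next vertex `x` of the queue. -/
def expand (d : ℕ) : Prog :=
  .seq (.seq (setVar 11 (.get 5 (var 7))) (setVar 8 (.get 1 (var 11))))
    (.seq (.loop (lt (var 8) (.get 1 (.add (var 11) (.const 1)))) (visit d))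
      (setVar 7 (.add (var 7) (.const 1))))

/-- Breadth-first search from the vertex in variable `3`: array `d` receives the distances plus one,
and array `5` the vertices in the order of their distances. -/
def search (d : ℕ) : Prog :=
  .seq (clear d)
    (.seq (.seq (.setWord d (var 3) (.const 1)) (.seq (.setWord 5 (.const 0) (var 3))
      (.seq (setVar 6 (.const 1)) (setVar 7 (.const 0)))))
      (.loop (lt (var 7) (var 6)) (expand d)))

end Prog

section Search

variable {n B : ℕ} {G : SimpleGraph (Fin n)} {adj : Fin n → List (Fin n)} {M : Memory} {d : ℕ}

theorem clear_spec (hB : n + 1 ≤ B) (hd : 11 < d) (hn : M.word 0 0 = n) :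
    Wp B (.clear d) M fun T M' => T ≤ 20 * n + 10 ∧ ∀ i, i < n → M'.word d i = 0 := by
  -- The distance array is a parameter; that it differs from the scalar and queue arrays is needed
  -- in both orientations to resolve memory accesses.
  have hd' : ∀ a, a < 12 → a ≠ d := by omega
  have hd'' : ∀ a, a < 12 → d ≠ a := by omega
  rw [Prog.clear, wp_seq]
  simp only [wp_setWord]
  refine ⟨by simp, by simp, ?_⟩
  refine (wp_for_const n (fun k M => M.word 0 0 = n ∧ M.word 4 0 = k ∧
    ∀ i, i < k → M.word d i = 0) 11 ?_ ?_ _ ?_).imp ?_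
  · rintro k M hk ⟨h0, h4, h⟩
    simp [h0, h4]
    omega
  · rintro k M hk ⟨h0, h4, h⟩
    simp [h0, h4, hd', hd'']
    refine ⟨by omega, by omega, fun i hi hne => h i (by omega)⟩
  · simp [hn]
  · rintro T M' ⟨hT, h0, h4, h⟩
    simp at hT ⊢
    exact ⟨by omega, h⟩

theorem dist_lt_card (hG : G.Connected) (s x : Fin n) : G.dist s x < n := by
  obtain ⟨p, hp, hl⟩ := hG.exists_path_of_dist s x
  simpa [← hl] using hp.length_lt

/-- The memory during a breadth-first search with queue `ord`. -/
structure BfsMemory (G : SimpleGraph (Fin n)) (adj : Fin n → List (Fin n)) (d : ℕ) (s : Fin n)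
    (ord : List (Fin n)) (M : Memory) : Prop where
  graph : HasGraph adj M
  tail : M.word 6 0 = ord.length
  queue : ∀ i (h : i < ord.length), M.word 5 i = ord[i]
  dist : ∀ v ∈ ord, M.word d v = G.dist s v + 1
  fresh : ∀ v ∉ ord, M.word d v = 0

theorem visit_spec (hB : totalLength adj + 10 * n + 100 ≤ B) (hd : 11 < d) (hG : G.Connected)
    (hadj : IsAdjacencyList G adj) {s x : Fin n} {ord : List (Fin n)} {k p : ℕ}
    (hM : BfsMemory G adj d s ord M) (ho : IsBfsOrder G s ord k) (hx : ord[k]? = some x)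
    (h8 : M.word 8 0 = blockStart adj x + p) (h11 : M.word 11 0 = x) (h7 : M.word 7 0 = k)
    (hp : p < (adj x).length) :
    Wp B (.visit d) M fun T M' => T ≤ 60 ∧ M'.word 8 0 = blockStart adj x + (p + 1) ∧
      M'.word 11 0 = x ∧ M'.word 7 0 = k ∧ ∃ ord', BfsMemory G adj d s ord' M' ∧
        IsBfsOrder G s ord' k ∧ ord'[k]? = some x ∧ (adj x)[p] ∈ ord' ∧ ord <+: ord' := by
  have hd' : ∀ a, a < 12 → a ≠ d := by omega
  have hd'' : ∀ a, a < 12 → d ≠ a := by omega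
  have hlen : ord.length ≤ n := by simpa using ho.nodup.length_le_card
  have hbs := blockStart_add_le adj x
  have hnb := hM.graph.nbr x p hp
  have hdistle := dist_lt_card hG s x
  have hxo : x ∈ ord := List.mem_of_getElem? hx
  have hdx := hM.dist x hxo
  have hxy : G.Adj x (adj x)[p] := ((hadj x).2 _).1 (List.getElem_mem hp)
  rw [Prog.visit]
  generalize (adj x)[p] = y at *
  have hy := y.2
  simp [hd', hd'', h8, h11, h7, hnb, hM.tail, hdx]
  -- As distances are stored plus one, an entry is zero exactly if the vertex is not queued yet.
  refine ⟨by omega, ⟨by omega, ?_⟩, fun hne => ⟨by omega, by omega, ord, ?_, ho, hx, ?_, ?_⟩,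
    fun heq => ⟨by omega, by omega, by omega, by omega, by omega, by omega, by omega, ord ++ [y],
      ?_, ?_, ?_, ?_, ?_⟩⟩
  · by_cases hyo : y ∈ ord
    · rw [hM.dist y hyo]
      have := dist_lt_card hG s y
      omega
    · rw [hM.fresh y hyo]
      omega
  · exact ⟨hM.graph.frame (by simp) (by simp) (by simp), by simp [hM.tail],
      fun i h => by simp [hM.queue i h], fun v hv => by simp [hM.dist v hv, hd''],
      fun v hv => by simp [hM.fresh v hv, hd'']⟩
  · by_contra hyo
    exact hne (hM.fresh y hyo)
  · exact List.prefix_refl _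
  · have hyo : y ∉ ord := fun hyo => by
      have := hM.dist y hyo
      omega
    refine ⟨hM.graph.frame (by simp [hd']) (by simp [hd']) (by simp [hd']), by simp, ?_, ?_, ?_⟩
    · intro i h
      simp only [List.length_append, List.length_singleton] at h
      rcases (show i < ord.length ∨ i = ord.length by omega) with h1 | rfl
      · simp [hd', h1.ne, hM.queue i h1, List.getElem_append_left h1]
      · simp
    · intro v hv
      rcases List.mem_append.1 hv with h1 | h1
      · have hvy : (v : ℕ) ≠ y := fun e => hyo (Fin.ext e ▸ h1)
        simp [hd'', hvy, hM.dist v h1]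
      · rw [List.mem_singleton.1 h1]
        simp [hd'', ho.dist_new hG hx hxy hyo]
    · intro v hv
      simp only [List.mem_append, List.mem_singleton, not_or] at hv
      have hvy : (v : ℕ) ≠ y := fun e => hv.2 (Fin.ext e)
      simp [hd'', hvy, hM.fresh v hv.1]
  · have hyo : y ∉ ord := fun hyo => by
      have := hM.dist y hyo
      omega
    exact ho.push hG hx hxy hyo
  · rw [List.getElem?_append_left (List.getElem?_eq_some_iff.1 hx).1, hx]
  · simp
  · exact List.prefix_append _ _

theorem expand_spec (hB : totalLength adj + 10 * n + 100 ≤ B) (hd : 11 < d) (hG : G.Connected)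
    (hadj : IsAdjacencyList G adj) {s x : Fin n} {ord : List (Fin n)} {k : ℕ}
    (hM : BfsMemory G adj d s ord M) (ho : IsBfsOrder G s ord k) (hx : ord[k]? = some x)
    (h7 : M.word 7 0 = k) :
    Wp B (.expand d) M fun T M' => T ≤ 80 * (adj x).length + 50 ∧ M'.word 7 0 = k + 1 ∧
      ∃ ord', BfsMemory G adj d s ord' M' ∧ IsBfsOrder G s ord' (k + 1) ∧
        ord'[k]? = some x ∧ ord <+: ord' := by
  have hd' : ∀ a, a < 12 → a ≠ d := by omega
  have hd'' : ∀ a, a < 12 → d ≠ a := by omega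
  have hlen : ord.length ≤ n := by simpa using ho.nodup.length_le_card
  have hbs := blockStart_add_le adj x
  have hk := (List.getElem?_eq_some_iff.1 hx).1
  have hqx : M.word 5 k = x := by
    rw [hM.queue k hk]
    exact congrArg Fin.val (List.getElem?_eq_some_iff.1 hx).2
  have hst := hM.graph.start x
  have hx2 := x.2
  rw [Prog.expand, wp_seq]
  have setup : Wp B (.seq (.setVar 11 (.get 5 (.var 7))) (.setVar 8 (.get 1 (.var 11)))) M
      fun T M' => T ≤ 20 ∧ BfsMemory G adj d s ord M' ∧ M'.word 7 0 = k ∧ M'.word 11 0 = x ∧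
        M'.word 8 0 = blockStart adj x := by
    simp [h7, hqx, hst]
    refine ⟨by omega, by omega, ?_⟩
    exact ⟨hM.graph.frame (by simp) (by simp) (by simp), by simp [hM.tail],
      fun i h => by simp [hM.queue i h], fun v hv => by simp [hM.dist v hv, hd''],
      fun v hv => by simp [hM.fresh v hv, hd'']⟩
  refine setup.imp ?_
  rintro T₁ M₁ ⟨hT₁, hM₁, h7₁, h11₁, h8₁⟩
  rw [wp_seq]
  refine (wp_for_const (adj x).length (fun p M => M.word 8 0 = blockStart adj x + p ∧
    M.word 11 0 = x ∧ M.word 7 0 = k ∧ ∃ ord', BfsMemory G adj d s ord' M ∧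
        IsBfsOrder G s ord' k ∧ ord'[k]? = some x ∧ (∀ y ∈ (adj x).take p, y ∈ ord') ∧ ord <+: ord')
    60 ?_ ?_ _ ?_).imp ?_
  · rintro p M hp ⟨h8, h11, h7, ord', hM', -⟩
    simp [h8, h11, hM'.graph.finish x]
    omega
  · rintro p M hp ⟨h8, h11, h7, ord', hM', ho', hx', hy', hpre⟩
    refine (visit_spec hB hd hG hadj hM' ho' hx' h8 h11 h7 hp).imp ?_
    rintro T M' ⟨hT, h8', h11', h7', ord'', hM'', ho'', hx'', hmem, hsub⟩
    refine ⟨hT, h8', h11', h7', ord'', hM'', ho'', hx'', fun y hy => ?_, hpre.trans hsub⟩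
    rw [List.take_succ_eq_append_getElem hp, List.mem_append, List.mem_singleton] at hy
    rcases hy with hy | rfl
    · exact hsub.subset (hy' y hy)
    · exact hmem
  · exact ⟨h8₁, h11₁, h7₁, ord, hM₁, ho, hx, by simp, List.prefix_refl _⟩
  · rintro T₂ M₂ ⟨hT₂, h8, h11, h7', ord', hM', ho', hx', hy', hpre⟩
    have hlen' : ord'.length ≤ n := by simpa using ho'.nodup.length_le_card
    have hk' := (List.getElem?_eq_some_iff.1 hx').1
    simp at hT₂
    simp [h7']
    refine ⟨by omega, by omega, ord', ?_, ho'.advance hx' fun y hy => hy' y ?_, hx', hpre⟩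
    · exact ⟨hM'.graph.frame (by simp) (by simp) (by simp), by simp [hM'.tail],
        fun i h => by simp [hM'.queue i h], fun v hv => by simp [hM'.dist v hv, hd''],
        fun v hv => by simp [hM'.fresh v hv, hd'']⟩
    · rw [List.take_length]
      exact ((hadj x).2 y).2 hy

theorem search_spec (hB : totalLength adj + 10 * n + 100 ≤ B) (hd : 11 < d) (hG : G.Connected)
    (hadj : IsAdjacencyList G adj) {s : Fin n} (hM : HasGraph adj M) (h3 : M.word 3 0 = s) :
    Wp B (.search d) M fun T M' => T ≤ 80 * totalLength adj + 100 * n + 100 ∧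
      ∃ ord, BfsMemory G adj d s ord M' ∧ IsBfsOrder G s ord n ∧ ord.length = n := by
  have hd' : ∀ a, a < 12 → a ≠ d := by omega
  have hd'' : ∀ a, a < 12 → d ≠ a := by omega
  have hs := s.2
  rw [Prog.search, wp_seq]
  refine (clear_spec (by omega) hd hM.size).imp_runs ?_
  rintro T₀ M₀ hr ⟨hT₀, hc⟩
  have hM₀ : HasGraph adj M₀ := hM.runs hr (by simp [Prog.clear, Prog.wordArrays]; omega)
  have h3₀ : M₀.word 3 0 = s := by
    rw [hr.word_eq (by simp [Prog.clear, Prog.wordArrays]; omega), h3]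
  rw [wp_seq]
  have setup : Wp B (.seq (.setWord d (.var 3) (.const 1)) (.seq (.setWord 5 (.const 0) (.var 3))
      (.seq (.setVar 6 (.const 1)) (.setVar 7 (.const 0))))) M₀
      fun T M' => T ≤ 30 ∧ BfsMemory G adj d s [s] M' ∧ M'.word 7 0 = 0 := by
    simp [h3₀, hd']
    refine ⟨by omega, by omega, by omega, by omega, ?_⟩
    refine ⟨hM₀.frame (by simp [hd']) (by simp [hd']) (by simp [hd']), by simp, by simp [hd'],
      by simp [hd''], fun v hv => ?_⟩
    have hvs : (v : ℕ) ≠ s := fun e => hv (by rw [Fin.ext e]; exact List.mem_singleton_self s)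
    simp [hd'', hvs, hc]
  refine setup.imp ?_
  rintro T₁ M₁ ⟨hT₁, hM₁, h7₁⟩
  -- The queue grows while it is processed, so a potential is used: every vertex that is not yet
  -- processed holds the cost of scanning its adjacency list.
  have key := wp_loop (B := B) (p := .expand d) (b := .lt (.var 7) (.var 6))
    (fun (ok : List (Fin n) × ℕ) M => BfsMemory G adj d s ok.1 M ∧ IsBfsOrder G s ok.1 ok.2 ∧
      M.word 7 0 = ok.2 ∧ ok.2 ≤ ok.1.length)
    (fun ok => (∑ v ∈ Finset.univ \ (ok.1.take ok.2).toFinset, (80 * (adj v).length + 60)) + 6)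
    ?_ ([s], 0) M₁ ⟨hM₁, isBfsOrder_singleton G s, h7₁, by simp⟩
  · refine key.imp ?_
    rintro T₂ M₂ ⟨hT₂, ⟨ord, k⟩, ⟨hM₂, ho, h7, hk⟩, hb⟩
    simp [h7, hM₂.tail] at hb hk
    obtain rfl : k = ord.length := by omega
    have hall := ho.mem_of_length_le hG le_rfl
    have hlen : ord.length = n := by
      have h1 : ord.toFinset = Finset.univ := by ext v; simp [hall v]
      rw [← List.toFinset_card_of_nodup ho.nodup, h1, Finset.card_univ, Fintype.card_fin]
    refine ⟨?_, ord, hM₂, by rw [hlen] at ho; exact ho, hlen⟩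
    simp [Finset.sum_add_distrib, ← Finset.mul_sum] at hT₂
    rw [totalLength]
    omega
  · rintro ⟨ord, k⟩ M ⟨hM, ho, h7, hk⟩
    have hlen : ord.length ≤ n := by simpa using ho.nodup.length_le_card
    simp only at hk h7 hM
    simp [h7, hM.tail]
    refine ⟨by omega, fun hlt => ?_⟩
    have hx : ord[k]? = some ord[k] := List.getElem?_eq_getElem (by omega)
    refine (expand_spec hB hd hG hadj hM ho hx h7).imp ?_
    rintro T M' ⟨hT, h7', ord', hM', ho', hx', hpre⟩
    have hk' := (List.getElem?_eq_some_iff.1 hx').1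
    rw [h7']
    refine ⟨ord', ⟨hM', ho', hk'⟩, ?_⟩
    obtain ⟨l, rfl⟩ := hpre
    have htake : (ord ++ l).take (k + 1) = ord.take k ++ [ord[k]] := by
      rw [List.take_append_of_le_length (by omega), List.take_succ_eq_append_getElem]
    have hnot : ord[k] ∉ (ord.take k).toFinset := by
      rw [List.mem_toFinset, List.mem_take_iff_getElem]
      rintro ⟨i, hi, he⟩
      have := (List.Nodup.getElem_inj_iff ho.nodup).1 he
      omega
    change _ + T + ((∑ v ∈ Finset.univ \ ((ord ++ l).take (k + 1)).toFinset, _) + 6) ≤ _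
    rw [htake]
    generalize ord.take k = t at hnot ⊢
    generalize ord[k] = x at hnot hT ⊢
    have hsdiff : Finset.univ \ t.toFinset =
        insert x (Finset.univ \ (t ++ [x]).toFinset) := by
      ext v
      by_cases hv : v = x
      · subst hv; simpa using hnot
      · simp [hv]
    rw [hsdiff, Finset.sum_insert (by simp)]
    omega

end Search

/-! ### Counting shortest paths: the program -/

namespace Prog

open WordExpr

/-- Add the count of the neighbour `y` of `x` that is read from cell `e` to the count of `x`, if `y`
precedes `x` on a shortest path. -/
def gather (d c : ℕ) : Prog :=
  .seq (setVar 10 (.get 2 (var 8)))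
    (.seq (.cond (ne (.add (.get d (var 10)) (.const 1)) (.get d (var 11))) .skip
      (.setRat c (var 11) (.add (.get c (var 11)) (.get c (var 10)))))
      (setVar 8 (.add (var 8) (.const 1))))

/-- Compute the count of the next vertex `x` of the queue. -/
def countVertex (d c : ℕ) : Prog :=
  .seq (.seq (setVar 11 (.get 5 (var 7)))
    (.seq (.setRat c (var 11) (.ofWord (.sub (.const 1) (var 7)))) (setVar 8 (.get 1 (var 11)))))
    (.seq (.loop (lt (var 8) (.get 1 (.add (var 11) (.const 1)))) (gather d c))
      (setVar 7 (.add (var 7) (.const 1))))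

/-- Compute the numbers of shortest paths from the vertex in variable `3` into the rational array
`c`, and the distances plus one into the word array `d`. -/
def bfs (d c : ℕ) : Prog :=
  .seq (search d) (.seq (setVar 7 (.const 0)) (.loop (lt (var 7) (var 0)) (countVertex d c)))

end Prog

section Count

variable {n B : ℕ} {G : SimpleGraph (Fin n)} {adj : Fin n → List (Fin n)} {M : Memory} {d c : ℕ}

theorem BfsMemory.frame {s : Fin n} {ord : List (Fin n)} {M M' : Memory}
    (hM : BfsMemory G adj d s ord M)
    (h : ∀ a, a = 0 ∨ a = 1 ∨ a = 2 ∨ a = 5 ∨ a = 6 ∨ a = d → ∀ j, M'.word a j = M.word a j) :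
    BfsMemory G adj d s ord M' :=
  ⟨hM.graph.frame (h 0 (by simp)) (h 1 (by simp)) (h 2 (by simp)),
    by rw [h 6 (by simp), hM.tail], fun i hi => by rw [h 5 (by simp), hM.queue i hi],
    fun v hv => by rw [h d (by simp), hM.dist v hv], fun v hv => by rw [h d (by simp), hM.fresh v hv]⟩

open Classical in
theorem sum_map_adj (hadj : IsAdjacencyList G adj) (x : Fin n) {R : Type*} [AddCommMonoid R]
    (f : Fin n → R) : ((adj x).map f).sum = ∑ y, if G.Adj x y then f y else 0 := by
  rw [← List.sum_toFinset f (hadj x).1, ← Finset.sum_filter]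
  refine Finset.sum_congr ?_ fun _ _ => rfl
  ext y
  simp [(hadj x).2 y]

open Classical in
theorem sum_predecessors (hadj : IsAdjacencyList G adj) (hG : G.Connected) {s x : Fin n}
    (hx : x ≠ s) : ((adj x).map fun y =>
      if G.dist s y + 1 = G.dist s x then (sigma G s y : ℚ) else 0).sum = sigma G s x := by
  rw [sum_map_adj hadj, sigma_eq_sum hG hx]
  push_cast
  refine Finset.sum_congr rfl fun y _ => ?_
  by_cases h : G.Adj x y <;> simp [h]

theorem gather_spec (hB : totalLength adj + 10 * n + 100 ≤ B) (hd : 11 < d) (hG : G.Connected)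
    {s x : Fin n} {ord : List (Fin n)} {k m p : ℕ}
    (hM : BfsMemory G adj d s ord M) (ho : IsBfsOrder G s ord m) (hall : ∀ v, v ∈ ord)
    (hx : ord[k]? = some x)
    (h8 : M.word 8 0 = blockStart adj x + p) (h11 : M.word 11 0 = x) (h7 : M.word 7 0 = k)
    (hp : p < (adj x).length) (hc : ∀ v ∈ ord.take k, M.rat c v = sigma G s v) :
    Wp B (.gather d c) M fun T M' => T ≤ 60 ∧ BfsMemory G adj d s ord M' ∧
      M'.word 8 0 = blockStart adj x + (p + 1) ∧
      M'.word 11 0 = x ∧ M'.word 7 0 = k ∧ (∀ v ∈ ord.take k, M'.rat c v = sigma G s v) ∧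
      M'.rat c x = M.rat c x + if G.dist s (adj x)[p] + 1 = G.dist s x then
        (sigma G s (adj x)[p] : ℚ) else 0 := by
  have hd'' : ∀ a, a < 12 → d ≠ a := by omega
  have hbs := blockStart_add_le adj x
  have hnb := hM.graph.nbr x p hp
  have hlx := dist_lt_card hG s x
  have hly := dist_lt_card hG s (adj x)[p]
  have hdx := hM.dist x (hall x)
  have hdy := hM.dist _ (hall (adj x)[p])
  have hxk : x ∉ ord.take k := by
    obtain ⟨hk, rfl⟩ := List.getElem?_eq_some_iff.1 hx
    rw [List.mem_take_iff_getElem]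
    rintro ⟨i, hi, he⟩
    have := (List.Nodup.getElem_inj_iff ho.nodup).1 he
    omega
  rw [Prog.gather]
  generalize (adj x)[p] = y at *
  have hy := y.2
  have hx2 := x.2
  simp [hd'', h8, h11, h7, hnb, hdx, hdy]
  refine ⟨by omega, by omega, fun hne => ⟨by omega, ?_, by omega, hc, ?_⟩,
    fun h1 h2 => ⟨by omega, by omega, by omega, ?_, by omega, ?_, ?_⟩⟩
  · refine hM.frame fun a ha j => ?_
    have : a ≠ 10 ∧ a ≠ 8 := by omega
    simp [this]
  · exact fun h => absurd h (by omega)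
  · refine hM.frame fun a ha j => ?_
    have : a ≠ 10 ∧ a ≠ 8 := by omega
    simp [this]
  · intro v hv
    rw [if_neg fun e : (v : ℕ) = x => hxk (Fin.ext e ▸ hv)]
    exact hc v hv
  -- A predecessor is closer to `s`, so it comes earlier in the queue and its count is final.
  · rw [if_pos (by omega)]
    exact hc y (ho.mem_take_of_dist_lt hx (hall y) (by omega))

theorem countVertex_spec (hB : totalLength adj + 10 * n + 100 ≤ B) (hd : 11 < d)
    (hG : G.Connected) (hadj : IsAdjacencyList G adj) {s x : Fin n} {ord : List (Fin n)} {k m : ℕ}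
    (hM : BfsMemory G adj d s ord M) (ho : IsBfsOrder G s ord m) (hall : ∀ v, v ∈ ord)
    (hx : ord[k]? = some x) (h7 : M.word 7 0 = k)
    (hc : ∀ v ∈ ord.take k, M.rat c v = sigma G s v) :
    Wp B (.countVertex d c) M fun T M' => T ≤ 80 * (adj x).length + 60 ∧
      BfsMemory G adj d s ord M' ∧ M'.word 7 0 = k + 1 ∧
      ∀ v ∈ ord.take (k + 1), M'.rat c v = sigma G s v := by
  have hd'' : ∀ a, a < 12 → d ≠ a := by omega
  have hlen : ord.length ≤ n := by simpa using ho.nodup.length_le_card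
  have hbs := blockStart_add_le adj x
  have hk := (List.getElem?_eq_some_iff.1 hx).1
  have hqx : M.word 5 k = x := by
    rw [hM.queue k hk]
    exact congrArg Fin.val (List.getElem?_eq_some_iff.1 hx).2
  have hst := hM.graph.start x
  have hx2 := x.2
  have hxk : x ∉ ord.take k := by
    obtain ⟨hk, rfl⟩ := List.getElem?_eq_some_iff.1 hx
    rw [List.mem_take_iff_getElem]
    rintro ⟨i, hi, he⟩
    have := (List.Nodup.getElem_inj_iff ho.nodup).1 he
    omega
  rw [Prog.countVertex, wp_seq]
  -- The truncated difference `1 - k` initialises the count with `1` at the source, which is the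
  -- queue entry `0`, and with `0` elsewhere; no branch is needed.
  have setup : Wp B (.seq (.setVar 11 (.get 5 (.var 7)))
      (.seq (.setRat c (.var 11) (.ofWord (.sub (.const 1) (.var 7))))
        (.setVar 8 (.get 1 (.var 11))))) M
      fun T M' => T ≤ 30 ∧ BfsMemory G adj d s ord M' ∧ M'.word 7 0 = k ∧ M'.word 11 0 = x ∧
        M'.word 8 0 = blockStart adj x ∧ (∀ v ∈ ord.take k, M'.rat c v = sigma G s v) ∧
        M'.rat c x = ((1 - k : ℕ) : ℚ) := by
    simp [h7, hqx, hst]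
    refine ⟨by omega, by omega, by omega, by omega, ?_, ?_⟩
    · refine hM.frame fun a ha j => ?_
      have : a ≠ 11 ∧ a ≠ 8 := by omega
      simp [this]
    · intro v hv
      rw [if_neg fun e : (v : ℕ) = x => hxk (Fin.ext e ▸ hv)]
      exact hc v hv
  refine setup.imp ?_
  rintro T₁ M₁ ⟨hT₁, hM₁, h7₁, h11₁, h8₁, hc₁, hcx₁⟩
  rw [wp_seq]
  refine (wp_for_const (adj x).length (fun p M => BfsMemory G adj d s ord M ∧
    M.word 8 0 = blockStart adj x + p ∧
    M.word 11 0 = x ∧ M.word 7 0 = k ∧ (∀ v ∈ ord.take k, M.rat c v = sigma G s v) ∧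
    M.rat c x = ((1 - k : ℕ) : ℚ) + (((adj x).take p).map fun y =>
      if G.dist s y + 1 = G.dist s x then (sigma G s y : ℚ) else 0).sum)
    60 ?_ ?_ _ ?_).imp ?_
  · rintro p M hp ⟨hM', h8, h11, h7, -⟩
    simp [h8, h11, hM'.graph.finish x]
    omega
  · rintro p M hp ⟨hM', h8, h11, h7, hc', hcx⟩
    refine (gather_spec hB hd hG hM' ho hall hx h8 h11 h7 hp hc').imp ?_
    rintro T M' ⟨hT, hM'', h8', h11', h7', hc'', hcx'⟩
    refine ⟨hT, hM'', h8', h11', h7', hc'', ?_⟩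
    rw [hcx', hcx, List.take_succ_eq_append_getElem hp, List.map_append, List.sum_append]
    simp [add_assoc]
  · exact ⟨hM₁, h8₁, h11₁, h7₁, hc₁, by simp [hcx₁]⟩
  · rintro T₂ M₂ ⟨hT₂, hM', h8, h11, h7', hc', hcx⟩
    simp at hT₂
    simp [h7']
    refine ⟨by omega, by omega, ?_, ?_⟩
    · refine hM'.frame fun a ha j => ?_
      have : a ≠ 7 := by omega
      simp [this]
    · have htake : ord.take (k + 1) = ord.take k ++ [x] := by
        rw [List.take_succ_eq_append_getElem hk, (List.getElem?_eq_some_iff.1 hx).2]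
      intro v hv
      rw [htake, List.mem_append, List.mem_singleton] at hv
      rcases hv with hv | rfl
      · exact hc' v hv
      · rw [List.take_length] at hcx
        rw [hcx]
        by_cases hvs : v = s
        · have hk0 : k = 0 := by
            have h0 := ho.head
            obtain ⟨hk', e⟩ := List.getElem?_eq_some_iff.1 hx
            obtain ⟨h0', e0⟩ := List.getElem?_eq_some_iff.1 h0
            exact (List.Nodup.getElem_inj_iff ho.nodup).1 (e.trans (hvs.trans e0.symm))
          subst hvs hk0
          have : (adj v).map (fun y => if G.dist v y + 1 = G.dist v v then (sigma G v y : ℚ) else 0)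
              = (adj v).map fun _ => 0 := by
            refine List.map_congr_left fun y _ => ?_
            rw [if_neg (by simp)]
          rw [this, sigma_self]
          simp
        · have hk0 : 1 - k = 0 := by
            rcases Nat.eq_zero_or_pos k with rfl | h0
            · rw [ho.head, Option.some_inj] at hx
              exact absurd hx.symm hvs
            · omega
          rw [sum_predecessors hadj hG hvs, hk0, Nat.cast_zero, zero_add]

/-- Turns costs by queue position into costs by vertex, since the queue has no repetitions. -/
theorem sum_getD_le {ord : List (Fin n)} (hn : ord.Nodup) (s : Fin n) (f : Fin n → ℕ) :
    ∑ k ∈ Finset.range ord.length, f (ord.getD k s) ≤ ∑ v, f v := by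
  have hinj : Set.InjOn (fun k => ord.getD k s) (Finset.range ord.length : Finset ℕ) := by
    intro i hi j hj heq
    simp only [Finset.coe_range, Set.mem_Iio] at hi hj
    simp only [List.getD_eq_getElem _ _ hi, List.getD_eq_getElem _ _ hj] at heq
    exact (List.Nodup.getElem_inj_iff hn).1 heq
  rw [← Finset.sum_image (f := f) hinj]
  exact Finset.sum_le_univ_sum_of_nonneg fun _ => Nat.zero_le _

theorem bfs_spec (hB : totalLength adj + 10 * n + 100 ≤ B) (hd : 11 < d) (hG : G.Connected)
    (hadj : IsAdjacencyList G adj) {s : Fin n} (hM : HasGraph adj M) (h3 : M.word 3 0 = s) :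
    Wp B (.bfs d c) M fun T M' => T ≤ 200 * (totalLength adj + n) + 200 ∧
      ∀ v : Fin n, M'.word d v = G.dist s v + 1 ∧ M'.rat c v = sigma G s v := by
  rw [Prog.bfs, wp_seq]
  refine (search_spec hB hd hG hadj hM h3).imp ?_
  rintro T₁ M₁ ⟨hT₁, ord, hM₁, ho, hlen⟩
  have hall : ∀ v, v ∈ ord := ho.mem_of_length_le hG hlen.le
  simp only [wp_seq, wp_setWord]
  refine ⟨by simp, by simp, ?_⟩
  refine (wp_for n (fun k M => BfsMemory G adj d s ord M ∧ M.word 7 0 = k ∧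
    ∀ v ∈ ord.take k, M.rat c v = sigma G s v)
    (fun k => 80 * (adj (ord.getD k s)).length + 60) ?_ ?_ _ ?_).imp ?_
  · rintro k M hk ⟨hM, h7, -⟩
    simp [h7, hM.graph.size]
    omega
  · rintro k M hk ⟨hM, h7, hc⟩
    have hk' : k < ord.length := by omega
    rw [List.getD_eq_getElem _ _ hk']
    exact countVertex_spec hB hd hG hadj hM ho hall (List.getElem?_eq_getElem hk') h7 hc
  · refine ⟨hM₁.frame fun a ha j => ?_, by simp, by simp⟩
    have : a ≠ 7 := by omega
    simp [this]
  · rintro T M' ⟨hT, hM', h7, hc⟩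
    refine ⟨?_, fun v => ⟨hM'.dist v (hall v), hc v ?_⟩⟩
    · have h1 := sum_getD_le ho.nodup s fun v => (adj v).length
      simp only [Finset.sum_add_distrib, ← Finset.mul_sum] at hT
      rw [hlen, ← totalLength] at h1
      simp at hT h1 ⊢
      omega
    · rw [List.take_of_length_le hlen.le]
      exact hall v

end Count

/-! ### Processing one maximal induced path -/

namespace RatExpr

open WordExpr

/-- `directAfter` at position `22`; the weights are in array `4`, their partial sums in array `5`, and
the parameters in `23` and `6`. -/
def directAfterAt : RatExpr :=
  .add (.sub (.get 5 (.add (var 22) (var 23))) (.get 5 (var 22)))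
    (.mul (.get 6 (.const 0)) (.get 4 (.add (.add (var 22) (var 23)) (.const 1))))

/-- `directBefore` at position `22`. -/
def directBeforeAt : RatExpr :=
  .add (.sub (.get 5 (.sub (var 22) (.const 1))) (.get 5 (.sub (.sub (var 22) (.const 1)) (var 23))))
    (.mul (.get 6 (.const 0)) (.get 4 (.sub (.sub (var 22) (.const 1)) (var 23))))

/-- `indirectAfter` at position `22`; the length of the path is in `13`. -/
def indirectAfterAt : RatExpr :=
  .sub (.sub (.get 5 (var 13)) (.get 5 (var 22))) directAfterAt

/-- `indirectBefore` at position `22`. -/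
def indirectBeforeAt : RatExpr :=
  .sub (.get 5 (.sub (var 22) (.const 1))) directBeforeAt

/-- `balance` at position `22`. -/
def balanceAt : RatExpr :=
  .mul (.get 4 (var 22))
    (.add (.sub (.sub directAfterAt indirectAfterAt) directBeforeAt) indirectBeforeAt)

end RatExpr

namespace Prog

open WordExpr

/-- Distances and numbers of shortest paths from both ends of the path. -/
def searchEnds : Prog :=
  .seq (.seq (setVar 3 (var 14)) (bfs 20 2)) (.seq (setVar 3 (var 15)) (bfs 21 3))

/-- The length of the cycle in variable `24`, half of it in `23`, and the share of the direct
connection in the case of a tie. -/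
def setParameters : Prog :=
  .seq (setVar 24 (.sub (.add (var 13) (.get 20 (var 15))) (.const 1)))
    (.seq (setVar 23 (.div (.sub (var 24) (.const 1)) (.const 2)))
      (.cond (ne (var 24) (.add (.div (var 24) (.const 2)) (.div (var 24) (.const 2))))
        (.setRat 6 (.const 0) (.const 0))
        (.setRat 6 (.const 0) (.div (.const 1) (.add (.get 2 (var 15)) (.const 1))))))

/-- The weights along the path and their partial sums. -/
def setWeights : Prog :=
  .seq (.seq (.setRat 4 (.const 0) (.const 0)) (.seq (.setRat 5 (.const 0) (.const 0))
    (setVar 22 (.const 1))))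
    (.loop (lt (var 22) (.add (.add (var 13) (var 13)) (.const 1)))
      (.seq (.cond (lt (var 22) (var 13)) (.setRat 4 (var 22) (.get 0 (.get 12 (var 22))))
        (.setRat 4 (var 22) (.const 0)))
        (.seq (.setRat 5 (var 22) (.add (.get 5 (.sub (var 22) (.const 1))) (.get 4 (var 22))))
          (setVar 22 (.add (var 22) (.const 1))))))

/-- The weight of all pairs that are connected indirectly. -/
def setTotal : Prog :=
  .seq (.seq (.setRat 7 (.const 0) (.const 0)) (setVar 22 (.const 1)))
    (.loop (lt (var 22) (var 13))
      (.seq (.setRat 7 (.const 0)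
        (.add (.get 7 (.const 0)) (.mul (.get 4 (var 22)) .indirectAfterAt)))
        (setVar 22 (.add (var 22) (.const 1)))))

/-- Add the contributions to the inner vertices of the path. -/
def addInner : Prog :=
  .seq (.seq (.setRat 8 (.const 0) (.get 7 (.const 0))) (setVar 22 (.const 1)))
    (.loop (lt (var 22) (var 13))
      (.seq (.setRat 1 (.get 12 (var 22)) (.add (.get 1 (.get 12 (var 22)))
        (.mul (.const 2) (.sub (.get 8 (.const 0))
          (.mul (.get 4 (var 22)) (.add .indirectAfterAt .directBeforeAt))))))
        (.seq (.setRat 8 (.const 0) (.add (.get 8 (.const 0)) .balanceAt))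
          (setVar 22 (.add (var 22) (.const 1))))))

/-- Add the contributions to the vertices on the shortest connections of the ends of the path. -/
def addOuter : Prog :=
  .seq (setVar 22 (.const 0))
    (.loop (lt (var 22) (var 0))
      (.seq (.cond (ne (.add (.get 20 (var 22)) (.get 21 (var 22)))
          (.add (.get 20 (var 15)) (.const 1))) .skip
        (.setRat 1 (var 22) (.add (.get 1 (var 22)) (.mul (.const 2) (.mul (.get 7 (.const 0))
          (.div (.mul (.get 2 (var 22)) (.get 3 (var 22))) (.get 2 (var 15))))))))
        (setVar 22 (.add (var 22) (.const 1)))))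

/-- Add the contribution of the path in array `12`, with length `13` and ends `14` and `15`. -/
def addPath : Prog :=
  .seq searchEnds (.seq setParameters (.seq setWeights (.seq setTotal (.seq addInner addOuter))))

end Prog

/-! ### Correctness and running time for one path. -/

section AddPath

variable {n B : ℕ} {G : SimpleGraph (Fin n)} {adj : Fin n → List (Fin n)} {pen : Fin n → ℕ}
  {ps : ℕ → Fin n} {M M' : Memory} {L : ℕ}

/-- The memory holds the graph, the weights, and the path `ps 0, …, ps L`. -/
structure PathMemory (adj : Fin n → List (Fin n)) (pen : Fin n → ℕ) (ps : ℕ → Fin n) (L : ℕ)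
    (M : Memory) : Prop where
  graph : HasGraph adj M
  weight : ∀ v : Fin n, M.rat 0 v = pen v
  length : M.word 13 0 = L
  inner : ∀ i, 0 < i → i < L → M.word 12 i = ps i
  first : M.word 14 0 = ps 0
  last : M.word 15 0 = ps L

theorem PathMemory.frame (h : PathMemory adj pen ps L M)
    (hw : ∀ a ∈ [0, 1, 2, 12, 13, 14, 15], ∀ j, M'.word a j = M.word a j)
    (hr : ∀ j, M'.rat 0 j = M.rat 0 j) : PathMemory adj pen ps L M' :=
  ⟨h.graph.frame (hw 0 (by simp)) (hw 1 (by simp)) (hw 2 (by simp)),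
    fun v => by rw [hr, h.weight], by rw [hw 13 (by simp), h.length],
    fun i h0 hi => by rw [hw 12 (by simp), h.inner i h0 hi], by rw [hw 14 (by simp), h.first],
    by rw [hw 15 (by simp), h.last]⟩

theorem PathMemory.runs (h : PathMemory adj pen ps L M) {p : Prog} {T : ℕ}
    (hr : Runs B p M T M') (hw : ∀ a ∈ [0, 1, 2, 12, 13, 14, 15], a ∉ p.wordArrays)
    (h0 : 0 ∉ p.ratArrays) : PathMemory adj pen ps L M' :=
  h.frame (fun a ha => hr.word_eq (hw a ha)) (hr.rat_eq h0)

theorem searchEnds_spec (hB : totalLength adj + 10 * n + 100 ≤ B) (hG : G.Connected)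
    (hadj : IsAdjacencyList G adj) (hM : PathMemory adj pen ps L M) :
    Wp B .searchEnds M fun T M' => T ≤ 400 * (totalLength adj + n) + 500 ∧
      ∀ v : Fin n, M'.word 20 v = G.dist (ps 0) v + 1 ∧ M'.rat 2 v = sigma G (ps 0) v ∧
        M'.word 21 v = G.dist (ps L) v + 1 ∧ M'.rat 3 v = sigma G (ps L) v := by
  have h0 := (ps 0).2
  have hL := (ps L).2
  have first : Wp B (.seq (.setVar 3 (.var 14)) (.bfs 20 2)) M fun T M' =>
      T ≤ 200 * (totalLength adj + n) + 250 ∧ ∀ v : Fin n,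
        M'.word 20 v = G.dist (ps 0) v + 1 ∧ M'.rat 2 v = sigma G (ps 0) v := by
    rw [wp_seq]
    simp only [wp_setWord]
    refine ⟨by simp, by simp [hM.first]; omega, ?_⟩
    refine (bfs_spec hB (by omega) hG hadj (s := ps 0) (hM.graph.frame ?_ ?_ ?_) ?_).imp ?_
    · simp
    · simp
    · simp
    · simp [hM.first]
    · rintro T M' ⟨hT, h⟩
      simp at hT ⊢
      exact ⟨by omega, h⟩
  rw [Prog.searchEnds, wp_seq]
  refine first.imp_runs ?_
  rintro T₁ M₁ hr₁ ⟨hT₁, h₁⟩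
  have hM₁ := hM.runs hr₁ (by decide) (by decide)
  rw [wp_seq]
  simp only [wp_setWord]
  refine ⟨by simp, by simp [hM₁.last]; omega, ?_⟩
  refine (bfs_spec hB (by omega) hG hadj (s := ps L) (hM₁.graph.frame ?_ ?_ ?_) ?_).imp_runs ?_
  · simp
  · simp
  · simp
  · simp [hM₁.last]
  · rintro T₂ M₂ hr₂ ⟨hT₂, h₂⟩
    refine ⟨by simp; omega, fun v => ⟨?_, ?_, h₂ v⟩⟩
    · rw [hr₂.word_eq (by decide)]
      simpa using (h₁ v).1
    · rw [hr₂.rat_eq (by decide)]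
      simpa using (h₁ v).2

/-- The memory after the search from both ends of the path. -/
structure EndsMemory (G : SimpleGraph (Fin n)) (ps : ℕ → Fin n) (L : ℕ) (M : Memory) : Prop where
  distFirst : ∀ v : Fin n, M.word 20 v = G.dist (ps 0) v + 1
  countFirst : ∀ v : Fin n, M.rat 2 v = sigma G (ps 0) v
  distLast : ∀ v : Fin n, M.word 21 v = G.dist (ps L) v + 1
  countLast : ∀ v : Fin n, M.rat 3 v = sigma G (ps L) v

theorem setParameters_spec (hB : totalLength adj + 10 * n + 100 ≤ B) (hG : G.Connected)
    (hp : IsTraversal G ps L) (hM : PathMemory adj pen ps L M) (he : EndsMemory G ps L M) :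
    Wp B .setParameters M fun T M' => T ≤ 80 ∧
      M'.word 23 0 = (L + G.dist (ps 0) (ps L) - 1) / 2 ∧
      M'.rat 6 0 = tieShare (L + G.dist (ps 0) (ps L)) (sigma G (ps 0) (ps L)) := by
  have hL := (ps L).2
  have hLn : L ≤ n := by simpa using hp.isChain.length_le
  have hdl := hp.dist_end_le hG
  have hN : (sigma G (ps 0) (ps L) : ℚ) + 1 ≠ 0 := by positivity
  have h1 := he.distFirst (ps L)
  have h2 := he.countFirst (ps L)
  rw [Prog.setParameters, tieShare]
  -- The stored distance is `D + 1`, whence the subtraction of one in the cycle length. Ties are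
  -- recognised from the parity of a word, as rationals cannot be tested.
  simp [hM.length, hM.last, h1, h2, hN]
  generalize G.dist (ps 0) (ps L) = D at *
  refine ⟨by omega, by omega, by omega, fun _ _ => by omega, fun _ _ => by omega⟩

/-- The memory after the weights have been prepared. -/
structure SumMemory (w : ℕ → ℚ) (L c : ℕ) (e : ℚ) (M : Memory) : Prop where
  weight : ∀ i, i ≤ 2 * L → M.rat 4 i = w i
  sum : ∀ i, i ≤ 2 * L → M.rat 5 i = prefixSum w i
  share : M.rat 6 0 = e
  half : M.word 23 0 = c
  length : M.word 13 0 = L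

theorem prefixSum_pred {w : ℕ → ℚ} {i : ℕ} (hi : 0 < i) :
    prefixSum w i = prefixSum w (i - 1) + w i := by
  rw [prefixSum, Finset.sum_range_succ, prefixSum, show i - 1 + 1 = i by omega]

/-- `directAfter` reads up to position `i + c + 1 < 2 * L`. The zeros from `L` on have to be written
explicitly because earlier paths leave their weights in the array. -/
theorem setWeights_spec (hB : totalLength adj + 10 * n + 100 ≤ B) (hLn : L ≤ n)
    (hM : PathMemory adj pen ps L M) :
    Wp B .setWeights M fun T M' => T ≤ 120 * n + 100 ∧
      ∀ i, i ≤ 2 * L → M'.rat 4 i = innerWeight pen ps L i ∧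
        M'.rat 5 i = prefixSum (innerWeight pen ps L) i := by
  rw [Prog.setWeights, wp_seq]
  have setup : Wp B (.seq (.setRat 4 (.const 0) (.const 0)) (.seq (.setRat 5 (.const 0) (.const 0))
      (.setVar 22 (.const 1)))) M fun T M' => T ≤ 30 ∧ PathMemory adj pen ps L M' ∧
        M'.word 22 0 = 1 ∧ M'.rat 4 0 = 0 ∧ M'.rat 5 0 = 0 := by
    simp
    refine ⟨by omega, hM.frame ?_ ?_⟩
    · intro a ha j
      have : a ≠ 22 := by rintro rfl; revert ha; decide
      simp [this]
    · simp
  refine setup.imp ?_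
  rintro T₁ M₁ ⟨hT₁, hM₁, h22, h4, h5⟩
  refine (wp_for_const (2 * L) (fun k M => PathMemory adj pen ps L M ∧ M.word 22 0 = k + 1 ∧
    ∀ i, i ≤ k → M.rat 4 i = innerWeight pen ps L i ∧
      M.rat 5 i = prefixSum (innerWeight pen ps L) i) 40 ?_ ?_ _ ?_).imp ?_
  · rintro k M hk ⟨hM, h22, -⟩
    simp [h22, hM.length]
    omega
  · rintro k M hk ⟨hM, h22, h⟩
    have hps := (ps (k + 1)).2
    have hin := hM.inner (k + 1) (by omega)
    have key : ∀ x : ℚ, x = innerWeight pen ps L (k + 1) →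
        Wp B (.seq (.setRat 5 (.var 22) (.add (.get 5 (.sub (.var 22) (.const 1))) (.get 4 (.var 22))))
          (.setVar 22 (.add (.var 22) (.const 1)))) (M.setRat 4 (k + 1) x) fun T M' =>
            T ≤ 22 ∧ PathMemory adj pen ps L M' ∧ M'.word 22 0 = k + 1 + 1 ∧
          ∀ i, i ≤ k + 1 → M'.rat 4 i = innerWeight pen ps L i ∧
            M'.rat 5 i = prefixSum (innerWeight pen ps L) i := by
      intro x hx
      simp [h22]
      refine ⟨by omega, by omega, by omega, hM.frame ?_ ?_, fun i hi => ⟨?_, ?_⟩⟩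
      · intro a ha j
        have : a ≠ 22 := by rintro rfl; revert ha; decide
        simp [this]
      · simp
      · split_ifs with heq
        · rw [heq, hx]
        · exact (h i (by omega)).1
      · split_ifs with heq
        · rw [heq, prefixSum_pred (by omega), (h k le_rfl).2, hx, Nat.add_sub_cancel]
        · exact (h i (by omega)).2
    rw [wp_seq, wp_cond]
    refine ⟨by simp [h22, hM.length]; omega, fun hlt => ?_, fun hge => ?_⟩
    · have hlt : k + 1 < L := by simp [h22, hM.length] at hlt; omega
      rw [wp_setRat]
      refine ⟨by simp [h22]; omega, by simp [h22, hin hlt]; omega, ?_⟩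
      have hx : M.rat 0 (ps (k + 1)) = innerWeight pen ps L (k + 1) := by
        rw [hM.weight, innerWeight_inner pen (by omega) hlt]
      refine Wp.imp (Q := fun T M' => T ≤ 22 ∧ PathMemory adj pen ps L M' ∧
        M'.word 22 0 = k + 1 + 1 ∧ ∀ i, i ≤ k + 1 → M'.rat 4 i = innerWeight pen ps L i ∧
            M'.rat 5 i = prefixSum (innerWeight pen ps L) i) ?_ ?_
      · simpa only [WordExpr.eval, RatExpr.eval, h22, hin hlt] using key _ hx
      · rintro T M' ⟨hT, h'⟩
        exact ⟨by simp; omega, h'⟩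
    · have hge : L ≤ k + 1 := by simp [h22, hM.length] at hge; omega
      rw [wp_setRat]
      refine ⟨by simp [h22]; omega, by simp, ?_⟩
      refine Wp.imp (Q := fun T M' => T ≤ 22 ∧ PathMemory adj pen ps L M' ∧
        M'.word 22 0 = k + 1 + 1 ∧ ∀ i, i ≤ k + 1 → M'.rat 4 i = innerWeight pen ps L i ∧
            M'.rat 5 i = prefixSum (innerWeight pen ps L) i) ?_ ?_
      · simpa only [WordExpr.eval, RatExpr.eval, h22] using
          key _ (innerWeight_of_le pen (k + 1) hge).symm
      · rintro T M' ⟨hT, h'⟩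
        exact ⟨by simp; omega, h'⟩
  · refine ⟨hM₁, h22, fun i hi => ?_⟩
    obtain rfl : i = 0 := by omega
    rw [h4, h5, innerWeight_zero]
    simp [prefixSum, innerWeight_zero]
  · rintro T₂ M₂ ⟨hT₂, hM₂, h22, h⟩
    refine ⟨?_, h⟩
    simp at hT₂
    omega

theorem directAfterAt_spec {w : ℕ → ℚ} {c i : ℕ} {e : ℚ} (hM : SumMemory w L c e M)
    (hB : 3 * L + 10 ≤ B) (hc : c < L) (hi : i < L) (h22 : M.word 22 0 = i) :
    RatExpr.directAfterAt.Fits B M ∧ RatExpr.directAfterAt.eval M = directAfter w c e i := by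
  simp [RatExpr.directAfterAt, directAfter, h22, hM.half, hM.share, hM.sum i (by omega),
    hM.sum (i + c) (by omega), hM.weight (i + c + 1) (by omega)]
  omega

theorem directBeforeAt_spec {w : ℕ → ℚ} {c i : ℕ} {e : ℚ} (hM : SumMemory w L c e M)
    (hB : 3 * L + 10 ≤ B) (hc : c < L) (hi : i < L) (h22 : M.word 22 0 = i) :
    RatExpr.directBeforeAt.Fits B M ∧ RatExpr.directBeforeAt.eval M = directBefore w c e i := by
  simp [RatExpr.directBeforeAt, directBefore, h22, hM.half, hM.share, hM.sum (i - 1) (by omega),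
    hM.sum (i - 1 - c) (by omega), hM.weight (i - 1 - c) (by omega)]
  omega

theorem indirectAfterAt_spec {w : ℕ → ℚ} {c i : ℕ} {e : ℚ} (hM : SumMemory w L c e M)
    (hB : 3 * L + 10 ≤ B) (hc : c < L) (hi : i < L) (h22 : M.word 22 0 = i) :
    RatExpr.indirectAfterAt.Fits B M ∧
      RatExpr.indirectAfterAt.eval M = indirectAfter w L c e i := by
  obtain ⟨h1, h2⟩ := directAfterAt_spec hM hB hc hi h22
  simp [RatExpr.indirectAfterAt, indirectAfter, h1, h2, h22, hM.length, hM.sum i (by omega),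
    hM.sum L (by omega)]
  omega

theorem indirectBeforeAt_spec {w : ℕ → ℚ} {c i : ℕ} {e : ℚ} (hM : SumMemory w L c e M)
    (hB : 3 * L + 10 ≤ B) (hc : c < L) (hi : i < L) (h22 : M.word 22 0 = i) :
    RatExpr.indirectBeforeAt.Fits B M ∧
      RatExpr.indirectBeforeAt.eval M = indirectBefore w c e i := by
  obtain ⟨h1, h2⟩ := directBeforeAt_spec hM hB hc hi h22
  simp [RatExpr.indirectBeforeAt, indirectBefore, h1, h2, h22, hM.sum (i - 1) (by omega)]
  omega

theorem balanceAt_spec {w : ℕ → ℚ} {c i : ℕ} {e : ℚ} (hM : SumMemory w L c e M)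
    (hB : 3 * L + 10 ≤ B) (hc : c < L) (hi : i < L) (h22 : M.word 22 0 = i) :
    RatExpr.balanceAt.Fits B M ∧ RatExpr.balanceAt.eval M = balance w L c e i := by
  obtain ⟨h1, h2⟩ := directBeforeAt_spec hM hB hc hi h22
  obtain ⟨h3, h4⟩ := directAfterAt_spec hM hB hc hi h22
  obtain ⟨h5, h6⟩ := indirectBeforeAt_spec hM hB hc hi h22
  obtain ⟨h7, h8⟩ := indirectAfterAt_spec hM hB hc hi h22
  simp [RatExpr.balanceAt, balance, h1, h2, h3, h4, h5, h6, h7, h8, h22, hM.weight i (by omega)]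
  omega

theorem SumMemory.frame {w : ℕ → ℚ} {c : ℕ} {e : ℚ} (hM : SumMemory w L c e M)
    (h4 : ∀ j, M'.rat 4 j = M.rat 4 j) (h5 : ∀ j, M'.rat 5 j = M.rat 5 j)
    (h6 : ∀ j, M'.rat 6 j = M.rat 6 j) (h23 : ∀ j, M'.word 23 j = M.word 23 j)
    (h13 : ∀ j, M'.word 13 j = M.word 13 j) : SumMemory w L c e M' :=
  ⟨fun i hi => by rw [h4, hM.weight i hi], fun i hi => by rw [h5, hM.sum i hi],
    by rw [h6, hM.share], by rw [h23, hM.half], by rw [h13, hM.length]⟩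

theorem setTotal_spec {w : ℕ → ℚ} {c : ℕ} {e : ℚ} (hB : 3 * L + 10 ≤ B) (hc : c < L)
    (h0 : w 0 = 0) (hM : SumMemory w L c e M) :
    Wp B .setTotal M fun T M' => T ≤ 100 * L + 100 ∧ M'.rat 7 0 = indirectTotal w L c e := by
  rw [Prog.setTotal, wp_seq]
  have setup : Wp B (.seq (.setRat 7 (.const 0) (.const 0)) (.setVar 22 (.const 1))) M fun T M' =>
      T ≤ 30 ∧ SumMemory w L c e M' ∧ M'.word 22 0 = 1 ∧ M'.rat 7 0 = 0 := by
    simp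
    exact ⟨by omega, hM.frame (by simp) (by simp) (by simp) (by simp) (by simp)⟩
  refine setup.imp ?_
  rintro T₁ M₁ ⟨hT₁, hM₁, h22, h7⟩
  -- The loop starts at position `1`; the omitted term at `0` vanishes by `h0`.
  refine (wp_for_const (L - 1) (fun k M => SumMemory w L c e M ∧ M.word 22 0 = k + 1 ∧
    M.rat 7 0 = ∑ i ∈ Finset.range (k + 1), w i * indirectAfter w L c e i) 70 ?_ ?_ _ ?_).imp ?_
  · rintro k M hk ⟨hM, h22, -⟩
    simp [h22, hM.length]
    omega
  · rintro k M hk ⟨hM, h22, h⟩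
    obtain ⟨h1, h2⟩ := indirectAfterAt_spec hM hB hc (by omega) h22
    rw [wp_seq, wp_setRat]
    refine ⟨by simp, by simp [h22, h1]; omega, ?_⟩
    simp [h22, h2, h, hM.weight (k + 1) (by omega)]
    refine ⟨by omega, by simp [RatExpr.indirectAfterAt, RatExpr.directAfterAt],
      hM.frame (by simp) (by simp) (by simp) (by simp) (by simp), ?_⟩
    rw [Finset.sum_range_succ _ (k + 1)]
  · exact ⟨hM₁, h22, by simp [h7, h0]⟩
  · rintro T M' ⟨hT, hM', -, h⟩
    simp at hT
    refine ⟨by omega, ?_⟩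
    rw [h, indirectTotal, show L - 1 + 1 = L by omega]

theorem addInner_spec {w : ℕ → ℚ} {c : ℕ} {e : ℚ} (hB : 10 * n + 10 ≤ B) (hc : c < L)
    (hLn : L ≤ n) (h0 : w 0 = 0) (hinj : ∀ i j, i < L → j < L → ps i = ps j → i = j)
    (hP : ∀ i, 0 < i → i < L → M.word 12 i = ps i) (hM : SumMemory w L c e M) :
    Wp B .addInner M fun T M' => T ≤ 320 * L + 100 ∧
      (∀ r, 0 < r → r < L → M'.rat 1 (ps r) = M.rat 1 (ps r) +
        2 * (M.rat 7 0 + ∑ i ∈ Finset.range r, balance w L c e i -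
          w r * (indirectAfter w L c e r + directBefore w c e r))) ∧
      ∀ v : Fin n, (∀ r, 0 < r → r < L → ps r ≠ v) → M'.rat 1 v = M.rat 1 v := by
  rw [Prog.addInner, wp_seq]
  have setup : Wp B (.seq (.setRat 8 (.const 0) (.get 7 (.const 0))) (.setVar 22 (.const 1))) M
      fun T M' => T ≤ 30 ∧ SumMemory w L c e M' ∧ M'.word 22 0 = 1 ∧ M'.rat 8 0 = M.rat 7 0 ∧
        (∀ j, M'.rat 1 j = M.rat 1 j) ∧ ∀ i, 0 < i → i < L → M'.word 12 i = ps i := by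
    simp
    exact ⟨by omega, hM.frame (by simp) (by simp) (by simp) (by simp) (by simp), hP⟩
  refine setup.imp ?_
  rintro T₁ M₁ ⟨hT₁, hM₁, h22, h8, h1, hP₁⟩
  -- Rational array `8` holds the total plus the balances of all positions passed so far, which is
  -- the quantity needed at the next position.
  refine (wp_for_const (L - 1) (fun k M' => SumMemory w L c e M' ∧ M'.word 22 0 = k + 1 ∧
    (∀ i, 0 < i → i < L → M'.word 12 i = ps i) ∧
    M'.rat 8 0 = M.rat 7 0 + ∑ i ∈ Finset.range (k + 1), balance w L c e i ∧
    (∀ r, 0 < r → r ≤ k → M'.rat 1 (ps r) = M.rat 1 (ps r) +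
        2 * (M.rat 7 0 + ∑ i ∈ Finset.range r, balance w L c e i -
          w r * (indirectAfter w L c e r + directBefore w c e r))) ∧
      ∀ v : Fin n, (∀ r, 0 < r → r ≤ k → ps r ≠ v) → M'.rat 1 v = M.rat 1 v)
    300 ?_ ?_ _ ?_).imp ?_
  · rintro k M hk ⟨hM, h22, -⟩
    simp [h22, hM.length]
    omega
  · rintro k M' hk ⟨hM', h22, hP', h8, hin, hout⟩
    obtain ⟨a1, a2⟩ := indirectAfterAt_spec hM' (B := B) (by omega) hc (by omega) h22
    obtain ⟨b1, b2⟩ := directBeforeAt_spec hM' (B := B) (by omega) hc (by omega) h22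
    have hpk := hP' (k + 1) (by omega) (by omega)
    have hps := (ps (k + 1)).2
    have hold := hout (ps (k + 1)) fun r h0 hr heq => by
      have := hinj _ _ (by omega) (by omega) heq
      omega
    rw [wp_seq, wp_setRat]
    refine ⟨by simp [h22, hpk]; omega, by simp [h22, hpk, a1, b1]; omega, ?_⟩
    have hM₂ : SumMemory w L c e (M'.setRat 1 (ps (k + 1)) (M.rat 1 (ps (k + 1)) +
        2 * (M.rat 7 0 + ∑ i ∈ Finset.range (k + 1), balance w L c e i -
          w (k + 1) * (indirectAfter w L c e (k + 1) + directBefore w c e (k + 1))))) :=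
      hM'.frame (by simp) (by simp) (by simp) (by simp) (by simp)
    obtain ⟨c1, c2⟩ := balanceAt_spec hM₂ (B := B) (by omega) hc (i := k + 1) (by omega)
      (by simpa using h22)
    simp [h22, hpk, a2, b2, h8, hM'.weight (k + 1) (by omega), hold, c1, c2]
    refine ⟨by omega, ?_, hM'.frame (by simp) (by simp) (by simp) (by simp) (by simp), hP', ?_, ?_,
      ?_⟩
    · simp [RatExpr.indirectAfterAt, RatExpr.directAfterAt, RatExpr.directBeforeAt,
        RatExpr.indirectBeforeAt, RatExpr.balanceAt]
    · rw [Finset.sum_range_succ _ (k + 1)]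
      ring
    · intro r h0 hr
      split_ifs with heq
      · have := hinj _ _ (by omega) (by omega) (Fin.ext heq)
        rw [this]
      · refine hin r h0 ?_
        by_contra hcon
        exact heq (by rw [show r = k + 1 by omega])
    · intro v hv
      rw [if_neg fun e => hv (k + 1) (by omega) le_rfl (Fin.ext e).symm]
      exact hout v fun r h0 hr => hv r h0 (by omega)
  · exact ⟨hM₁, h22, hP₁, by simp [h8, balance, h0], fun r h0 hr => absurd h0 (by omega),
      fun v _ => h1 v⟩
  · rintro T M' ⟨hT, hM', -, -, -, hin, hout⟩
    simp at hT
    exact ⟨by omega, fun r h0 hr => hin r h0 (by omega),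
      fun v hv => hout v fun r h0 hr => hv r h0 (by omega)⟩

theorem addOuter_spec (hB : 10 * n + 10 ≤ B) (hG : G.Connected) (hn : M.word 0 0 = n)
    (h15 : M.word 15 0 = ps L) (he : EndsMemory G ps L M) :
    Wp B .addOuter M fun T M' => T ≤ 100 * n + 100 ∧ ∀ v : Fin n, M'.rat 1 v = M.rat 1 v +
      2 * (M.rat 7 0 * visitShare G (ps 0) (ps L) v) := by
  rw [Prog.addOuter, wp_seq]
  simp only [wp_setWord]
  refine ⟨by simp, by simp, ?_⟩
  have hps := (ps L).2
  have hN : (sigma G (ps 0) (ps L) : ℚ) ≠ 0 := by exact_mod_cast (sigma_pos hG _ _).ne'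
  refine (wp_for_const n (fun k M' => M'.word 0 0 = n ∧ M'.word 15 0 = ps L ∧
    EndsMemory G ps L M' ∧ M'.rat 7 0 = M.rat 7 0 ∧ M'.word 22 0 = k ∧
    ∀ v : Fin n, M'.rat 1 v = M.rat 1 v + if (v : ℕ) < k then
      2 * (M.rat 7 0 * visitShare G (ps 0) (ps L) v) else 0) 70 ?_ ?_ _ ?_).imp ?_
  · rintro k M hk ⟨hn, -, -, -, h22, -⟩
    simp [hn, h22]
    omega
  · rintro k M' hk ⟨hn', h15', he', h7, h22, h⟩
    have hv1 := he'.distFirst ⟨k, hk⟩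
    have hv2 := he'.distLast ⟨k, hk⟩
    have hv3 := he'.countFirst ⟨k, hk⟩
    have hv4 := he'.countLast ⟨k, hk⟩
    have hv5 := h ⟨k, hk⟩
    have hd1 := dist_lt_card hG (ps 0) ⟨k, hk⟩
    have hd2 := dist_lt_card hG (ps L) ⟨k, hk⟩
    have hd3 := dist_lt_card hG (ps 0) (ps L)
    simp only [lt_irrefl, if_false, add_zero] at hv1 hv2 hv3 hv4 hv5
    -- All stored distances are one too large: the test compares `(d + 1) + (d' + 1)` with `(D + 1)
    -- + 1`.
    simp [h22, hv1, hv2, hv3, hv4, hv5, h15', hn', h7, he'.distFirst (ps L),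
      he'.countFirst (ps L), hN]
    refine ⟨by omega, fun hne => ⟨by omega, ⟨he'.1, he'.2, he'.3, he'.4⟩, fun v => ?_⟩,
      fun h1 h2 => ⟨by omega, by omega, by omega, ⟨he'.1, he'.2, he'.3, he'.4⟩, fun v => ?_⟩⟩
    · rw [h v]
      rcases lt_trichotomy (v : ℕ) k with hvk | hvk | hvk
      · rw [if_pos hvk, if_pos (by omega)]
      · rw [if_neg (by omega), if_pos (by omega)]
        obtain rfl : v = ⟨k, hk⟩ := Fin.ext hvk
        rw [visitShare, if_neg (by omega)]
        simp
      · rw [if_neg (by omega), if_neg (by omega)]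
    · rcases lt_trichotomy (v : ℕ) k with hvk | hvk | hvk
      · rw [if_neg hvk.ne, if_pos (by omega), h v, if_pos hvk]
      · obtain rfl : v = ⟨k, hk⟩ := Fin.ext hvk
        rw [if_pos rfl, if_pos (by simp), visitShare, if_pos (by omega)]
      · rw [if_neg (by omega), if_neg (by omega), h v, if_neg (by omega)]
  · exact ⟨by simp [hn], by simp [h15], ⟨by simpa using he.1, by simpa using he.2,
      by simpa using he.3, by simpa using he.4⟩, by simp, by simp, by simp⟩
  · rintro T M' ⟨hT, -, -, -, -, -, h⟩
    simp at hT ⊢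
    refine ⟨by omega, fun v => ?_⟩
    rw [h v, if_pos v.2]

theorem addPath_spec (hB : totalLength adj + 10 * n + 100 ≤ B) (hG : G.Connected)
    (hadj : IsAdjacencyList G adj) (hp : IsTraversal G ps L) (hM : PathMemory adj pen ps L M) :
    Wp B .addPath M fun T M' => T ≤ 1100 * (totalLength adj + n) + 1000 ∧
      ∀ v : Fin n, M'.rat 1 v = M.rat 1 v + 2 * pairSum G pen ps L v := by
  have hLn : L ≤ n := by simpa using hp.isChain.length_le
  have hdl := hp.dist_end_le hG
  have h2L := hp.two_le
  rw [Prog.addPath, wp_seq]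
  refine (searchEnds_spec hB hG hadj hM).imp_runs ?_
  rintro T₁ M₁ r₁ ⟨hT₁, hends⟩
  have hM₁ := hM.runs r₁ (by decide) (by decide)
  have he₁ : EndsMemory G ps L M₁ := ⟨fun v => (hends v).1, fun v => (hends v).2.1,
    fun v => (hends v).2.2.1, fun v => (hends v).2.2.2⟩
  rw [wp_seq]
  refine (setParameters_spec hB hG hp hM₁ he₁).imp_runs ?_
  rintro T₂ M₂ r₂ ⟨hT₂, hc₂, hs₂⟩
  have hM₂ := hM₁.runs r₂ (by decide) (by decide)
  rw [wp_seq]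
  refine (setWeights_spec hB hLn hM₂).imp_runs ?_
  rintro T₃ M₃ r₃ ⟨hT₃, hw₃⟩
  have hM₃ := hM₂.runs r₃ (by decide) (by decide)
  obtain ⟨c, hc⟩ : ∃ c, c = (L + G.dist (ps 0) (ps L) - 1) / 2 := ⟨_, rfl⟩
  obtain ⟨e, he⟩ : ∃ e, e = tieShare (L + G.dist (ps 0) (ps L)) (sigma G (ps 0) (ps L)) :=
    ⟨_, rfl⟩
  have hcL : c < L := by omega
  have hsum₃ : SumMemory (innerWeight pen ps L) L c e M₃ :=
    ⟨fun i hi => (hw₃ i hi).1, fun i hi => (hw₃ i hi).2,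
      by rw [r₃.rat_eq (by decide), hs₂, he], by rw [r₃.word_eq (by decide), hc₂, hc], hM₃.length⟩
  rw [wp_seq]
  refine (setTotal_spec (by omega) hcL (innerWeight_zero pen) hsum₃).imp_runs ?_
  rintro T₄ M₄ r₄ ⟨hT₄, h7⟩
  have hM₄ := hM₃.runs r₄ (by decide) (by decide)
  have hsum₄ : SumMemory (innerWeight pen ps L) L c e M₄ :=
    hsum₃.frame (r₄.rat_eq (by decide)) (r₄.rat_eq (by decide)) (r₄.rat_eq (by decide))
      (r₄.word_eq (by decide)) (r₄.word_eq (by decide))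
  rw [wp_seq]
  refine (addInner_spec (n := n) (ps := ps) (by omega) hcL hLn (innerWeight_zero pen)
    (fun i j hi hj => hp.inj i j hi.le hj.le) hM₄.inner hsum₄).imp_runs ?_
  rintro T₅ M₅ r₅ ⟨hT₅, hin, hout⟩
  have hM₅ := hM₄.runs r₅ (by decide) (by decide)
  have he₅ : EndsMemory G ps L M₅ := by
    refine ⟨fun v => ?_, fun v => ?_, fun v => ?_, fun v => ?_⟩
    · rw [r₅.word_eq (by decide), r₄.word_eq (by decide), r₃.word_eq (by decide),
        r₂.word_eq (by decide), he₁.distFirst]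
    · rw [r₅.rat_eq (by decide), r₄.rat_eq (by decide), r₃.rat_eq (by decide),
        r₂.rat_eq (by decide), he₁.countFirst]
    · rw [r₅.word_eq (by decide), r₄.word_eq (by decide), r₃.word_eq (by decide),
        r₂.word_eq (by decide), he₁.distLast]
    · rw [r₅.rat_eq (by decide), r₄.rat_eq (by decide), r₃.rat_eq (by decide),
        r₂.rat_eq (by decide), he₁.countLast]
  refine (addOuter_spec (by omega) hG hM₅.graph.size hM₅.last he₅).imp ?_
  rintro T₆ M₆ ⟨hT₆, h⟩
  refine ⟨by omega, fun v => ?_⟩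
  have h1 : ∀ j, M₄.rat 1 j = M.rat 1 j := fun j => by
    rw [r₄.rat_eq (by decide), r₃.rat_eq (by decide), r₂.rat_eq (by decide),
      r₁.rat_eq (by decide)]
  have h7' : M₅.rat 7 0 = indirectTotal (innerWeight pen ps L) L c e := by
    rw [r₅.rat_eq (by decide), h7]
  rw [h v, h7']
  -- Inner vertices receive zero from the outer pass, and all other vertices are untouched by the
  -- inner one.
  by_cases hv : ∃ r, (0 < r ∧ r < L) ∧ ps r = v
  · obtain ⟨r, ⟨h0, hr⟩, rfl⟩ := hv
    rw [hp.indirectTotal_mul_visitShare hG pen h0 hr hc he, hin r h0 hr, h7, h1,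
      hp.pairSum_inner hG pen h0 hr hc he]
    ring
  · have hv' : ∀ r, 0 < r → r < L → ps r ≠ v := fun r h0 hr heq => hv ⟨r, ⟨h0, hr⟩, heq⟩
    rw [hout v hv', h1, hp.pairSum_outer hG pen hv' hc he]

end AddPath

/-! ### Following a path -/

namespace WordExpr

/-- The degree of a vertex. -/
@[reducible] def deg (v : WordExpr) : WordExpr := .sub (.get 1 (.add v (.const 1))) (.get 1 v)

/-- A test for `e = f`. -/
@[reducible] def eq (e f : WordExpr) : WordExpr := .sub (.const 1) (ne e f)

end WordExpr

namespace Prog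

open WordExpr

/-- Append the vertex `15` to the path and go on to its neighbour other than `16`. -/
def followStep : Prog :=
  .seq (.setWord 12 (var 13) (var 15))
    (.seq (setVar 19 (.get 2 (.get 1 (var 15))))
      (.seq (.cond (ne (var 19) (var 16)) .skip
          (setVar 19 (.get 2 (.add (.get 1 (var 15)) (.const 1)))))
        (.seq (setVar 16 (var 15)) (.seq (setVar 15 (var 19))
          (setVar 13 (.add (var 13) (.const 1)))))))

/-- Follow the path that starts with the edge from `14` to `18` along vertices of degree two. -/
def followPath : Prog :=
  .seq (.seq (setVar 16 (var 14)) (.seq (setVar 15 (var 18)) (setVar 13 (.const 1))))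
    (.loop (eq (deg (var 15)) (.const 2)) followStep)

/-- Add the contribution of the path that starts with the edge from `14` to `18`. -/
def addDart : Prog := .seq followPath (.cond (lt (var 14) (var 15)) addPath .skip)

end Prog

section Follow

variable {n B : ℕ} {G : SimpleGraph (Fin n)} {adj : Fin n → List (Fin n)} {pen : Fin n → ℕ}
  {M : Memory}

theorem length_adj (hadj : IsAdjacencyList G adj) (x : Fin n) [Fintype (G.neighborSet x)] :
    (adj x).length = G.degree x := by
  rw [← List.toFinset_card_of_nodup (hadj x).1, ← SimpleGraph.card_neighborFinset_eq_degree]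
  congr 1
  ext y
  simp [(hadj x).2 y]

open Classical in
theorem IsChain.extend {V : Type*} [Fintype V] {G : SimpleGraph V} {ps : ℕ → V} {k : ℕ}
    (h : IsChain G ps k) (hk : 0 < k) (hd : G.degree (ps k) = 2) {z : V} (hz : G.Adj (ps k) z)
    (hne : ps (k - 1) ≠ z) : IsChain G (Function.update ps (k + 1) z) (k + 1) := by
  have hold : ∀ i, i ≤ k → Function.update ps (k + 1) z i = ps i := fun i hi =>
    Function.update_of_ne (by omega) _ _
  refine ⟨fun i hi => ?_, fun i h0 hi => ?_, fun i h0 hi => ?_, ?_⟩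
  · rcases (show i < k ∨ i = k by omega) with h1 | rfl
    · rw [hold i (by omega), hold (i + 1) (by omega)]
      exact h.adj i h1
    · rw [hold i le_rfl, Function.update_self]
      exact hz
  · rw [hold i (by omega)]
    rcases (show i < k ∨ i = k by omega) with h1 | rfl
    · exact h.degree_inner i h0 h1
    · exact hd
  · rcases (show i < k ∨ i = k by omega) with h1 | rfl
    · rw [hold (i - 1) (by omega), hold (i + 1) (by omega)]
      exact h.turn i h0 h1
    · rw [hold (i - 1) (by omega), Function.update_self]
      exact hne
  · rw [hold 0 (by omega)]
    exact h.degree_start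

/-- The memory while a path is followed. -/
structure FollowMemory (adj : Fin n → List (Fin n)) (ps : ℕ → Fin n) (k : ℕ) (M : Memory) :
    Prop where
  graph : HasGraph adj M
  length : M.word 13 0 = k
  inner : ∀ i, 0 < i → i < k → M.word 12 i = ps i
  last : M.word 15 0 = ps k
  previous : M.word 16 0 = ps (k - 1)

open Classical in
theorem followStep_spec (hB : totalLength adj + 10 * n + 100 ≤ B)
    (hadj : IsAdjacencyList G adj) {ps : ℕ → Fin n} {k : ℕ} (hk : 0 < k)
    (hM : FollowMemory adj ps k M) (hc : IsChain G ps k) (hd : (adj (ps k)).length = 2) :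
    Wp B .followStep M fun T M' => T ≤ 60 ∧ ∃ z, FollowMemory adj (Function.update ps (k + 1) z)
      (k + 1) M' ∧ IsChain G (Function.update ps (k + 1) z) (k + 1) := by
  have hkn : k ≤ n := by simpa using hc.length_le
  have hbs := blockStart_add_le adj (ps k)
  have h0 := hM.graph.nbr (ps k) 0 (by omega)
  have h1 := hM.graph.nbr (ps k) 1 (by omega)
  have hst := hM.graph.start (ps k)
  have hp := (ps k).2
  have hp' := (ps (k - 1)).2
  have ha0 : G.Adj (ps k) (adj (ps k))[0] := ((hadj _).2 _).1 (List.getElem_mem _)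
  have ha1 : G.Adj (ps k) (adj (ps k))[1] := ((hadj _).2 _).1 (List.getElem_mem _)
  have hne : (adj (ps k))[0] ≠ (adj (ps k))[1] := fun e => by
    have := (List.Nodup.getElem_inj_iff (hadj (ps k)).1).1 e
    omega
  have hdeg : G.degree (ps k) = 2 := by rw [← length_adj hadj, hd]
  generalize (adj (ps k))[0] = a at *
  generalize (adj (ps k))[1] = b at *
  have ha := a.2
  have hb := b.2
  have fin : ∀ (z : Fin n) (M' : Memory), (∀ i, M'.word 0 i = M.word 0 i) →
      (∀ i, M'.word 1 i = M.word 1 i) → (∀ i, M'.word 2 i = M.word 2 i) →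
      (∀ i, M'.word 12 i = if i = k then ↑(ps k) else M.word 12 i) → M'.word 13 0 = k + 1 →
      M'.word 15 0 = z → M'.word 16 0 = ps k →
      FollowMemory adj (Function.update ps (k + 1) z) (k + 1) M' := by
    intro z M' e0 e1 e2 e12 e13 e15 e16
    have hold : ∀ i, i ≤ k → Function.update ps (k + 1) z i = ps i := fun i hi =>
      Function.update_of_ne (by omega) _ _
    refine ⟨hM.graph.frame e0 e1 e2, e13, fun i h0 hi => ?_, by simp [e15], ?_⟩
    · rw [e12, hold i (by omega)]
      split_ifs with h
      · rw [h]
      · exact hM.inner i h0 (by omega)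
    · rw [e16, Nat.add_sub_cancel, hold k le_rfl]
  rw [add_zero] at h0
  rw [Prog.followStep]
  simp [hM.length, hM.last, hM.previous, hst, h0, h1]
  refine ⟨by omega, by omega, by omega, by omega, fun hap => ⟨by omega, by omega, by omega, a, ?_, ?_⟩,
    fun h2 h3 => ⟨by omega, by omega, by omega, by omega, b, ?_, ?_⟩⟩
  · apply fin <;> simp
  · exact hc.extend hk hdeg ha0 fun e => by
      have := congrArg Fin.val e
      omega
  · apply fin <;> simp
  · refine hc.extend hk hdeg ha1 fun e => hne (Fin.ext ?_)
    have := congrArg Fin.val e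
    omega

open Classical in
theorem followPath_spec (hB : totalLength adj + 10 * n + 100 ≤ B)
    (hadj : IsAdjacencyList G adj) {u y : Fin n} (hM : HasGraph adj M) (h14 : M.word 14 0 = u)
    (h18 : M.word 18 0 = y) (hu : G.degree u ≠ 2) (huy : G.Adj u y) :
    Wp B .followPath M fun T M' => T ≤ 100 * n + 100 ∧ ∃ ps L, FollowMemory adj ps L M' ∧
      IsChain G ps L ∧ 0 < L ∧ ps 0 = u ∧ ps 1 = y ∧ G.degree (ps L) ≠ 2 := by
  have hu2 := u.2
  have hy2 := y.2
  rw [Prog.followPath, wp_seq]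
  obtain ⟨qs, hqs⟩ : ∃ qs : ℕ → Fin n, qs = fun i => if i = 0 then u else y := ⟨_, rfl⟩
  have setup : Wp B (.seq (.setVar 16 (.var 14)) (.seq (.setVar 15 (.var 18))
      (.setVar 13 (.const 1)))) M fun T M' => T ≤ 30 ∧ FollowMemory adj qs 1 M' := by
    simp [h14, h18]
    refine ⟨by omega, by omega, by omega, ?_⟩
    exact ⟨hM.frame (by simp) (by simp) (by simp), by simp, fun i h0 hi => absurd h0 (by omega),
      by simp [hqs], by simp [hqs]⟩
  refine setup.imp ?_
  rintro T₁ M₁ ⟨hT₁, hM₁⟩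
  -- The number of rounds is unknown, but a chain has length at most `n`, so `n - s.1` bounds the
  -- remaining ones.
  refine (wp_loop (fun (s : ℕ × (ℕ → Fin n)) M => FollowMemory adj s.2 s.1 M ∧
    IsChain G s.2 s.1 ∧ 0 < s.1 ∧ s.2 0 = u ∧ s.2 1 = y)
    (fun s => (n - s.1) * 100 + 40) ?_ (1, qs) M₁ ⟨hM₁, ?_, by simp, by simp [hqs],
      by simp [hqs]⟩).imp ?_
  · rintro ⟨k, ps⟩ M ⟨hM, hc, hk, h0, h1⟩
    simp only at hM hc hk h0 h1
    have hbs := blockStart_add_le adj (ps k)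
    have hp := (ps k).2
    have hkn : k ≤ n := by simpa using hc.length_le
    simp [hM.last, hM.graph.start, hM.graph.finish]
    refine ⟨by omega, fun hne => ?_⟩
    refine (followStep_spec hB hadj hk hM hc (by omega)).imp ?_
    rintro T M' ⟨hT, z, hM', hc'⟩
    have hkn' : k + 1 ≤ n := by simpa using hc'.length_le
    refine ⟨k + 1, ⟨_, hM', hc', by omega, ?_, ?_⟩, by omega⟩
    · rw [Function.update_of_ne (by omega), h0]
    · rw [Function.update_of_ne (by omega), h1]
  · refine ⟨fun i hi => ?_, fun i h0 hi => absurd h0 (by omega),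
      fun i h0 hi => absurd h0 (by omega),
      by rwa [show (1, qs).2 0 = u by simp [hqs]]⟩
    obtain rfl : i = 0 := by simpa using hi
    simpa [hqs] using huy
  · rintro T M' ⟨hT, ⟨k, ps⟩, ⟨hM, hc, hk, h0, h1⟩, hb⟩
    simp only at hM hc hk h0 h1
    refine ⟨by simp only at hT; omega, ps, k, hM, hc, hk, h0, h1, ?_⟩
    rw [← length_adj hadj]
    simp [hM.last, hM.graph.start, hM.graph.finish] at hb
    omega

-- A path is followed from both of its ends; the comparison of the ends lets one of the two
-- directions pass. The same comparison discards chains that return to `u`, which are not paths.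
open Classical in
theorem addDart_spec (hB : totalLength adj + 10 * n + 100 ≤ B) (hG : G.Connected)
    (hadj : IsAdjacencyList G adj) {u y : Fin n} (hM : HasGraph adj M)
    (hpen : ∀ v : Fin n, M.rat 0 v = pen v) (h14 : M.word 14 0 = u)
    (h18 : M.word 18 0 = y) (hu : G.degree u ≠ 2) (huy : G.Adj u y) (hy : G.degree y = 2) :
    Wp B .addDart M fun T M' => T ≤ 1200 * (totalLength adj + n) + 1200 ∧
      ∀ v : Fin n, M'.rat 1 v = M.rat 1 v + dartSum G pen u y v := by
  have hu2 := u.2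
  rw [Prog.addDart, wp_seq]
  refine (followPath_spec hB hadj hM h14 h18 hu huy).imp_runs ?_
  rintro T₁ M₁ r₁ ⟨hT₁, ps, L, hM₁, hc, hL, h0, h1, hd⟩
  have hps := (ps L).2
  have h14' : M₁.word 14 0 = u := by rw [r₁.word_eq (by decide), h14]
  have hr1 : ∀ j, M₁.rat 1 j = M.rat 1 j := r₁.rat_eq (by decide)
  rw [wp_cond]
  simp only [WordExpr.eval, h14', hM₁.last]
  refine ⟨by simp [h14', hM₁.last]; omega, fun hlt => ?_, fun hge => ?_⟩
  · have hlt' : u < ps L := by rw [Fin.lt_def]; omega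
    -- The second vertex `y` has degree two and the last one does not.
    have h2 : 2 ≤ L := by
      by_contra hcon
      obtain rfl : L = 1 := by omega
      exact hd (h1 ▸ hy)
    have hp := hc.isTraversal h2 hd (h0 ▸ hlt'.ne)
    refine (addPath_spec (pen := pen) hB hG hadj hp ⟨hM₁.graph, fun v => ?_, hM₁.length, hM₁.inner,
      h0 ▸ h14', hM₁.last⟩).imp ?_
    · rw [r₁.rat_eq (by decide), hpen]
    · rintro T M' ⟨hT, h⟩
      refine ⟨by simp; omega, fun v => ?_⟩
      rw [h v, hr1, dartSum_eq_pairSum ⟨hp, h0, h1, hlt'⟩]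
  · rw [wp_skip]
    refine ⟨by simp; omega, fun v => ?_⟩
    rw [hr1, dartSum_eq_zero hc hL h0 h1 hd, add_zero]
    rw [Fin.lt_def]
    omega

end Follow

/-! ### The main program -/

namespace Prog

open WordExpr

/-- Process the edge from `14` to the neighbour that is read from cell `17`. -/
def dartStep : Prog :=
  .seq (setVar 18 (.get 2 (var 17)))
    (.seq (.cond (eq (deg (var 18)) (.const 2)) addDart .skip)
      (setVar 17 (.add (var 17) (.const 1))))

/-- Process all edges at the vertex `14`, if its degree is not two. -/
def vertexStep : Prog :=
  .seq (.cond (ne (deg (var 14)) (.const 2))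
      (.seq (setVar 17 (.get 1 (var 14)))
        (.loop (lt (var 17) (.get 1 (.add (var 14) (.const 1)))) dartStep)) .skip)
    (setVar 14 (.add (var 14) (.const 1)))

/-- The sums over all maximal induced paths, for all vertices. -/
def samePathSums : Prog := .seq (setVar 14 (.const 0)) (.loop (lt (var 14) (var 0)) vertexStep)

end Prog

section Main

variable {n B : ℕ} {G : SimpleGraph (Fin n)} {adj : Fin n → List (Fin n)} {pen : Fin n → ℕ}
  {M : Memory}

/-- The number of neighbours of `u` of degree two. -/
def thinNeighbors (adj : Fin n → List (Fin n)) (u : Fin n) : ℕ :=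
  ((adj u).map fun y => if (adj y).length = 2 then 1 else 0).sum

/-- The number of edges from a vertex whose degree is not two to a vertex of degree two. -/
def thinDarts (adj : Fin n → List (Fin n)) : ℕ :=
  ∑ u, if (adj u).length ≠ 2 then thinNeighbors adj u else 0

open Classical in
theorem dartStep_spec (hB : totalLength adj + 10 * n + 100 ≤ B) (hG : G.Connected)
    (hadj : IsAdjacencyList G adj) {u : Fin n} {p : ℕ} (hp : p < (adj u).length)
    (hM : HasGraph adj M) (hpen : ∀ v : Fin n, M.rat 0 v = pen v) (h14 : M.word 14 0 = u)
    (h17 : M.word 17 0 = blockStart adj u + p) (hu : (adj u).length ≠ 2) :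
    Wp B .dartStep M fun T M' => T ≤ 60 + (1200 * (totalLength adj + n) + 1200) *
        (if (adj (adj u)[p]).length = 2 then 1 else 0) ∧
      HasGraph adj M' ∧ (∀ v : Fin n, M'.rat 0 v = pen v) ∧ M'.word 14 0 = u ∧
      M'.word 17 0 = blockStart adj u + (p + 1) ∧
      ∀ v : Fin n, M'.rat 1 v = M.rat 1 v + dartSum G pen u (adj u)[p] v := by
  have hbs := blockStart_add_le adj u
  have hnb := hM.nbr u p hp
  have huy : G.Adj u (adj u)[p] := ((hadj u).2 _).1 (List.getElem_mem hp)
  generalize (adj u)[p] = y at *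
  have hy := y.2
  have hbsy := blockStart_add_le adj y
  rw [Prog.dartStep, wp_seq, wp_setWord]
  refine ⟨by simp, by simp [h17, hnb]; omega, ?_⟩
  simp only [WordExpr.eval, h17, hnb]
  obtain ⟨M₁, hM₁⟩ : ∃ M₁, M₁ = M.setWord 18 0 (y : ℕ) := ⟨_, rfl⟩
  rw [← hM₁]
  have hg₁ : HasGraph adj M₁ := hM.frame (by simp [hM₁]) (by simp [hM₁]) (by simp [hM₁])
  have e18 : M₁.word 18 0 = y := by simp [hM₁]
  have e14 : M₁.word 14 0 = u := by simp [hM₁, h14]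
  have e17 : M₁.word 17 0 = blockStart adj u + p := by simp [hM₁, h17]
  have epen : ∀ v : Fin n, M₁.rat 0 v = pen v := by simp [hM₁, hpen]
  have eout : ∀ j, M₁.rat 1 j = M.rat 1 j := by simp [hM₁]
  have hu' : G.degree u ≠ 2 := by rwa [← length_adj hadj]
  have mid : Wp B (.cond (.eq (.deg (.var 18)) (.const 2)) .addDart .skip) M₁ fun T M' =>
      T ≤ 40 + (1200 * (totalLength adj + n) + 1200) * (if (adj y).length = 2 then 1 else 0) ∧
      ∀ v : Fin n, M'.rat 1 v = M.rat 1 v + dartSum G pen u y v := by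
    rw [wp_cond]
    simp only [WordExpr.eval, e18, hg₁.start, hg₁.finish]
    refine ⟨by simp [e18, hg₁.start, hg₁.finish]; omega, fun h2 => ?_, fun h2 => ?_⟩
    · have h2 : (adj y).length = 2 := by omega
      refine (addDart_spec hB hG hadj hg₁ epen e14 e18 hu' huy
        (by rw [← length_adj hadj, h2])).imp ?_
      rintro T M' ⟨hT, h⟩
      rw [if_pos h2]
      refine ⟨by simp; omega, fun v => by rw [h v, eout]⟩
    · have h2 : (adj y).length ≠ 2 := by omega
      rw [wp_skip, if_neg h2]
      refine ⟨by simp, fun v => ?_⟩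
      rw [eout, dartSum, dif_neg, add_zero]
      rintro ⟨ps, L, hs⟩
      have := hs.1.degree_inner 1 (by omega) hs.1.two_le
      rw [hs.2.2.1, ← length_adj hadj] at this
      exact h2 this
  rw [wp_seq]
  refine mid.imp_runs ?_
  rintro T M' r ⟨hT, h⟩
  have f17 : M'.word 17 0 = blockStart adj u + p := by rw [r.word_eq (by decide), e17]
  have f14 : M'.word 14 0 = u := by rw [r.word_eq (by decide), e14]
  have fpen : ∀ v : Fin n, M'.rat 0 v = pen v := fun v => by rw [r.rat_eq (by decide), epen]
  have hg' : HasGraph adj M' := hg₁.runs r (by decide)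
  -- The nonlinear cost term is made opaque so that `omega` can treat the rest.
  generalize (1200 * (totalLength adj + n) + 1200) *
    (if (adj y).length = 2 then 1 else 0) = X at *
  simp [f17, f14, fpen, h]
  refine ⟨by omega, by omega, hg'.frame (by simp) (by simp) (by simp), by omega⟩

theorem sum_getD_eq {V : Type*} (l : List V) (a : V) (f : V → ℕ) :
    ∑ p ∈ Finset.range l.length, f (l.getD p a) = (l.map f).sum := by
  induction l with
  | nil => simp
  | cons b l ih =>
    rw [List.length_cons, Finset.sum_range_succ', List.map_cons, List.sum_cons, ← ih, add_comm]
    simp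

open Classical in
theorem vertexStep_spec (hB : totalLength adj + 10 * n + 100 ≤ B) (hG : G.Connected)
    (hadj : IsAdjacencyList G adj) {u : Fin n}
    (hM : HasGraph adj M) (hpen : ∀ v : Fin n, M.rat 0 v = pen v) (h14 : M.word 14 0 = u) :
    Wp B .vertexStep M fun T M' => T ≤ 80 * (adj u).length + 80 +
        (1200 * (totalLength adj + n) + 1200) *
        (if (adj u).length ≠ 2 then thinNeighbors adj u else 0) ∧
      HasGraph adj M' ∧ (∀ v : Fin n, M'.rat 0 v = pen v) ∧ M'.word 14 0 = u + 1 ∧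
      ∀ v : Fin n, M'.rat 1 v = M.rat 1 v + ∑ y, dartSum G pen u y v := by
  have hbs := blockStart_add_le adj u
  have hu := u.2
  have mid : Wp B (.cond (.ne (.deg (.var 14)) (.const 2)) (.seq (.setVar 17 (.get 1 (.var 14)))
      (.loop (.lt (.var 17) (.get 1 (.add (.var 14) (.const 1)))) .dartStep)) .skip) M fun T M' =>
      T ≤ 80 * (adj u).length + 60 + (1200 * (totalLength adj + n) + 1200) *
        (if (adj u).length ≠ 2 then thinNeighbors adj u else 0) ∧
      HasGraph adj M' ∧ (∀ v : Fin n, M'.rat 0 v = pen v) ∧ M'.word 14 0 = u ∧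
      ∀ v : Fin n, M'.rat 1 v = M.rat 1 v + ∑ y, dartSum G pen u y v := by
    rw [wp_cond]
    simp only [WordExpr.eval, h14, hM.start, hM.finish]
    refine ⟨by simp [h14, hM.start, hM.finish]; omega, fun h2 => ?_, fun h2 => ?_⟩
    · have h2 : (adj u).length ≠ 2 := by omega
      rw [wp_seq, wp_setWord]
      refine ⟨by simp, by simp [h14, hM.start]; omega, ?_⟩
      refine (wp_for (adj u).length (fun p M' => HasGraph adj M' ∧
        (∀ v : Fin n, M'.rat 0 v = pen v) ∧ M'.word 14 0 = u ∧
        M'.word 17 0 = blockStart adj u + p ∧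
        ∀ v : Fin n, M'.rat 1 v = M.rat 1 v + (((adj u).take p).map fun y => dartSum G pen u y v).sum)
        (fun p => 60 + (1200 * (totalLength adj + n) + 1200) *
          (if (adj ((adj u).getD p u)).length = 2 then 1 else 0)) ?_ ?_ _ ?_).imp ?_
      · rintro p M' hp ⟨hg, -, h14', h17, -⟩
        simp [h14', h17, hg.finish]
        omega
      · rintro p M' hp ⟨hg, hpen', h14', h17, h⟩
        rw [List.getD_eq_getElem _ _ hp]
        refine (dartStep_spec hB hG hadj hp hg hpen' h14' h17 h2).imp ?_
        rintro T M'' ⟨hT, hg', hpen'', h14'', h17', h'⟩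
        refine ⟨hT, hg', hpen'', h14'', h17', fun v => ?_⟩
        rw [h' v, h v, List.take_succ_eq_append_getElem hp, List.map_append, List.sum_append]
        simp [add_assoc]
      · exact ⟨hM.frame (by simp) (by simp) (by simp), by simpa using hpen, by simp [h14],
          by simp [h14, hM.start], by simp⟩
      · rintro T M' ⟨hT, hg, hpen', h14', -, h⟩
        refine ⟨?_, hg, hpen', h14', fun v => ?_⟩
        · rw [Finset.sum_add_distrib, Finset.sum_add_distrib, ← Finset.mul_sum,
            sum_getD_eq (adj u) u fun y => if (adj y).length = 2 then 1 else 0,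
            ← thinNeighbors] at hT
          rw [if_pos h2]
          generalize (1200 * (totalLength adj + n) + 1200) * thinNeighbors adj u = X at *
          simp at hT ⊢
          omega
        · rw [h v, List.take_length, sum_map_adj hadj]
          congr 1
          refine Finset.sum_congr rfl fun y _ => ?_
          split_ifs with huy
          · rfl
          · rw [dartSum, dif_neg]
            rintro ⟨ps, L, hs⟩
            have := hs.1.adj 0 (by have := hs.1.two_le; omega)
            rw [zero_add, hs.2.1, hs.2.2.1] at this
            exact huy this
    · have h2 : (adj u).length = 2 := by omega
      rw [wp_skip]
      refine ⟨by simp; omega, hM, hpen, h14, fun v => ?_⟩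
      rw [Finset.sum_eq_zero, add_zero]
      intro y _
      rw [dartSum, dif_neg]
      rintro ⟨ps, L, hs⟩
      have := hs.1.degree_start
      rw [hs.2.1, ← length_adj hadj] at this
      exact this h2
  rw [Prog.vertexStep, wp_seq]
  refine mid.imp ?_
  rintro T M' ⟨hT, hg, hpen', h14', h⟩
  generalize (1200 * (totalLength adj + n) + 1200) *
    (if (adj u).length ≠ 2 then thinNeighbors adj u else 0) = X at *
  simp [h14', hpen', h]
  exact ⟨by omega, by omega, hg.frame (by simp) (by simp) (by simp)⟩

/-- Searches are paid for only at the directed edges counted by `thinDarts`; everything else is a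
single scan of the adjacency lists. -/
theorem samePathSums_spec (hB : totalLength adj + 10 * n + 100 ≤ B) (hG : G.Connected)
    (hadj : IsAdjacencyList G adj) (pen : Fin n → ℕ) :
    Wp B .samePathSums (inputMemory adj pen) fun T M' =>
      T ≤ 80 * totalLength adj + 100 * n + 100 +
        (1200 * (totalLength adj + n) + 1200) * thinDarts adj ∧
      ∀ v : Fin n, M'.rat 1 v = samePathSum G pen v := by
  rw [Prog.samePathSums, wp_seq, wp_setWord]
  refine ⟨by simp, by simp, ?_⟩
  have hn : 0 < n := by
    obtain ⟨v⟩ := hG.nonempty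
    exact v.pos
  refine (wp_for n (fun k M => HasGraph adj M ∧ (∀ v : Fin n, M.rat 0 v = pen v) ∧
    M.word 14 0 = k ∧ ∀ v : Fin n, M.rat 1 v =
      ∑ u : Fin n, if (u : ℕ) < k then ∑ y, dartSum G pen u y v else 0)
    (fun k => if h : k < n then 80 * (adj ⟨k, h⟩).length + 80 +
        (1200 * (totalLength adj + n) + 1200) *
        (if (adj ⟨k, h⟩).length ≠ 2 then thinNeighbors adj ⟨k, h⟩ else 0) else 0)
    ?_ ?_ _ ?_).imp ?_
  · rintro k M hk ⟨hg, -, h14, -⟩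
    simp [h14, hg.size]
    omega
  · rintro k M hk ⟨hg, hpen, h14, h⟩
    rw [dif_pos hk]
    refine (vertexStep_spec hB hG hadj (u := ⟨k, hk⟩) hg hpen h14).imp ?_
    rintro T M' ⟨hT, hg', hpen', h14', h'⟩
    refine ⟨hT, hg', hpen', h14', fun v => ?_⟩
    rw [h' v, h v, ← Finset.sum_ite_eq_of_mem' Finset.univ (⟨k, hk⟩ : Fin n)
      (fun u => ∑ y, dartSum G pen u y v) (Finset.mem_univ _), ← Finset.sum_add_distrib]
    refine Finset.sum_congr rfl fun u _ => ?_
    rcases lt_trichotomy (u : ℕ) k with h1 | h1 | h1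
    · rw [if_pos h1, if_neg (by rw [Fin.ext_iff]; exact h1.ne), if_pos (by omega), add_zero]
    · rw [if_neg (by omega), if_pos (Fin.ext h1), if_pos (by omega), zero_add]
    · rw [if_neg (by omega), if_neg (by rw [Fin.ext_iff]; exact h1.ne'), if_neg (by omega),
        add_zero]
  · refine ⟨(hasGraph_inputMemory adj pen).frame (by simp) (by simp) (by simp), ?_, by simp, ?_⟩
    · simp [inputMemory]
    · simp [inputMemory]
  · rintro T M' ⟨hT, -, -, -, h⟩
    refine ⟨?_, fun v => ?_⟩
    · rw [Finset.sum_range] at hT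
      simp only [Fin.is_lt, dif_pos, Fin.eta, Finset.sum_add_distrib, ← Finset.mul_sum,
        ← totalLength.eq_1, ← thinDarts.eq_1] at hT
      generalize (1200 * (totalLength adj + n) + 1200) * thinDarts adj = X at *
      simp at hT ⊢
      omega
    · rw [h v, samePathSum_eq_sum_dartSum hG]
      exact Finset.sum_congr rfl fun u _ => if_pos u.2

end Main

/-! ### The running time in terms of the feedback edge number -/

open Classical in
/-- A connected graph has at most `n - 1 + k` edges. -/
theorem card_edgeFinset_lt {V : Type*} [Fintype V] {G : SimpleGraph V} (hG : G.Connected) :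
    G.edgeFinset.card + 1 ≤ Fintype.card V + feedbackEdgeNumber G := by
  obtain ⟨F, -, hF, hc⟩ : feedbackEdgeNumber G ∈ {c | ∃ F : Finset (Sym2 V),
      (F : Set (Sym2 V)) ⊆ G.edgeSet ∧ (G.deleteEdges (F : Set (Sym2 V))).IsAcyclic ∧
      F.card = c} := by
    refine Nat.sInf_mem ⟨_, G.edgeFinset, by simp, ?_, rfl⟩
    simp [SimpleGraph.isAcyclic_bot]
  -- The forest left by an optimal deletion extends to a spanning tree, so every edge lies in this
  -- tree or was deleted.
  obtain ⟨T, hT, -, htree⟩ :=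
    hG.exists_isTree_le_of_le_of_isAcyclic (SimpleGraph.deleteEdges_le _) hF
  have hsub : G.edgeFinset ⊆ T.edgeFinset ∪ F := by
    intro e he
    by_cases heF : e ∈ F
    · simp [heF]
    · refine Finset.mem_union_left _ (SimpleGraph.mem_edgeFinset.2 ?_)
      refine SimpleGraph.edgeSet_mono hT ?_
      rw [SimpleGraph.edgeSet_deleteEdges]
      exact ⟨SimpleGraph.mem_edgeFinset.1 he, by simpa using heF⟩
  have h1 := Finset.card_le_card hsub
  have h2 := Finset.card_union_le T.edgeFinset F
  have h3 := htree.card_edgeFinset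
  omega

-- Besides some neighbour `a` of `v` there is a third vertex. Without `a` the graph is still
-- connected, so `v` has a neighbour other than `a`.
open Classical in
theorem IsBiconnected.two_le_degree {V : Type*} [Fintype V] {G : SimpleGraph V}
    (hG : IsBiconnected G) (hV : 3 ≤ Fintype.card V) (v : V) : 2 ≤ G.degree v := by
  have : Nontrivial V := Fintype.one_lt_card_iff_nontrivial.1 (by omega)
  obtain ⟨a, ha⟩ := hG.1.preconnected.exists_adj_of_nontrivial v
  obtain ⟨z, hz⟩ : ∃ z, z ∉ ({v, a} : Finset V) := by
    by_contra! h
    have := Finset.card_le_card (fun x _ => h x : Finset.univ ⊆ ({v, a} : Finset V))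
    have := Finset.card_le_two (a := v) (b := a)
    rw [Finset.card_univ] at *
    omega
  simp only [Finset.mem_insert, Finset.mem_singleton, not_or] at hz
  have hpre : (G.induce {a}ᶜ).Preconnected := not_not.1 (hG.2 a)
  have hva : v ∈ ({a}ᶜ : Set V) := by simpa using ha.ne
  have hza : z ∈ ({a}ᶜ : Set V) := by simpa using hz.2
  have : Nontrivial ({a}ᶜ : Set V) := ⟨⟨v, hva⟩, ⟨z, hza⟩, fun h => hz.1 (congrArg (·.1) h).symm⟩
  obtain ⟨⟨b, hb⟩, hvb⟩ := hpre.exists_adj_of_nontrivial ⟨v, hva⟩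
  have hvb : G.Adj v b := hvb
  have hab : a ≠ b := fun h => hb h.symm
  rw [← SimpleGraph.card_neighborFinset_eq_degree, ← Finset.card_pair hab]
  refine Finset.card_le_card fun x hx => ?_
  rw [SimpleGraph.mem_neighborFinset]
  simp only [Finset.mem_insert, Finset.mem_singleton] at hx
  rcases hx with rfl | rfl <;> assumption

/-! ### Bounds on the number of thin darts and on the running time. -/

section Counting

variable {n : ℕ} {G : SimpleGraph (Fin n)} {adj : Fin n → List (Fin n)}

open Classical in
theorem totalLength_eq (hadj : IsAdjacencyList G adj) :
    totalLength adj = 2 * G.edgeFinset.card := by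
  rw [← SimpleGraph.sum_degrees_eq_twice_card_edges, totalLength]
  exact Finset.sum_congr rfl fun v _ => length_adj hadj v

theorem totalLength_le_sq (hadj : IsAdjacencyList G adj) : totalLength adj ≤ n * n := by
  refine (Finset.sum_le_card_nsmul _ _ n fun v _ => ?_).trans (by simp)
  simpa using (hadj v).1.length_le_card

theorem thinNeighbors_le (adj : Fin n → List (Fin n)) (u : Fin n) :
    thinNeighbors adj u ≤ (adj u).length := by
  refine (List.sum_le_card_nsmul _ 1 ?_).trans (by simp)
  intro x hx
  obtain ⟨y, -, rfl⟩ := List.mem_map.1 hx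
  split_ifs <;> simp

/-- A vertex of degree `d ≥ 3` is the start of at most `d ≤ 3 * (d - 2)` thin darts, one of degree
two of none. The sum of all `d - 2` is `2(m - n)`, which the feedback edge number controls. -/
theorem thinDarts_le_excess (h : ∀ v, 2 ≤ (adj v).length) :
    thinDarts adj + 6 * n ≤ 3 * totalLength adj := by
  have : ∑ u : Fin n, ((if (adj u).length ≠ 2 then thinNeighbors adj u else 0) + 6) ≤
      ∑ u, 3 * (adj u).length := by
    refine Finset.sum_le_sum fun u _ => ?_
    have := h u
    have := thinNeighbors_le adj u
    split_ifs <;> omega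
  rw [Finset.sum_add_distrib, ← Finset.mul_sum] at this
  simpa [thinDarts, totalLength, mul_comm] using this

-- Counted at the end of degree two, each vertex is entered at most twice.
open Classical in
theorem thinDarts_le_two_mul (hadj : IsAdjacencyList G adj) : thinDarts adj ≤ 2 * n := by
  calc thinDarts adj ≤ ∑ u, thinNeighbors adj u :=
        Finset.sum_le_sum fun u _ => by split_ifs <;> simp
    _ = ∑ y, ∑ u, if G.Adj y u then (if (adj y).length = 2 then 1 else 0) else 0 := by
        rw [Finset.sum_comm]
        refine Finset.sum_congr rfl fun u _ => ?_
        simp only [thinNeighbors, sum_map_adj hadj, G.adj_comm u]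
    _ ≤ ∑ _y : Fin n, 2 := by
        refine Finset.sum_le_sum fun y _ => ?_
        rw [← sum_map_adj hadj y fun _ => if (adj y).length = 2 then 1 else 0]
        split_ifs with h <;> simp [h]
    _ = 2 * n := by simp [mul_comm]

/-- Here `E` is twice the number of edges and `X` the number of thin darts. The two bounds on `E`
force `1 ≤ k`, and with `hX'` they give `X ≤ 6 * k`. In `(3 * n + 2 * k) * X` this bound serves the
term with `n`, and `X ≤ 2 * n` the term with `k`. -/
theorem running_time_le {n k E X : ℕ} (hn : 3 ≤ n) (hE : E + 2 ≤ 2 * (n + k)) (hE' : 2 * n ≤ E)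
    (hX : X ≤ 2 * n) (hX' : X + 6 * n ≤ 3 * E) :
    80 * E + 100 * n + 100 + (1200 * (E + n) + 1200) * X ≤ 40000 * (k * n) := by
  have hk : 1 ≤ k := by omega
  have hn' : n ≤ k * n := Nat.le_mul_of_pos_left n hk
  have hk' : k ≤ k * n := Nat.le_mul_of_pos_right k (by omega)
  have hXk : X ≤ 6 * k := by omega
  have h1 : n * X ≤ 6 * (k * n) := by nlinarith
  have h2 : k * X ≤ 2 * (k * n) := by nlinarith
  have h3 : (E + n) * X ≤ (3 * n + 2 * k) * X := Nat.mul_le_mul_right X (by omega)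
  nlinarith

end Counting

end BetweennessPaths

open BetweennessPaths in
theorem mainTheorem3 :
    ∃ (prog : Prog) (C d : ℕ),
      ∀ (n : ℕ) (G : SimpleGraph (Fin n)) (adj : Fin n → List (Fin n)) (pen : Fin n → ℕ),
        3 ≤ n → IsBiconnected G → IsAdjacencyList G adj →
          ∃ (T : ℕ) (M : Memory),
            Runs (n ^ d) prog (inputMemory adj pen) T M ∧
            T ≤ C * (feedbackEdgeNumber G * n) ∧
            ∀ v : Fin n, M.rat 1 v = samePathSum G pen v := by
  classical
  refine ⟨.samePathSums, 40000, 8, fun n G adj pen hn hG hadj => ?_⟩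
  have hdeg : ∀ v, 2 ≤ (adj v).length := fun v => by
    rw [length_adj hadj]
    exact hG.two_le_degree (by simpa using hn) v
  -- The exponent has to absorb the constants for every `n ≥ 3`: then `n ^ 8` is at least `729 * n ^
  -- 2`.
  have hB : totalLength adj + 10 * n + 100 ≤ n ^ 8 := by
    have h1 := totalLength_le_sq hadj
    have h2 : 9 ≤ n ^ 2 := by nlinarith
    have h3 : 729 * n ^ 2 ≤ n ^ 8 := by
      calc 729 * n ^ 2 = 9 ^ 3 * n ^ 2 := by norm_num
        _ ≤ (n ^ 2) ^ 3 * n ^ 2 := by gcongr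
        _ = n ^ 8 := by ring
    nlinarith
  obtain ⟨T, M, hrun, hT, h⟩ := samePathSums_spec hB hG.1 hadj pen
  refine ⟨T, M, hrun, hT.trans ?_, h⟩
  have hE := totalLength_eq hadj
  have hm := card_edgeFinset_lt hG.1
  have hlow : 2 * n ≤ totalLength adj := by
    have := Finset.card_nsmul_le_sum Finset.univ (fun v => (adj v).length) 2 fun v _ => hdeg v
    simpa [totalLength, mul_comm] using this
  rw [Fintype.card_fin] at hm
  exact running_time_le hn (by omega) hlow (thinDarts_le_two_mul hadj) (thinDarts_le_excess hdeg)
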